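/- For integers $1\le k<n$ let $g_k:[0,1]^n\to[0,1]$ be $g_k(t)=t_{[k]}-t_{[k+1]}+t_{[n]}$, where $t_{[i]}$ is the $i$-th largest entry of $t$. Mixture selection for $g_k$ is the problem: given an $n\times m$ matrix $A$ with (rational) entries in $[0,1]$, $m\ge 1$, find $x$ in the simplex $\Delta_m=\{x\in\mathbb R^m: x\ge 0,\ \sum_j x_j=1\}$ maximizing $g_k(Ax)$. For a function $k=k(n)$ and $\epsilon>0$, an additive $\epsilon$-approximation algorithm outputs, for all such $A$ with $1\le k(n)<n$ (where $k=k(n)$, $n$ being the number of rows of $A$), some $x\in\Delta_m$ with $g_k(Ax)\ge\max_{y\in\Delta_m}g_k(Ay)-\epsilon$; an additive PTAS consists of a deterministic additive $\epsilon$-approximation algorithm for every constant $\epsilon>0$, each running in time polynomial in the bit length of $A$. Let $\mathcal G(n,\frac12)$ be the random graph on $n$ vertices in which each edge is included independently with probability $\frac12$, and let $\mathcal G(n,\frac12,k)$ be obtained from it by adding all edges inside a uniformly random set of $k$ vertices. **Theorem.** Let $k=k(n)$ be a function from the natural numbers to the natural numbers with $k=\omega(\log^2 n)$ and $k=o(\sqrt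 n)$. 1. Whenever $1\le k<n$, $g_k$ maps $[0,1]^n$ into $[0,1]$ and is $3$-Lipschitz with respect to the $L^\infty$ metric. It is not $O(1)$-stable: for every constant $\beta\ge 0$ and all sufficiently large $n$, $g_{k}$ is not $\beta$-stable. Here $g:[0,1]^n\to[0,1]$ is $\beta$-stable if $\mathbb E_{R\sim\mathcal D}\big[\min\{g(t'): t'\in[0,1]^n,\ t'_i=t_i\ \text{for all } i\notin R\}\big]\ge g(t)-\alpha\beta$ for all $t\in[0,1]^n$, all $\alpha\in(0,1]$ and all distributions $\mathcal D$ over subsets of $\{1,\dots,n\}$ with $\Pr_{R\sim\mathcal D}[i\in R]\le\alpha$ for every $i$. 2. For every constant $\epsilon>0$, with probability $1-o(1)$ over $G\sim\mathcal G(n,\frac12,k)$, there is an $x\in\Delta_n$ with $g_k(Ax)\ge 1-\epsilon$, where $A$ is the adjacency matrix of $G$; this holds simultaneously for every choice of the diagonal entries of $A$ in $\{0,1\}$ (self-loops), with $x$ allowed to depend on that choice. 3. For every constant $\epsilon>0$, with probability $1-o(1)$ over $G\sim\mathcal G(n,\frac12)$, $g_k(Ax)\le\frac34+\epsilon$ for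 all $x\in\Delta_n$, where $A$ is the adjacency matrix of $G$; this again holds simultaneously for every choice of the diagonal entries of $A$ in $\{0,1\}$. 4. Suppose that no probabilistic polynomial-time algorithm distinguishes $\mathcal G(n,\frac12)$ from $\mathcal G(n,\frac12,k)$ with success probability $1-o(1)$, i.e. that there is no probabilistic polynomial-time algorithm whose probability of rejecting $G\sim\mathcal G(n,\frac12)$ and whose probability of accepting $G\sim\mathcal G(n,\frac12,k)$ both tend to $1$ as $n\to\infty$. Then there is no additive PTAS for mixture selection for $g_{k(n)}$. -/

import Mathlib

open MeasureTheory Filter Topology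
open scoped ENNReal

namespace MixSel

/-! ### A random access machine with logarithmic cost

A program works on finitely many named unbounded arrays of natural numbers. Every evaluation of a
subexpression is charged one unit plus the bit length of its value, so that running times agree
with Turing machine running times up to a polynomial. -/

/-- Memory: `σ v i` is the content of cell `i` of the array with name `v`. -/
abbrev Store := ℕ → ℕ → ℕ

inductive Expr : Type
  | lit (c : ℕ)
  | get (v : ℕ) (i : Expr)
  | add (a b : Expr)
  | sub (a b : Expr)
  | mul (a b : Expr)
  | div (a b : Expr)

/-- The value of an expression (`sub` is truncated subtraction, `div` is the rounded-down quotient,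
with quotient `0` for divisor `0`). -/
def Expr.eval (σ : Store) : Expr → ℕ
  | .lit c => c
  | .get v i => σ v (i.eval σ)
  | .add a b => a.eval σ + b.eval σ
  | .sub a b => a.eval σ - b.eval σ
  | .mul a b => a.eval σ * b.eval σ
  | .div a b => a.eval σ / b.eval σ

/-- The cost of evaluating an expression; `Nat.size` is the bit length. -/
def Expr.cost (σ : Store) : Expr → ℕ
  | .lit c => 1 + c.size
  | .get v i => i.cost σ + 1 + (σ v (i.eval σ)).size
  | .add a b => a.cost σ + b.cost σ + 1 + (a.eval σ + b.eval σ).size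
  | .sub a b => a.cost σ + b.cost σ + 1 + (a.eval σ - b.eval σ).size
  | .mul a b => a.cost σ + b.cost σ + 1 + (a.eval σ * b.eval σ).size
  | .div a b => a.cost σ + b.cost σ + 1 + (a.eval σ / b.eval σ).size

/-- Programs: `set v i e` stores the value of `e` in cell `i` of array `v`; `ite c p q` runs `p` if
`c` is nonzero and `q` otherwise; `loop c p` runs `p` as long as `c` is nonzero. -/
inductive Prog : Type
  | skip
  | set (v : ℕ) (i e : Expr)
  | seq (p q : Prog)
  | ite (c : Expr) (p q : Prog)
  | loop (c : Expr) (p : Prog)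

/-- `Runs p σ τ T`: started in memory `σ`, the program `p` halts with memory `τ` after time `T`. -/
inductive Runs : Prog → Store → Store → ℕ → Prop
  | skip (σ : Store) : Runs .skip σ σ 1
  | set (v : ℕ) (i e : Expr) (σ : Store) :
      Runs (.set v i e) σ
        (Function.update σ v (Function.update (σ v) (i.eval σ) (e.eval σ)))
        (i.cost σ + e.cost σ + 1)
  | seq {p q : Prog} {σ ρ τ : Store} {S T : ℕ} :
      Runs p σ ρ S → Runs q ρ τ T → Runs (.seq p q) σ τ (S + T + 1)
  | ite_true {c : Expr} {p q : Prog} {σ τ : Store} {T : ℕ} :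
      c.eval σ ≠ 0 → Runs p σ τ T → Runs (.ite c p q) σ τ (c.cost σ + T + 1)
  | ite_false {c : Expr} {p q : Prog} {σ τ : Store} {T : ℕ} :
      c.eval σ = 0 → Runs q σ τ T → Runs (.ite c p q) σ τ (c.cost σ + T + 1)
  | loop_true {c : Expr} {p : Prog} {σ ρ τ : Store} {S T : ℕ} :
      c.eval σ ≠ 0 → Runs p σ ρ S → Runs (.loop c p) ρ τ T →
        Runs (.loop c p) σ τ (c.cost σ + S + T + 1)
  | loop_false {c : Expr} {p : Prog} {σ : Store} :
      c.eval σ = 0 → Runs (.loop c p) σ σ (c.cost σ + 1)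

/-! ### Mixture selection -/

/-- The unit cube `[0,1]^n`. -/
def cube (n : ℕ) : Set (Fin n → ℝ) := {t | ∀ i, t i ∈ Set.Icc (0 : ℝ) 1}

/-- `t_[i]`, the `i`-th largest entry of `t` (`1 ≤ i ≤ n`; the value is `0` for other `i`). -/
noncomputable def nthLargest {n : ℕ} (t : Fin n → ℝ) (i : ℕ) : ℝ :=
  if h : 1 ≤ i ∧ i ≤ n then t (Tuple.sort t ⟨n - i, by omega⟩) else 0

/-- `t_[k] - t_[k+1] + t_[n]`. -/
noncomputable def gClique (n k : ℕ) (t : Fin n → ℝ) : ℝ :=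
  nthLargest t k - nthLargest t (k + 1) + nthLargest t n

/-- Lipschitz continuity with constant `c` in `L^∞` (the norm of `Fin n → ℝ` is the maximum norm)
of a function on the unit cube. -/
def IsLipschitz {n : ℕ} (c : ℝ) (g : (Fin n → ℝ) → ℝ) : Prop :=
  ∀ t ∈ cube n, ∀ t' ∈ cube n, |g t - g t'| ≤ c * ‖t - t'‖

/-- A distribution over subsets of `Fin n` is `α`-light if no element is contained in the random
subset with probability larger than `α`. -/
def IsLight {n : ℕ} (α : ℝ) (D : PMF (Finset (Fin n))) : Prop :=
  ∀ i, D.toOuterMeasure {R | i ∈ R} ≤ ENNReal.ofReal α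

/-- `β`-noise stability of a function on the unit cube. -/
def IsStable {n : ℕ} (β : ℝ) (g : (Fin n → ℝ) → ℝ) : Prop :=
  ∀ t ∈ cube n, ∀ α : ℝ, 0 < α → α ≤ 1 → ∀ D : PMF (Finset (Fin n)), IsLight α D →
    g t - α * β ≤
      ∑ R, (D R).toReal * sInf (g '' {t' | t' ∈ cube n ∧ ∀ i, i ∉ R → t' i = t i})

/-- Input layout for a rational matrix with entries in `[0,1]`: array `0` holds the dimensions,
arrays `1` and `2` hold the numerators and denominators (in lowest terms) of the entries, row by
row; every other cell is `0`. -/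
def matrixStore {n m : ℕ} (A : Matrix (Fin n) (Fin m) ℚ) : Store := fun v a =>
  match v with
  | 0 => if a = 0 then n else if a = 1 then m else 0
  | 1 => if h : a < n * m then
      (A (finProdFinEquiv.symm ⟨a, h⟩).1 (finProdFinEquiv.symm ⟨a, h⟩).2).num.natAbs else 0
  | 2 => if h : a < n * m then
      (A (finProdFinEquiv.symm ⟨a, h⟩).1 (finProdFinEquiv.symm ⟨a, h⟩).2).den else 0
  | _ => 0

/-- The bit length of a rational matrix with nonnegative entries. -/
def matrixSize {n m : ℕ} (A : Matrix (Fin n) (Fin m) ℚ) : ℕ :=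
  n + m + ∑ i, ∑ j, ((A i j).num.natAbs.size + (A i j).den.size)

/-- Output layout for a vector: numerators in array `3`, denominators in array `4`. -/
noncomputable def outputVec (m : ℕ) (τ : Store) : Fin m → ℝ :=
  fun j => (τ 3 j : ℝ) / (τ 4 j : ℝ)

/-- `g(A x)`. -/
noncomputable def mixValue {n m : ℕ} (g : (Fin n → ℝ) → ℝ) (A : Matrix (Fin n) (Fin m) ℝ)
    (x : Fin m → ℝ) : ℝ :=
  g (A.mulVec x)

/-- The deterministic program `P` is a polynomial-time additive `ε`-approximation algorithm for
mixture selection for the functions `g n : [0,1]^n → [0,1]`, `n ∈ N`: on every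
`n × m` matrix `A` with `n ∈ N`, `m ≥ 1` and rational entries in `[0,1]` it outputs `x` in the
simplex with `g(A x) ≥ max_y g(A y) - ε`, in time polynomial in the bit length of `A`. -/
def IsPolyTimeApprox (N : Set ℕ) (g : (n : ℕ) → (Fin n → ℝ) → ℝ) (ε : ℝ) (P : Prog) : Prop :=
  ∃ p : Polynomial ℕ, ∀ n ∈ N, ∀ m : ℕ, 1 ≤ m → ∀ A : Matrix (Fin n) (Fin m) ℚ,
    (∀ i j, A i j ∈ Set.Icc (0 : ℚ) 1) →
    ∃ τ T, Runs P (matrixStore A) τ T ∧ T ≤ p.eval (matrixSize A) ∧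
      outputVec m τ ∈ stdSimplex ℝ (Fin m) ∧
      ∀ y ∈ stdSimplex ℝ (Fin m),
        mixValue (g n) (A.map (fun a : ℚ => (a : ℝ))) y - ε ≤
          mixValue (g n) (A.map (fun a : ℚ => (a : ℝ))) (outputVec m τ)

/-- An additive PTAS: for every constant `ε > 0`, a polynomial-time additive `ε`-approximation
algorithm. -/
def HasAdditivePTAS (N : Set ℕ) (g : (n : ℕ) → (Fin n → ℝ) → ℝ) : Prop :=
  ∀ ε : ℝ, 0 < ε → ∃ P : Prog, IsPolyTimeApprox N g ε P

/-! ### Planted cliques -/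

/-- The number `1/2` as an edge probability. -/
noncomputable def half : unitInterval := ⟨1 / 2, by norm_num, by norm_num⟩

instance discreteMeasurableSpace_graph (n : ℕ) : DiscreteMeasurableSpace (SimpleGraph (Fin n)) := by
  have : MeasurableSingletonClass (SimpleGraph (Fin n)) := by
    constructor
    intro G
    have h := (SimpleGraph.measurable_adj (V := Fin n)) (MeasurableSet.singleton G.Adj)
    convert h using 1
    ext H
    exact SimpleGraph.adj_inj.symm
  infer_instance

/-- The random graph `G(n, 1/2)`. -/
noncomputable def randomGraph (n : ℕ) : Measure (SimpleGraph (Fin n)) :=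
  SimpleGraph.binomialRandom (Fin n) half

/-- The graph whose edges are all pairs of distinct elements of `C`. -/
def cliqueOn {n : ℕ} (C : Finset (Fin n)) : SimpleGraph (Fin n) where
  Adj i j := i ≠ j ∧ i ∈ C ∧ j ∈ C
  symm := ⟨fun _ _ h => ⟨h.1.symm, h.2.2, h.2.1⟩⟩
  loopless := ⟨fun _ h => h.1 rfl⟩

/-- The random graph `G(n, 1/2, k)`: all edges inside a uniformly random set of `k` vertices
are added to `G(n, 1/2)`. It is the zero measure for `k > n`. -/
noncomputable def plantedGraph (n k : ℕ) : Measure (SimpleGraph (Fin n)) :=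
  ((n.choose k : ℝ≥0∞)⁻¹) •
    ∑ C ∈ Finset.powersetCard k (Finset.univ : Finset (Fin n)),
      (randomGraph n).map (fun G => G ⊔ cliqueOn C)

theorem isProbabilityMeasure_plantedGraph {n k : ℕ} (h : k ≤ n) :
    IsProbabilityMeasure (plantedGraph n k) := by
  constructor
  have hp : IsProbabilityMeasure (randomGraph n) := by unfold randomGraph; infer_instance
  have h1 : ∀ C : Finset (Fin n),
      (randomGraph n).map (fun G => G ⊔ cliqueOn C) Set.univ = 1 := fun C => by
    rw [Measure.map_apply (Measurable.of_discrete) MeasurableSet.univ]; simp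
  have h2 : (n.choose k : ℝ≥0∞) ≠ 0 := by
    exact_mod_cast (Nat.choose_pos h).ne'
  simp only [plantedGraph, Measure.smul_apply, Measure.finsetSum_apply, h1, Finset.sum_const,
    Finset.card_powersetCard, Finset.card_univ, Fintype.card_fin, smul_eq_mul, nsmul_eq_mul,
    mul_one]
  exact ENNReal.inv_mul_cancel h2 (ENNReal.natCast_ne_top _)

open Classical in
/-- The adjacency matrix of `G`, with a self-loop at `i` if `d i` is true. -/
noncomputable def adjLoops {n : ℕ} (G : SimpleGraph (Fin n)) (d : Fin n → Bool) :
    Matrix (Fin n) (Fin n) ℝ :=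
  fun i j => if i = j then (if d i then 1 else 0) else if G.Adj i j then 1 else 0

open Classical in
/-- Input layout for a graph and a string of coin flips: cell `0` of array `0` holds the number `n`
of vertices, array `1` the adjacency matrix, row by row, and array `2` the coin flips; every other
cell is `0`. -/
noncomputable def graphStore {n q : ℕ} (G : SimpleGraph (Fin n)) (r : Fin q → Bool) : Store :=
  fun v a =>
    match v with
    | 0 => if a = 0 then n else 0
    | 1 => if h : a < n * n then
        (if G.Adj (finProdFinEquiv.symm ⟨a, h⟩).1 (finProdFinEquiv.symm ⟨a, h⟩).2 then 1 else 0)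
        else 0
    | 2 => if h : a < q then (if r ⟨a, h⟩ then 1 else 0) else 0
    | _ => 0

/-- `P` halts with a nonzero number in cell `0` of array `3`. -/
def Accepts (P : Prog) (σ : Store) : Prop := ∃ τ T, Runs P σ τ T ∧ τ 3 0 ≠ 0

/-- `P` halts with zero in cell `0` of array `3`. -/
def Rejects (P : Prog) (σ : Store) : Prop := ∃ τ T, Runs P σ τ T ∧ τ 3 0 = 0

/-- The probability that `P`, using `q` uniform independent coin flips, accepts a random graph. -/
noncomputable def acceptProb {n : ℕ} (P : Prog) (q : ℕ) (μ : Measure (SimpleGraph (Fin n))) :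
    ℝ≥0∞ :=
  ∫⁻ G, ProbabilityTheory.uniformOn Set.univ {r : Fin q → Bool | Accepts P (graphStore G r)} ∂μ

/-- The probability that `P`, using `q` uniform independent coin flips, rejects a random graph. -/
noncomputable def rejectProb {n : ℕ} (P : Prog) (q : ℕ) (μ : Measure (SimpleGraph (Fin n))) :
    ℝ≥0∞ :=
  ∫⁻ G, ProbabilityTheory.uniformOn Set.univ {r : Fin q → Bool | Rejects P (graphStore G r)} ∂μ

/-- `P`, using `q(n)` coin flips on graphs with `n` vertices, runs in polynomial time. -/
def IsPolyTimeOnGraphs (P : Prog) (q : Polynomial ℕ) : Prop :=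
  ∃ p : Polynomial ℕ, ∀ (n : ℕ) (G : SimpleGraph (Fin n)) (r : Fin (q.eval n) → Bool),
    ∃ τ T, Runs P (graphStore G r) τ T ∧ T ≤ p.eval n

/-- The planted clique assumption for the clique size `k(n)`: no probabilistic polynomial-time
algorithm distinguishes `G(n, 1/2)` from `G(n, 1/2, k(n))` with success probability `1 - o(1)`. -/
def PlantedCliqueAssumption (k : ℕ → ℕ) : Prop :=
  ¬ ∃ (P : Prog) (q : Polynomial ℕ), IsPolyTimeOnGraphs P q ∧
    Tendsto (fun n => rejectProb P (q.eval n) (randomGraph n)) atTop (𝓝 1) ∧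
    Tendsto (fun n => acceptProb P (q.eval n) (plantedGraph n (k n))) atTop (𝓝 1)

end MixSel

/-! Write `t = A x`. When a clique is planted, the uniform distribution on it gives the clique rows
value almost 1 and, by a Chernoff bound, all other rows value about 1/2. So `t_[k]` is near 1 while
`t_[k+1]` and `t_[n]` cancel (`le_mixValue_unifVec`, `plantedGraph_optimum`).

On a random graph every mixture is close, in every row, to the empirical distribution of a sample of
`r = O(log n)` columns (`exists_sample`). A union bound over the `n ^ r` samples then suffices if
each one fails with probability `2 ^ (-c log² n)` for a large `c`; this is where `k = ω(log² n)`
enters. For a fixed sample with weights `y`, the rows outside the support are independent uniform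
bit vectors on the support (`sum_adjB`). If some `y j > 1/4`, symmetry puts more than `k` rows at
`1/2 + y j / 2` or above and some row at `1/2 - y j / 2` or below, so the value is at most `1 - y
j`. If all weights are at most 1/4, a value above 3/4 requires `t_[k] > 3/4` and an empty window of
length 1/4 just below it. An isoperimetric inequality on the hypercube
(`card_le_two_mul_card_boundary`) says that the tail above the window is at most twice as likely as
the window. Hence nearly `k` rows in the tail and none in the window occur with probability at most
`(2/3) ^ (k - r)` (`randomGraph_gap_le`).

For hardness, the approximation algorithm is run on the adjacency matrix and its output is tested
for value at least 7/8. The function `k` need not be computable, so the test accepts any size in a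
computable range; `randomGraph_optimum` therefore treats all sizes in a range at once. The test is
written as a term with bounded sums, and such terms compile to programs with polynomial running time
(`Term.stores_compile`).

Instability is witnessed by the indicator of a `k`-set, where changing any single coordinate drops
the value from 1 to 0. -/

namespace MixSel

/-! ### Order statistics -/

theorem card_le_nthLargest {n : ℕ} (t : Fin n → ℝ) {i : ℕ} (h1 : 1 ≤ i) (hn : i ≤ n) :
    i ≤ (Finset.univ.filter fun a => nthLargest t i ≤ t a).card := by
  have hp : n - i < n := by omega
  have hval : nthLargest t i = t (Tuple.sort t ⟨n - i, hp⟩) := by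
    simp [nthLargest, h1, hn]
  calc i = ((Finset.Ici (⟨n - i, hp⟩ : Fin n)).map (Tuple.sort t).toEmbedding).card := by
        rw [Finset.card_map, Fin.card_Ici]; simp; omega
    _ ≤ _ := by
        apply Finset.card_le_card
        intro a ha
        simp only [Finset.mem_map, Finset.mem_Ici, Equiv.coe_toEmbedding] at ha
        obtain ⟨q, hq, rfl⟩ := ha
        simp only [Finset.mem_filter, Finset.mem_univ, true_and, hval]
        exact Tuple.monotone_sort t hq

theorem card_nthLargest_lt {n : ℕ} (t : Fin n → ℝ) {i : ℕ} (h1 : 1 ≤ i) (hn : i ≤ n) :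
    (Finset.univ.filter fun a => nthLargest t i < t a).card < i := by
  have hp : n - i < n := by omega
  have hval : nthLargest t i = t (Tuple.sort t ⟨n - i, hp⟩) := by
    simp [nthLargest, h1, hn]
  have : (Finset.univ.filter fun a => nthLargest t i < t a).card ≤
      ((Finset.Ioi (⟨n - i, hp⟩ : Fin n)).map (Tuple.sort t).toEmbedding).card := by
    apply Finset.card_le_card
    intro a ha
    simp only [Finset.mem_filter, Finset.mem_univ, true_and, hval] at ha
    simp only [Finset.mem_map, Finset.mem_Ioi, Equiv.coe_toEmbedding]
    refine ⟨(Tuple.sort t).symm a, ?_, by simp⟩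
    by_contra hc
    have := Tuple.monotone_sort t (not_lt.1 hc)
    simp only [Function.comp, Equiv.apply_symm_apply] at this
    linarith
  rw [Finset.card_map, Fin.card_Ioi] at this
  simp only at this
  omega

/-- This equivalence turns order statistics into counts of entries above a threshold, the form in
which they are compared below. -/
theorem le_nthLargest_iff {n : ℕ} (t : Fin n → ℝ) {i : ℕ} (h1 : 1 ≤ i) (hn : i ≤ n) (u : ℝ) :
    u ≤ nthLargest t i ↔ i ≤ (Finset.univ.filter fun a => u ≤ t a).card := by
  constructor
  · intro h
    refine (card_le_nthLargest t h1 hn).trans (Finset.card_le_card ?_)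
    intro a
    simp only [Finset.mem_filter, Finset.mem_univ, true_and]
    exact h.trans
  · intro h
    by_contra hc
    have h2 := card_nthLargest_lt t h1 hn
    have h3 : (Finset.univ.filter fun a => u ≤ t a).card ≤
        (Finset.univ.filter fun a => nthLargest t i < t a).card := by
      apply Finset.card_le_card
      intro a
      simp only [Finset.mem_filter, Finset.mem_univ, true_and]
      exact (not_le.1 hc).trans_le
    omega

theorem exists_eq_nthLargest {n : ℕ} (t : Fin n → ℝ) {i : ℕ} (h1 : 1 ≤ i) (hn : i ≤ n) :
    ∃ a, t a = nthLargest t i :=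
  ⟨_, by simp [nthLargest, h1, hn]; rfl⟩

theorem nthLargest_anti {n : ℕ} (t : Fin n → ℝ) {i j : ℕ} (h1 : 1 ≤ i) (hij : i ≤ j) (hn : j ≤ n) :
    nthLargest t j ≤ nthLargest t i := by
  rw [le_nthLargest_iff t h1 (hij.trans hn)]
  exact hij.trans (card_le_nthLargest t (h1.trans hij) hn)

theorem le_nthLargest_self_iff {n : ℕ} (t : Fin n → ℝ) (hn : 1 ≤ n) (u : ℝ) :
    u ≤ nthLargest t n ↔ ∀ a, u ≤ t a := by
  rw [le_nthLargest_iff t hn le_rfl]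
  constructor
  · intro h a
    have h2 : (Finset.univ.filter fun a => u ≤ t a) = Finset.univ := by
      apply Finset.eq_univ_of_card
      apply le_antisymm (Finset.card_le_univ _)
      simpa using h
    have := Finset.mem_univ a
    rw [← h2] at this
    simpa using this
  · intro h
    simp [h]

theorem nthLargest_self_le {n : ℕ} (t : Fin n → ℝ) (a : Fin n) : nthLargest t n ≤ t a :=
  (le_nthLargest_self_iff t a.pos _).1 le_rfl a

/-- No entry lies strictly between two consecutive order statistics. -/
theorem nthLargest_le_of_lt {n k : ℕ} (t : Fin n → ℝ) (h1 : 1 ≤ k) (hn : k < n) (a : Fin n)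
    (h : nthLargest t (k + 1) < t a) : nthLargest t k ≤ t a := by
  by_contra hc
  push Not at hc
  have h2 := card_le_nthLargest t h1 hn.le
  have h3 : ¬ t a ≤ nthLargest t (k + 1) := not_le.2 h
  rw [le_nthLargest_iff t (by omega) hn] at h3
  -- The `k` entries at or above `t_[k]` all exceed `t a`, and `a` is one more index: `k + 1`
  -- entries at or above `t a`, contrary to `h3`.
  have h4 : (Finset.univ.filter fun b => nthLargest t k ≤ t b).card <
      (Finset.univ.filter fun b => t a ≤ t b).card := by
    apply Finset.card_lt_card
    rw [Finset.ssubset_iff_of_subset]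
    · exact ⟨a, by simp, by simpa using hc⟩
    · intro b
      simp only [Finset.mem_filter, Finset.mem_univ, true_and]
      exact hc.le.trans
  omega

theorem nthLargest_le_add {n i : ℕ} (t t' : Fin n → ℝ) (δ : ℝ) (h : ∀ a, t a ≤ t' a + δ)
    (h1 : 1 ≤ i) (hn : i ≤ n) : nthLargest t i ≤ nthLargest t' i + δ := by
  rw [← sub_le_iff_le_add, le_nthLargest_iff t' h1 hn]
  refine (card_le_nthLargest t h1 hn).trans (Finset.card_le_card ?_)
  intro a
  simp only [Finset.mem_filter, Finset.mem_univ, true_and]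
  intro ha
  linarith [h a]

theorem abs_nthLargest_sub_le {n i : ℕ} (t t' : Fin n → ℝ) (δ : ℝ) (h : ∀ a, |t a - t' a| ≤ δ)
    (h1 : 1 ≤ i) (hn : i ≤ n) : |nthLargest t i - nthLargest t' i| ≤ δ := by
  have a1 := nthLargest_le_add t t' δ (fun a => by linarith [(abs_le.1 (h a)).2]) h1 hn
  have a2 := nthLargest_le_add t' t δ (fun a => by linarith [(abs_le.1 (h a)).1]) h1 hn
  rw [abs_le]; constructor <;> linarith

theorem abs_gClique_sub_le {n k : ℕ} (t t' : Fin n → ℝ) (δ : ℝ) (h : ∀ a, |t a - t' a| ≤ δ)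
    (h1 : 1 ≤ k) (hn : k < n) : |gClique n k t - gClique n k t'| ≤ 3 * δ := by
  have a1 := abs_le.1 (abs_nthLargest_sub_le t t' δ h h1 hn.le)
  have a2 := abs_le.1 (abs_nthLargest_sub_le t t' δ h (i := k + 1) (by omega) hn)
  have a3 := abs_le.1 (abs_nthLargest_sub_le t t' δ h (i := n) (by omega) le_rfl)
  unfold gClique
  rw [abs_le]; constructor <;> linarith [a1.1, a1.2, a2.1, a2.2, a3.1, a3.2]

theorem nthLargest_mem_Icc {n i : ℕ} {t : Fin n → ℝ} (ht : t ∈ cube n) (h1 : 1 ≤ i) (hn : i ≤ n) :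
    nthLargest t i ∈ Set.Icc (0 : ℝ) 1 := by
  obtain ⟨a, ha⟩ := exists_eq_nthLargest t h1 hn
  rw [← ha]
  exact ht a

theorem mapsTo_gClique {n k : ℕ} (h1 : 1 ≤ k) (hn : k < n) :
    Set.MapsTo (gClique n k) (cube n) (Set.Icc 0 1) := by
  intro t ht
  have a1 := nthLargest_mem_Icc ht h1 hn.le
  have a3 := nthLargest_mem_Icc ht (i := n) (by omega) le_rfl
  have b1 := nthLargest_anti t h1 (Nat.le_succ k) hn
  have b2 := nthLargest_anti t (Nat.succ_pos k) hn le_rfl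
  simp only [Nat.succ_eq_add_one] at b1 b2
  unfold gClique
  constructor <;> linarith [a1.1, a1.2, a3.1, a3.2]

theorem isLipschitz_gClique {n k : ℕ} (h1 : 1 ≤ k) (hn : k < n) :
    IsLipschitz 3 (gClique n k) := by
  intro t _ t' _
  apply abs_gClique_sub_le t t' _ _ h1 hn
  intro a
  exact norm_le_pi_norm (t - t') a

/-! ### Instability -/

theorem nthLargest_eq_zero {n i : ℕ} {t : Fin n → ℝ} (ht : t ∈ cube n) (h1 : 1 ≤ i) (hn : i ≤ n)
    (S : Finset (Fin n)) (hS : ∀ a, a ∉ S → t a = 0) (hc : S.card < i) : nthLargest t i = 0 := by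
  apply le_antisymm _ (nthLargest_mem_Icc ht h1 hn).1
  by_contra h
  have h2 := card_le_nthLargest t h1 hn
  have h3 := h2.trans (Finset.card_le_card (t := S) fun a ha => by
    simp only [Finset.mem_filter, Finset.mem_univ, true_and] at ha
    by_contra haS
    rw [hS a haS] at ha
    exact h ha)
  omega

theorem nthLargest_eq_one {n i : ℕ} {t : Fin n → ℝ} (ht : t ∈ cube n) (h1 : 1 ≤ i) (hn : i ≤ n)
    (S : Finset (Fin n)) (hS : ∀ a ∈ S, t a = 1) (hc : i ≤ S.card) : nthLargest t i = 1 := by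
  apply le_antisymm (nthLargest_mem_Icc ht h1 hn).2
  rw [le_nthLargest_iff t h1 hn]
  refine hc.trans (Finset.card_le_card fun a ha => ?_)
  simp [hS a ha]

/-- The indicator vector of a set. -/
noncomputable def indVec {n : ℕ} (S : Finset (Fin n)) : Fin n → ℝ := fun a => if a ∈ S then 1 else 0

theorem indVec_mem_cube {n : ℕ} (S : Finset (Fin n)) : indVec S ∈ cube n := by
  intro a
  unfold indVec
  split_ifs <;> simp

/-- As `S` is a proper subset, `t_[n] = 0`; the remaining difference is 1 exactly when the sorted
vector drops from 1 to 0 between positions `k` and `k + 1`. -/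
theorem gClique_indVec {n k : ℕ} (h1 : 1 ≤ k) (hn : k < n) (S : Finset (Fin n)) (hS : S.card < n) :
    gClique n k (indVec S) = if S.card = k then 1 else 0 := by
  have c := indVec_mem_cube S
  have z : ∀ i, 1 ≤ i → i ≤ n → S.card < i → nthLargest (indVec S) i = 0 := fun i hi hi' hc =>
    nthLargest_eq_zero c hi hi' S (fun a ha => by simp [indVec, ha]) hc
  have o : ∀ i, 1 ≤ i → i ≤ n → i ≤ S.card → nthLargest (indVec S) i = 1 := fun i hi hi' hc =>
    nthLargest_eq_one c hi hi' S (fun a ha => by simp [indVec, ha]) hc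
  unfold gClique
  rw [z n (by omega) le_rfl hS]
  rcases lt_trichotomy S.card k with h | h | h
  · rw [z k h1 hn.le h, z (k + 1) (by omega) hn (by omega), if_neg h.ne]; simp
  · rw [o k h1 hn.le h.ge, z (k + 1) (by omega) hn (by omega), if_pos h]; simp
  · rw [o k h1 hn.le h.le, o (k + 1) (by omega) hn (by omega), if_neg h.ne']; simp

/-- A uniformly random singleton is `1/n`-light. An adversary controlling that one coordinate
changes a `k`-set into one of size `k - 1` or `k + 1`, so the expected minimum is at most 0 and
stability would force `1 ≤ β / n`. The condition `k + 2 ≤ n` keeps the enlarged set proper, so that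
`t_[n]` stays 0. -/
theorem not_isStable_gClique {n k : ℕ} {β : ℝ} (h1 : 1 ≤ k) (hn : k + 2 ≤ n) (hβ : β < n) :
    ¬ IsStable β (gClique n k) := by
  intro h
  have hpos : 0 < n := by omega
  have : Nonempty (Fin n) := ⟨⟨0, hpos⟩⟩
  obtain ⟨S, -, hS⟩ := Finset.exists_subset_card_eq
    (s := (Finset.univ : Finset (Fin n))) (n := k) (by simp; omega)
  have hnR : (0 : ℝ) < n := by exact_mod_cast hpos
  set D : PMF (Finset (Fin n)) := (PMF.uniformOfFintype (Fin n)).map (fun i => {i}) with hD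
  have hlight : IsLight (1 / n : ℝ) D := by
    intro i
    rw [hD, PMF.toOuterMeasure_map_apply]
    have : (fun i : Fin n => ({i} : Finset (Fin n))) ⁻¹' {R | i ∈ R} = {i} := by
      ext j; simp [eq_comm]
    rw [this, PMF.toOuterMeasure_apply_singleton, PMF.uniformOfFintype_apply, Fintype.card_fin,
      one_div, ENNReal.ofReal_inv_of_pos hnR, ENNReal.ofReal_natCast]
  have key := h (indVec S) (indVec_mem_cube S) (1 / n) (by positivity)
    (by rw [div_le_one hnR]; exact_mod_cast hpos) D hlight
  rw [gClique_indVec h1 (by omega) S (by omega), if_pos hS] at key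
  have hle : ∑ R, (D R).toReal * sInf (gClique n k ''
      {t' | t' ∈ cube n ∧ ∀ i, i ∉ R → t' i = indVec S i}) ≤ 0 := by
    apply Finset.sum_nonpos
    intro R _
    by_cases hR : R ∈ D.support
    · rw [hD, PMF.support_map] at hR
      obtain ⟨i, -, rfl⟩ := hR
      apply mul_nonpos_of_nonneg_of_nonpos ENNReal.toReal_nonneg
      have hbdd : BddBelow (gClique n k ''
          {t' | t' ∈ cube n ∧ ∀ j, j ∉ ({i} : Finset (Fin n)) → t' j = indVec S j}) := by
        refine ⟨0, ?_⟩
        rintro _ ⟨t', ht', rfl⟩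
        exact (mapsTo_gClique h1 (by omega) ht'.1).1
      have hmod : ∃ S' : Finset (Fin n), S'.card < n ∧ S'.card ≠ k ∧
          ∀ j, j ≠ i → (j ∈ S' ↔ j ∈ S) := by
        by_cases hi : i ∈ S
        · refine ⟨S.erase i, ?_, ?_, fun j hj => by simp [hj]⟩ <;>
          rw [Finset.card_erase_of_mem hi] <;> omega
        · refine ⟨insert i S, ?_, ?_, fun j hj => by simp [hj]⟩ <;>
          rw [Finset.card_insert_of_notMem hi] <;> omega
      obtain ⟨S', hS1, hS2, hS3⟩ := hmod
      refine csInf_le hbdd ⟨indVec S', ⟨indVec_mem_cube S', ?_⟩, ?_⟩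
      · intro j hj
        have : j ≠ i := by simpa using hj
        simp [indVec, hS3 j this]
      · rw [gClique_indVec h1 (by omega) S' hS1, if_neg hS2]
    · rw [PMF.mem_support_iff, not_not] at hR
      simp [hR]
  have : 1 / n * β < 1 := by
    rw [one_div, inv_mul_lt_iff₀ hnR]; linarith
  linarith

/-! ### Uniform random graphs -/

theorem randomGraph_singleton {n : ℕ} (G : SimpleGraph (Fin n)) :
    randomGraph n {G} = (2⁻¹ : ℝ≥0∞) ^ (n.choose 2) := by
  classical
  have hh : (unitInterval.toNNReal half : ℝ≥0∞) = 2⁻¹ := by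
    rw [show unitInterval.toNNReal half = (2 : NNReal)⁻¹ from by ext; simp [half]]
    simp
  have hh' : (unitInterval.toNNReal (unitInterval.symm half) : ℝ≥0∞) = 2⁻¹ := by
    rw [show unitInterval.toNNReal (unitInterval.symm half) = (2 : NNReal)⁻¹ from by
      ext; simp [half]; norm_num]
    simp
  have hc : G.edgeSet.ncard ≤ n.choose 2 := by
    rw [← SimpleGraph.coe_edgeFinset, Set.ncard_coe_finset]
    simpa using G.card_edgeFinset_le_card_choose_two
  rw [randomGraph, SimpleGraph.binomialRandom_singleton, hh, hh', ← pow_add]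
  congr 1
  simp only [Nat.card_eq_fintype_card, Fintype.card_fin]
  omega

open Classical in
-- Markov's inequality. At edge probability 1/2 all graphs have the same weight, so the expectation
-- is a plain sum over graphs.
theorem randomGraph_le_of_le {n : ℕ} (S : Set (SimpleGraph (Fin n))) (F : SimpleGraph (Fin n) → ℝ)
    (h0 : ∀ G, 0 ≤ F G) (h1 : ∀ G ∈ S, 1 ≤ F G) (c : ℝ)
    (hc : ∑ G, F G ≤ Fintype.card (SimpleGraph (Fin n)) * c) :
    randomGraph n S ≤ ENNReal.ofReal c := by
  have hp : IsProbabilityMeasure (randomGraph n) := by unfold randomGraph; infer_instance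
  set p : ℝ≥0∞ := (2⁻¹ : ℝ≥0∞) ^ (n.choose 2) with hpdef
  have hsum : ∀ T : Finset (SimpleGraph (Fin n)), randomGraph n T = T.card * p := by
    intro T
    rw [← sum_measure_singleton]
    simp [randomGraph_singleton, hpdef]
  have huniv := hsum Finset.univ
  rw [Finset.coe_univ, measure_univ, Finset.card_univ] at huniv
  have hcard : (0 : ℝ) < Fintype.card (SimpleGraph (Fin n)) := by
    exact_mod_cast Fintype.card_pos
  have hp' : p = (Fintype.card (SimpleGraph (Fin n)) : ℝ≥0∞)⁻¹ :=
    ENNReal.eq_inv_of_mul_eq_one_left (by rw [mul_comm]; exact huniv.symm)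
  have hS := hsum S.toFinset
  rw [Set.coe_toFinset] at hS
  have hle : (S.toFinset.card : ℝ) ≤ Fintype.card (SimpleGraph (Fin n)) * c := by
    refine le_trans ?_ hc
    calc (S.toFinset.card : ℝ) = ∑ G ∈ S.toFinset, (1 : ℝ) := by simp
      _ ≤ ∑ G ∈ S.toFinset, F G := Finset.sum_le_sum fun G hG => h1 G (by simpa using hG)
      _ ≤ ∑ G, F G := Finset.sum_le_sum_of_subset_of_nonneg (Finset.subset_univ _)
          fun G _ _ => h0 G
  rw [hS, hp', ← ENNReal.ofReal_natCast, ← ENNReal.ofReal_natCast (Fintype.card _),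
    ← ENNReal.ofReal_inv_of_pos hcard, ← ENNReal.ofReal_mul (by positivity)]
  apply ENNReal.ofReal_le_ofReal
  rw [← div_eq_mul_inv, div_le_iff₀ hcard]
  linarith

open Classical in
/-- The adjacency matrix of a graph with Boolean entries. -/
noncomputable def adjB {n : ℕ} (G : SimpleGraph (Fin n)) : Fin n → Fin n → Bool :=
  fun i j => decide (G.Adj i j)

/-- The graph with edges between `M` and its complement prescribed by `b`. -/
def bipGraph {n : ℕ} (M : Finset (Fin n)) (b : Fin n → Fin n → Bool) : SimpleGraph (Fin n) where
  Adj i j := (i ∉ M ∧ j ∈ M ∧ b i j = true) ∨ (i ∈ M ∧ j ∉ M ∧ b j i = true)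
  symm := ⟨fun _ _ h => by tauto⟩
  loopless := ⟨fun _ h => by tauto⟩

open Classical in
theorem adjB_symmDiff {n : ℕ} (M : Finset (Fin n)) (b : Fin n → Fin n → Bool)
    (G : SimpleGraph (Fin n)) {i j : Fin n} (hi : i ∉ M) (hj : j ∈ M) :
    adjB (symmDiff G (bipGraph M b)) i j = xor (adjB G i j) (b i j) := by
  have : (symmDiff G (bipGraph M b)).Adj i j ↔
      G.Adj i j ∧ b i j = false ∨ b i j = true ∧ ¬ G.Adj i j := by
    simp [symmDiff, bipGraph, hi, hj]
  unfold adjB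
  rw [Bool.eq_iff_iff, decide_eq_true_iff, this]
  by_cases h : G.Adj i j <;> cases b i j <;> simp [h]

open Classical in
/-- The entries in rows outside `M` and columns in `M` of the adjacency matrix of a uniformly random
graph are independent and uniform. -/
theorem sum_adjB {n : ℕ} (M : Finset (Fin n)) (h : (Fin n → Fin n → Bool) → ℝ)
    (hh : ∀ b b', (∀ i, i ∉ M → ∀ j ∈ M, b i j = b' i j) → h b = h b') :
    (Fintype.card (Fin n → Fin n → Bool) : ℝ) * ∑ G, h (adjB G) =
      Fintype.card (SimpleGraph (Fin n)) * ∑ b, h b := by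
  -- Toggling the edges prescribed by `b` between `M` and its complement is an involution on graphs
  -- and hence preserves the sum. Summing over `b` as well replaces the visible entries by
  -- independent uniform bits.
  have h1 : ∀ b : Fin n → Fin n → Bool,
      ∑ G, h (adjB G) = ∑ G, h (fun i j => xor (adjB G i j) (b i j)) := by
    intro b
    have hinv : Function.Involutive fun G : SimpleGraph (Fin n) => symmDiff G (bipGraph M b) :=
      fun G => symmDiff_symmDiff_cancel_right _ _
    rw [← Equiv.sum_comp hinv.toPerm]
    refine Finset.sum_congr rfl fun G _ => hh _ _ fun i hi j hj => ?_
    exact adjB_symmDiff M b G hi hj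
  have h2 : ∀ a : Fin n → Fin n → Bool,
      ∑ b : Fin n → Fin n → Bool, h (fun i j => xor (a i j) (b i j)) = ∑ b, h b := by
    intro a
    have hinv : Function.Involutive
        fun b : Fin n → Fin n → Bool => fun i j => xor (a i j) (b i j) := by
      intro b
      funext i j
      simp
    exact Equiv.sum_comp hinv.toPerm h
  calc (Fintype.card (Fin n → Fin n → Bool) : ℝ) * ∑ G, h (adjB G)
      = ∑ b : Fin n → Fin n → Bool, ∑ G, h (fun i j => xor (adjB G i j) (b i j)) := by
        rw [← Finset.sum_congr rfl fun b _ => h1 b]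
        simp
    _ = ∑ G : SimpleGraph (Fin n), ∑ b, h b := by
        rw [Finset.sum_comm]
        exact Finset.sum_congr rfl fun G _ => h2 _
    _ = _ := by simp

/-- `φ` depends only on the coordinates in `M`. -/
def DepOn {n : ℕ} {α : Type*} (M : Finset (Fin n)) (φ : (Fin n → Bool) → α) : Prop :=
  ∀ w w', (∀ j ∈ M, w j = w' j) → φ w = φ w'

/-- Markov's inequality for a product of functions of the rows outside `M`, restricted to the
columns in `M`. -/
theorem randomGraph_le_of_prod {n : ℕ} (M : Finset (Fin n)) (φ : Fin n → (Fin n → Bool) → ℝ)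
    (c : Fin n → ℝ) (hdep : ∀ i, DepOn M (φ i)) (h0 : ∀ i w, 0 ≤ φ i w)
    (hc : ∀ i, i ∉ M → ∑ w, φ i w ≤ 2 ^ n * c i) (S : Set (SimpleGraph (Fin n))) (D : ℝ)
    (hD : 0 < D) (hS : ∀ G ∈ S, D ≤ ∏ i ∈ Mᶜ, φ i (adjB G i)) :
    randomGraph n S ≤ ENNReal.ofReal ((∏ i ∈ Mᶜ, c i) / D) := by
  classical
  apply randomGraph_le_of_le S (fun G => (∏ i ∈ Mᶜ, φ i (adjB G i)) / D)
  · intro G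
    exact div_nonneg (Finset.prod_nonneg fun i _ => h0 i _) hD.le
  · intro G hG
    rw [le_div_iff₀ hD, one_mul]
    exact hS G hG
  · have key := sum_adjB M (fun b => ∏ i ∈ Mᶜ, φ i (b i)) (by
      intro b b' hb
      refine Finset.prod_congr rfl fun i hi => hdep i _ _ fun j hj => ?_
      exact hb i (Finset.mem_compl.1 hi) j hj)
    -- Giving the rows in `M` the factor 1 extends the product to all rows, so that the sum over
    -- matrices factorizes.
    set ψ : Fin n → (Fin n → Bool) → ℝ := fun i w => if i ∈ M then 1 else φ i w with hψ
    have e1 : ∀ b : Fin n → Fin n → Bool, ∏ i ∈ Mᶜ, φ i (b i) = ∏ i, ψ i (b i) := by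
      intro b
      rw [← Finset.prod_subset (Finset.subset_univ Mᶜ)]
      · refine Finset.prod_congr rfl fun i hi => ?_
        simp [hψ, Finset.mem_compl.1 hi]
      · intro i _ hi
        simp only [Finset.mem_compl, not_not] at hi
        simp [hψ, hi]
    have e2 : ∑ b : Fin n → Fin n → Bool, ∏ i ∈ Mᶜ, φ i (b i) = ∏ i, ∑ w, ψ i w := by
      rw [Finset.prod_univ_sum]
      simp [e1]
    have e3 : ∏ i, ∑ w, ψ i w ≤ ∏ i, (2 ^ n * if i ∈ M then 1 else c i) := by
      apply Finset.prod_le_prod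
      · intro i _
        refine Finset.sum_nonneg fun w _ => ?_
        simp only [hψ]
        split_ifs
        · exact zero_le_one
        · exact h0 i w
      · intro i _
        by_cases hi : i ∈ M
        · simp [hψ, hi]
        · simpa [hψ, hi] using hc i hi
    have e4 : ∏ i : Fin n, ((2 : ℝ) ^ n * if i ∈ M then 1 else c i) =
        Fintype.card (Fin n → Fin n → Bool) * ∏ i ∈ Mᶜ, c i := by
      rw [Finset.prod_mul_distrib]
      congr 1
      · simp
      · rw [← Finset.prod_subset (Finset.subset_univ Mᶜ)]
        · refine Finset.prod_congr rfl fun i hi => ?_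
          simp [Finset.mem_compl.1 hi]
        · intro i _ hi
          simp only [Finset.mem_compl, not_not] at hi
          simp [hi]
    rw [e2] at key
    have hpos : (0 : ℝ) < Fintype.card (Fin n → Fin n → Bool) := by
      exact_mod_cast Fintype.card_pos
    have hfin : ∑ G : SimpleGraph (Fin n), ∏ i ∈ Mᶜ, φ i (adjB G i) ≤
        Fintype.card (SimpleGraph (Fin n)) * ∏ i ∈ Mᶜ, c i := by
      refine le_of_mul_le_mul_left ?_ hpos
      rw [key, mul_left_comm]
      refine mul_le_mul_of_nonneg_left ?_ (Nat.cast_nonneg _)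
      rw [← e4]
      exact e3
    rw [← Finset.sum_div, ← mul_div_assoc]
    gcongr

/-! ### Rows of the adjacency matrix -/

/-- The inner product of the weight vector `y` with the `0`-`1`-vector `w`. -/
noncomputable def rowVal {n : ℕ} (y : Fin n → ℝ) (w : Fin n → Bool) : ℝ :=
  ∑ j, y j * if w j then 1 else 0

/-- Flip the entry `j` of `w`. -/
def flipAt {n : ℕ} (j : Fin n) (w : Fin n → Bool) : Fin n → Bool := Function.update w j (!(w j))

theorem flipAt_flipAt {n : ℕ} (j : Fin n) (w : Fin n → Bool) : flipAt j (flipAt j w) = w := by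
  funext a
  by_cases h : a = j
  · subst h; simp [flipAt]
  · simp [flipAt, h]

/-- Flip all entries of `w`. -/
def flipAll {n : ℕ} (w : Fin n → Bool) : Fin n → Bool := fun j => !(w j)

theorem flipAll_flipAll {n : ℕ} (w : Fin n → Bool) : flipAll (flipAll w) = w := by
  funext a; simp [flipAll]

theorem rowVal_flipAt {n : ℕ} (y : Fin n → ℝ) (j : Fin n) (w : Fin n → Bool) :
    rowVal y (flipAt j w) = rowVal y w + if w j then - y j else y j := by
  unfold rowVal
  rw [← Finset.add_sum_erase _ _ (Finset.mem_univ j), ← Finset.add_sum_erase (a := j) _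
    (fun a => y a * if w a then (1 : ℝ) else 0) (Finset.mem_univ j)]
  have : ∑ x ∈ Finset.univ.erase j, (y x * if flipAt j w x then (1 : ℝ) else 0) =
      ∑ x ∈ Finset.univ.erase j, (y x * if w x then (1 : ℝ) else 0) := by
    refine Finset.sum_congr rfl fun a ha => ?_
    simp [flipAt, Finset.ne_of_mem_erase ha]
  rw [this]
  cases h : w j
  · simp [flipAt, h]
    ring
  · simp only [flipAt, h, Function.update_self, Bool.not_true, if_true]
    simp

theorem rowVal_flipAll {n : ℕ} {y : Fin n → ℝ} (hy : ∑ j, y j = 1) (w : Fin n → Bool) :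
    rowVal y (flipAll w) = 1 - rowVal y w := by
  unfold rowVal
  rw [eq_sub_iff_add_eq, ← Finset.sum_add_distrib]
  refine (Finset.sum_congr rfl fun a _ => ?_).trans hy
  cases h : w a <;> simp [flipAll, h]

theorem rowVal_depOn {n : ℕ} {y : Fin n → ℝ} {M : Finset (Fin n)} (hy : ∀ j, j ∉ M → y j = 0) :
    DepOn M (rowVal y) := by
  intro w w' h
  refine Finset.sum_congr rfl fun j _ => ?_
  by_cases hj : j ∈ M
  · rw [h j hj]
  · simp [hy j hj]

open Classical in
/-- If no weight exceeds `1/4`, the values in `[s, 1]` are at most twice as frequent as the values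
in `[s - 1/4, s)`, for `s ≥ 3/4`. -/
theorem card_le_two_mul_card_boundary {n : ℕ} {y : Fin n → ℝ} (h0 : ∀ j, 0 ≤ y j)
    (hy : ∑ j, y j = 1) (h4 : ∀ j, y j ≤ 1 / 4) {s : ℝ} (hs : 3 / 4 ≤ s) :
    (Finset.univ.filter fun w => s ≤ rowVal y w).card ≤
      2 * (Finset.univ.filter fun w => s - 1 / 4 ≤ rowVal y w ∧ rowVal y w < s).card := by
  set U := Finset.univ.filter fun w : Fin n → Bool => s ≤ rowVal y w with hU
  set W := Finset.univ.filter fun w : Fin n → Bool => s - 1 / 4 ≤ rowVal y w ∧ rowVal y w < s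
    with hW
  -- Turning a 1 at `j` into a 0 lowers the value by `y j ≤ 1/4`. It therefore maps the part of `U`
  -- with `w j = 1` injectively into the part with `w j = 0` together with `W`.
  have hj : ∀ j, ∑ w ∈ U, (2 * (if w j then (1 : ℝ) else 0) - 1) ≤ W.card := by
    intro j
    have e1 : ∑ w ∈ U, (2 * (if w j then (1 : ℝ) else 0) - 1) =
        (U.filter fun w => w j = true).card - (U.filter fun w => ¬ w j = true).card := by
      rw [Finset.sum_sub_distrib, ← Finset.mul_sum, Finset.sum_boole]
      have := Finset.card_filter_add_card_filter_not (s := U) (fun w => w j = true)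
      have h' : (U.card : ℝ) = (U.filter fun w => w j = true).card +
          (U.filter fun w => ¬ w j = true).card := by exact_mod_cast this.symm
      simp only [Finset.sum_const, nsmul_eq_mul, mul_one]
      rw [h']; ring
    have e2 : (U.filter fun w => w j = true).card ≤
        ((U.filter fun w => ¬ w j = true) ∪ W).card := by
      apply Finset.card_le_card_of_injOn (flipAt j)
      · intro w hw
        simp only [hU, Finset.coe_filter, Finset.mem_filter, Finset.mem_univ, true_and,
          Set.mem_ofPred_eq] at hw
        have hv := rowVal_flipAt y j w
        rw [if_pos hw.2] at hv
        simp only [hU, hW, Finset.coe_union, Finset.coe_filter, Finset.mem_filter,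
          Finset.mem_univ, true_and, Set.mem_union, Set.mem_ofPred_eq]
        by_cases h : s ≤ rowVal y (flipAt j w)
        · left; exact ⟨h, by simp [flipAt, hw.2]⟩
        · right; exact ⟨by rw [hv]; linarith [h4 j, hw.1], not_le.1 h⟩
      · intro w _ w' _ h
        rw [← flipAt_flipAt j w, h, flipAt_flipAt]
    have e3 := e2.trans (Finset.card_union_le _ _)
    have e4 : ((U.filter fun w => w j = true).card : ℝ) ≤
        (U.filter fun w => ¬ w j = true).card + W.card := by exact_mod_cast e3
    rw [e1]; linarith
  -- Averaging `hj` with the weights `y j` produces `2 * rowVal y w - 1`, which is at least 1/2 on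
  -- `U` because `s ≥ 3/4`.
  have hsum : ∑ w ∈ U, (2 * rowVal y w - 1) ≤ W.card := by
    have e1 : ∀ w, 2 * rowVal y w - 1 = ∑ j, y j * (2 * (if w j then (1 : ℝ) else 0) - 1) := by
      intro w
      simp_rw [mul_sub, Finset.sum_sub_distrib, mul_one, hy]
      rw [rowVal, Finset.mul_sum]
      congr 1
      refine Finset.sum_congr rfl fun j _ => ?_
      ring
    calc ∑ w ∈ U, (2 * rowVal y w - 1)
        = ∑ j, y j * ∑ w ∈ U, (2 * (if w j then (1 : ℝ) else 0) - 1) := by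
          simp_rw [e1, Finset.mul_sum]
          exact Finset.sum_comm
      _ ≤ ∑ j, y j * W.card :=
          Finset.sum_le_sum fun j _ => mul_le_mul_of_nonneg_left (hj j) (h0 j)
      _ = W.card := by rw [← Finset.sum_mul, hy, one_mul]
  have hlow : (U.card : ℝ) * (1 / 2) ≤ ∑ w ∈ U, (2 * rowVal y w - 1) := by
    rw [← nsmul_eq_mul]
    refine Finset.card_nsmul_le_sum _ _ _ fun w hw => ?_
    simp only [hU, Finset.mem_filter, Finset.mem_univ, true_and] at hw
    linarith
  have : (U.card : ℝ) ≤ 2 * W.card := by linarith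
  exact_mod_cast this

open Classical in
-- Pigeonhole: if one of four injections always lands in `Q`, then `Q` has density at least 1/4.
theorem two_pow_le_four_mul_card {n : ℕ} (Q : (Fin n → Bool) → Prop)
    (σ : Fin 4 → (Fin n → Bool) → (Fin n → Bool)) (hσ : ∀ a, Function.Injective (σ a))
    (h : ∀ w, ∃ a, Q (σ a w)) : 2 ^ n ≤ 4 * (Finset.univ.filter fun w => Q w).card := by
  calc 2 ^ n = (Finset.univ : Finset (Fin n → Bool)).card := by simp
    _ ≤ (Finset.univ.biUnion fun a : Fin 4 => Finset.univ.filter fun w => Q (σ a w)).card := by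
        apply Finset.card_le_card
        intro w _
        simpa using h w
    _ ≤ ∑ a : Fin 4, (Finset.univ.filter fun w => Q (σ a w)).card := Finset.card_biUnion_le
    _ ≤ ∑ a : Fin 4, (Finset.univ.filter fun w => Q w).card := by
        refine Finset.sum_le_sum fun a _ => ?_
        apply Finset.card_le_card_of_injOn (σ a)
        · intro w hw
          simpa using hw
        · exact (hσ a).injOn
    _ = _ := by simp

theorem flipAt_injective {n : ℕ} (j : Fin n) : Function.Injective (flipAt j) :=
  Function.LeftInverse.injective (flipAt_flipAt j)

theorem flipAll_injective {n : ℕ} : Function.Injective (flipAll (n := n)) :=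
  Function.LeftInverse.injective flipAll_flipAll

/-- The symmetries generated by `flipAt j` and `flipAll`. -/
def flips {n : ℕ} (j : Fin n) : Fin 4 → (Fin n → Bool) → (Fin n → Bool) :=
  ![id, flipAt j, flipAll, flipAt j ∘ flipAll]

theorem flips_injective {n : ℕ} (j : Fin n) (a : Fin 4) : Function.Injective (flips j a) := by
  fin_cases a
  · exact Function.injective_id
  · exact flipAt_injective j
  · exact flipAll_injective
  · exact (flipAt_injective j).comp flipAll_injective

open Classical in
theorem frequent_le_half {n : ℕ} {y : Fin n → ℝ} (hy : ∑ j, y j = 1) :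
    2 ^ n ≤ 4 * (Finset.univ.filter fun w => rowVal y w ≤ 1 / 2).card := by
  have hn : 0 < n := by
    rcases Nat.eq_zero_or_pos n with rfl | h
    · simp at hy
    · exact h
  refine two_pow_le_four_mul_card _ (flips ⟨0, hn⟩) (flips_injective _) fun w => ?_
  by_cases h : rowVal y w ≤ 1 / 2
  · exact ⟨0, h⟩
  · refine ⟨2, ?_⟩
    change rowVal y (flipAll w) ≤ 1 / 2
    rw [rowVal_flipAll hy]
    linarith

open Classical in
-- The values at `w` and `flipAt j w` differ by `y j`, so one of them is at distance at least `y j /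
-- 2` from 1/2. Complementing all bits reflects values about 1/2, so one of the four images lies on
-- the upper side.
theorem frequent_high {n : ℕ} {y : Fin n → ℝ} (hy : ∑ j, y j = 1) (j : Fin n) :
    2 ^ n ≤ 4 * (Finset.univ.filter fun w => 1 / 2 + y j / 2 ≤ rowVal y w).card := by
  refine two_pow_le_four_mul_card _ (flips j) (flips_injective _) fun w => ?_
  have h1 := rowVal_flipAt y j w
  have h2 := rowVal_flipAll hy w
  have h3 := rowVal_flipAt y j (flipAll w)
  by_contra hc
  push Not at hc
  have c0 : rowVal y w < _ := hc 0
  have c1 : rowVal y (flipAt j w) < _ := hc 1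
  have c2 : rowVal y (flipAll w) < _ := hc 2
  have c3 : rowVal y (flipAt j (flipAll w)) < _ := hc 3
  cases hw : w j
  · have : flipAll w j = true := by simp [flipAll, hw]
    simp only [hw, this, if_true] at h1 h3
    simp at h1
    linarith
  · have : flipAll w j = false := by simp [flipAll, hw]
    simp only [hw, this, if_true] at h1 h3
    simp at h3
    linarith

open Classical in
theorem frequent_low {n : ℕ} {y : Fin n → ℝ} (hy : ∑ j, y j = 1) (j : Fin n) :
    2 ^ n ≤ 4 * (Finset.univ.filter fun w => rowVal y w ≤ 1 / 2 - y j / 2).card := by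
  refine (frequent_high hy j).trans (Nat.mul_le_mul_left 4 ?_)
  apply Finset.card_le_card_of_injOn flipAll
  · intro w hw
    simp only [Finset.coe_filter, Finset.mem_univ, true_and, Set.mem_ofPred_eq] at hw ⊢
    rw [rowVal_flipAll hy]
    linarith
  · exact flipAll_injective.injOn

/-! ### Probability bounds for families of rows -/

open Classical in
-- Weight 1/2 on rows in `Q` and 1 on the others has mean at most 7/8, as `Q` has density at least
-- 1/4. If at most `L` rows are in `Q`, the product of the weights is at least `2 ^ (-L)`.
theorem randomGraph_card_le {n : ℕ} (M : Finset (Fin n)) (Q : (Fin n → Bool) → Prop)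
    (hQ : DepOn M Q) (h4 : 2 ^ n ≤ 4 * (Finset.univ.filter fun w => Q w).card) (L : ℕ) :
    randomGraph n {G | (Mᶜ.filter fun i => Q (adjB G i)).card ≤ L} ≤
      ENNReal.ofReal ((7 / 8) ^ (n - M.card) * 2 ^ L) := by
  have := randomGraph_le_of_prod M (fun _ w => if Q w then 1 / 2 else 1) (fun _ => 7 / 8)
    (fun i w w' h => by simp only [hQ w w' h]) (fun i w => by split_ifs <;> norm_num)
    (fun i _ => by
      have e : ∀ w, (if Q w then (1 / 2 : ℝ) else 1) = 1 - (1 / 2) * if Q w then 1 else 0 := by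
        intro w; split_ifs <;> norm_num
      simp_rw [e, Finset.sum_sub_distrib, ← Finset.mul_sum, Finset.sum_boole]
      have h4' : (2 : ℝ) ^ n ≤ 4 * (Finset.univ.filter fun w => Q w).card := by exact_mod_cast h4
      simp
      linarith)
    {G | (Mᶜ.filter fun i => Q (adjB G i)).card ≤ L} ((1 / 2) ^ L) (by positivity)
    (fun G hG => by
      rw [Finset.prod_ite]
      simp only [Finset.prod_const, mul_one, one_pow]
      exact pow_le_pow_of_le_one (by norm_num) (by norm_num) hG)
  refine this.trans (le_of_eq ?_)
  congr 1
  rw [Finset.prod_const, Finset.card_compl, Fintype.card_fin, one_div, inv_pow, div_inv_eq_mul]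

open Classical in
-- Weight 3/2 on `U`, 0 on `W` and 1 elsewhere has mean `1 + P(U)/2 - P(W) ≤ 1`. On the event no
-- factor vanishes and the product is at least `(3/2) ^ N`. Neither probability needs a lower bound.
theorem randomGraph_gap_le {n : ℕ} (M : Finset (Fin n)) (U W : (Fin n → Bool) → Prop)
    (hU : DepOn M U) (hW : DepOn M W) (hUW : ∀ w, W w → ¬ U w)
    (h2 : (Finset.univ.filter fun w => U w).card ≤ 2 * (Finset.univ.filter fun w => W w).card)
    (N : ℕ) :
    randomGraph n {G | (∀ i, i ∉ M → ¬ W (adjB G i)) ∧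
        N ≤ (Mᶜ.filter fun i => U (adjB G i)).card} ≤ ENNReal.ofReal ((2 / 3) ^ N) := by
  have := randomGraph_le_of_prod M (fun _ w => if U w then 3 / 2 else if W w then 0 else 1)
    (fun _ => 1)
    (fun i w w' h => by simp only [hU w w' h, hW w w' h])
    (fun i w => by split_ifs <;> norm_num)
    (fun i _ => by
      have e : ∀ w, (if U w then (3 / 2 : ℝ) else if W w then 0 else 1) =
          1 + (1 / 2) * (if U w then 1 else 0) - if W w then 1 else 0 := by
        intro w
        by_cases hw : W w
        · simp [hw, hUW w hw]
        · by_cases hu : U w <;> simp [hw, hu]; norm_num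
      simp_rw [e, Finset.sum_sub_distrib, Finset.sum_add_distrib, ← Finset.mul_sum,
        Finset.sum_boole]
      have h2' : ((Finset.univ.filter fun w => U w).card : ℝ) ≤
        2 * (Finset.univ.filter fun w => W w).card := by exact_mod_cast h2
      simp
      linarith)
    {G | (∀ i, i ∉ M → ¬ W (adjB G i)) ∧ N ≤ (Mᶜ.filter fun i => U (adjB G i)).card}
    ((3 / 2) ^ N) (by positivity)
    (fun G hG => by
      have e : ∏ i ∈ Mᶜ, (if U (adjB G i) then (3 / 2 : ℝ) else if W (adjB G i) then 0 else 1) =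
          ∏ i ∈ Mᶜ, (if U (adjB G i) then (3 / 2 : ℝ) else 1) := by
        refine Finset.prod_congr rfl fun i hi => ?_
        simp [hG.1 i (Finset.mem_compl.1 hi)]
      rw [e, Finset.prod_ite]
      simp only [Finset.prod_const, mul_one, one_pow]
      exact pow_le_pow_right₀ (by norm_num) hG.2)
  refine this.trans (le_of_eq ?_)
  congr 1
  simp only [Finset.prod_const_one]
  rw [one_div, ← inv_pow]
  norm_num

/-- The sum of the signs of the entries of `w` in `M`. -/
noncomputable def signSum {n : ℕ} (M : Finset (Fin n)) (w : Fin n → Bool) : ℝ :=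
  ∑ j ∈ M, if w j then 1 else -1

theorem sum_exp_signSum {n : ℕ} (M : Finset (Fin n)) (c : ℝ) :
    ∑ w, Real.exp (c * signSum M w) = 2 ^ n * Real.cosh c ^ M.card := by
  classical
  have e1 : ∀ w : Fin n → Bool, Real.exp (c * signSum M w) =
      ∏ j, (fun (j : Fin n) (b : Bool) => if j ∈ M then Real.exp (c * if b then 1 else -1) else 1)
        j (w j) := by
    intro w
    rw [signSum, Finset.mul_sum, Real.exp_sum, Finset.prod_ite]
    simp
  have e2 : ∀ j, ∑ b : Bool, (if j ∈ M then Real.exp (c * if b then 1 else -1) else 1) =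
      2 * if j ∈ M then Real.cosh c else 1 := by
    intro j
    by_cases hj : j ∈ M
    · simp [hj, Real.cosh_eq, mul_div_cancel₀]
    · simp [hj]
  have e3 := Finset.prod_univ_sum (fun _ : Fin n => (Finset.univ : Finset Bool))
    (fun (j : Fin n) (b : Bool) => if j ∈ M then Real.exp (c * if b then 1 else -1) else 1)
  rw [Fintype.piFinset_univ] at e3
  rw [Finset.sum_congr rfl fun w _ => e1 w, ← e3, Finset.prod_congr rfl fun j _ => e2 j,
    Finset.prod_mul_distrib, Finset.prod_ite]
  simp

/-- Chernoff bound for a single row, with `ε` itself as exponential parameter and `cosh ε ≤ exp (ε²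
/ 2)`; all other rows carry the factor 1. -/
theorem randomGraph_signSum_le {n : ℕ} (M : Finset (Fin n)) {i : Fin n} (hi : i ∉ M) {ε : ℝ}
    (hε : 0 < ε) : randomGraph n {G | ε * M.card ≤ |signSum M (adjB G i)|} ≤
      ENNReal.ofReal (2 * Real.exp (-(ε ^ 2 / 2 * M.card))) := by
  classical
  have := randomGraph_le_of_prod M
    (fun a w => if a = i then Real.exp (ε * signSum M w) + Real.exp (-ε * signSum M w) else 1)
    (fun a => if a = i then 2 * Real.exp (ε ^ 2 / 2 * M.card) else 1)
    (fun a w w' h => by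
      have : signSum M w = signSum M w' := Finset.sum_congr rfl fun j hj => by rw [h j hj]
      simp only [this])
    (fun a w => by split_ifs <;> positivity)
    (fun a _ => by
      by_cases ha : a = i
      · simp only [if_pos ha, Finset.sum_add_distrib, sum_exp_signSum, Real.cosh_neg]
        have : Real.cosh ε ^ M.card ≤ Real.exp (ε ^ 2 / 2 * M.card) := by
          rw [mul_comm, Real.exp_nat_mul]
          exact pow_le_pow_left₀ (Real.cosh_pos ε).le (Real.cosh_le_exp_half_sq ε) _
        nlinarith [this, pow_pos (zero_lt_two' ℝ) n]
      · simp [ha])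
    {G | ε * M.card ≤ |signSum M (adjB G i)|} (Real.exp (ε * (ε * M.card))) (Real.exp_pos _)
    (fun G hG => by
      rw [Finset.prod_ite_eq' Mᶜ i, if_pos (by simpa using hi)]
      rcases le_abs'.1 (show ε * M.card ≤ |signSum M (adjB G i)| from hG) with h | h
      · have h1 : Real.exp (ε * (ε * M.card)) ≤ Real.exp (-ε * signSum M (adjB G i)) := by
          apply Real.exp_le_exp.2
          nlinarith
        linarith [Real.exp_pos (ε * signSum M (adjB G i))]
      · have h1 : Real.exp (ε * (ε * M.card)) ≤ Real.exp (ε * signSum M (adjB G i)) := by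
          apply Real.exp_le_exp.2
          nlinarith
        linarith [Real.exp_pos (-ε * signSum M (adjB G i))])
  refine this.trans (le_of_eq ?_)
  rw [Finset.prod_ite_eq' Mᶜ i, if_pos (by simpa using hi), mul_div_assoc, ← Real.exp_sub]
  congr 3
  ring

/-! ### Limits of probabilities -/

theorem tendsto_measure_one {Ω : ℕ → Type*} [∀ n, MeasurableSpace (Ω n)]
    [∀ n, DiscreteMeasurableSpace (Ω n)] {μ : ∀ n, Measure (Ω n)} {S : ∀ n, Set (Ω n)} {δ : ℕ → ℝ}
    (hμ : ∀ᶠ n in atTop, IsProbabilityMeasure (μ n))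
    (hS : ∀ᶠ n in atTop, μ n (S n)ᶜ ≤ ENNReal.ofReal (δ n)) (hδ : Tendsto δ atTop (𝓝 0)) :
    Tendsto (fun n => μ n (S n)) atTop (𝓝 1) := by
  have h1 : Tendsto (fun n => 1 - ENNReal.ofReal (δ n)) atTop (𝓝 (1 - 0)) := by
    apply ENNReal.Tendsto.sub tendsto_const_nhds _ (Or.inl ENNReal.one_ne_top)
    simpa using ENNReal.tendsto_ofReal hδ
  rw [tsub_zero] at h1
  refine tendsto_of_tendsto_of_tendsto_of_le_of_le' h1 tendsto_const_nhds ?_ ?_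
  · filter_upwards [hμ, hS] with n hn hSn
    have := hn
    have e : μ n (S n) = 1 - μ n (S n)ᶜ := by
      rw [← prob_compl_eq_one_sub (MeasurableSet.of_discrete), compl_compl]
    rw [e]
    exact tsub_le_tsub_left hSn 1
  · filter_upwards [hμ] with n hn
    have := hn
    exact prob_le_one

theorem isProbabilityMeasure_randomGraph (n : ℕ) : IsProbabilityMeasure (randomGraph n) := by
  unfold randomGraph; infer_instance

theorem measure_iUnion_le_ofReal {Ω ι : Type*} [MeasurableSpace Ω] [Fintype ι] (μ : Measure Ω)
    (S : ι → Set Ω) (b : ℝ) (h : ∀ i, μ (S i) ≤ ENNReal.ofReal b) :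
    μ (⋃ i, S i) ≤ ENNReal.ofReal (Fintype.card ι * b) := by
  calc μ (⋃ i, S i) ≤ ∑ i, μ (S i) := measure_iUnion_fintype_le μ S
    _ ≤ ∑ _i : ι, ENNReal.ofReal b := Finset.sum_le_sum fun i _ => h i
    _ = _ := by
      rw [Finset.sum_const, nsmul_eq_mul, Finset.card_univ,
        ENNReal.ofReal_mul (Nat.cast_nonneg _), ENNReal.ofReal_natCast]

theorem measure_union_le_ofReal {Ω : Type*} [MeasurableSpace Ω] {μ : Measure Ω}
    {S T : Set Ω} {a b : ℝ} (ha : 0 ≤ a) (hb : 0 ≤ b) (hS : μ S ≤ ENNReal.ofReal a)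
    (hT : μ T ≤ ENNReal.ofReal b) : μ (S ∪ T) ≤ ENNReal.ofReal (a + b) := by
  rw [ENNReal.ofReal_add ha hb]
  exact (measure_union_le _ _).trans (add_le_add hS hT)

/-! ### Products with adjacency matrices -/

/-- Rows outside the support multiply their diagonal entry by 0. Self-loops are invisible there, and
one event on `G` serves every choice of `d`. -/
theorem mulVec_adjLoops {n : ℕ} (G : SimpleGraph (Fin n)) (d : Fin n → Bool) {M : Finset (Fin n)}
    {y : Fin n → ℝ} (hy : ∀ j, j ∉ M → y j = 0) {i : Fin n} (hi : i ∉ M) :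
    (adjLoops G d).mulVec y i = rowVal y (adjB G i) := by
  rw [Matrix.mulVec, dotProduct, rowVal]
  refine Finset.sum_congr rfl fun j _ => ?_
  by_cases hij : i = j
  · subst hij; simp [hy i hi]
  · by_cases h : G.Adj i j <;> simp [adjLoops, adjB, hij, h]

theorem adjLoops_mem_Icc {n : ℕ} (G : SimpleGraph (Fin n)) (d : Fin n → Bool) (i j : Fin n) :
    adjLoops G d i j ∈ Set.Icc (0 : ℝ) 1 := by
  unfold adjLoops
  split_ifs <;> simp

theorem mulVec_mem_cube {n m : ℕ} {A : Matrix (Fin n) (Fin m) ℝ}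
    (hA : ∀ i j, A i j ∈ Set.Icc (0 : ℝ) 1) {x : Fin m → ℝ} (hx : x ∈ stdSimplex ℝ (Fin m)) :
    A.mulVec x ∈ cube n := by
  intro i
  rw [Matrix.mulVec, dotProduct]
  constructor
  · exact Finset.sum_nonneg fun j _ => mul_nonneg (hA i j).1 (hx.1 j)
  · rw [← hx.2]
    exact Finset.sum_le_sum fun j _ => mul_le_of_le_one_left (hx.1 j) (hA i j).2

/-! ### The optimum on a graph with a planted clique -/

/-- The planted measure is an average over `C`, so a bound for every fixed `C` suffices. -/
theorem plantedGraph_le {n k : ℕ} (S : Set (SimpleGraph (Fin n))) (δ : ℝ≥0∞)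
    (h : ∀ C : Finset (Fin n), C.card = k → randomGraph n {G | G ⊔ cliqueOn C ∈ S} ≤ δ) :
    plantedGraph n k S ≤ δ := by
  have h1 : ∀ C ∈ Finset.powersetCard k (Finset.univ : Finset (Fin n)),
      (randomGraph n).map (fun G => G ⊔ cliqueOn C) S ≤ δ := by
    intro C hC
    rw [Measure.map_apply Measurable.of_discrete MeasurableSet.of_discrete]
    exact h C (Finset.mem_powersetCard.1 hC).2
  simp only [plantedGraph, Measure.smul_apply, Measure.finsetSum_apply, smul_eq_mul]
  have h2 := Finset.sum_le_card_nsmul _ _ _ h1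
  rw [Finset.card_powersetCard, Finset.card_univ, Fintype.card_fin, nsmul_eq_mul] at h2
  calc _ ≤ (n.choose k : ℝ≥0∞)⁻¹ * (n.choose k * δ) := by gcongr
    _ = ((n.choose k : ℝ≥0∞)⁻¹ * n.choose k) * δ := by ring
    _ ≤ 1 * δ := by
      gcongr
      exact ENNReal.inv_mul_le_one _
    _ = δ := one_mul _

/-- The uniform distribution on `C`. -/
noncomputable def unifVec {n : ℕ} (C : Finset (Fin n)) : Fin n → ℝ :=
  fun j => if j ∈ C then (C.card : ℝ)⁻¹ else 0

theorem unifVec_mem_stdSimplex {n : ℕ} {C : Finset (Fin n)} (hC : 0 < C.card) :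
    unifVec C ∈ stdSimplex ℝ (Fin n) := by
  have : (C.card : ℝ) ≠ 0 := by positivity
  refine ⟨fun j => ?_, ?_⟩
  · unfold unifVec; split_ifs <;> positivity
  · simp [unifVec, this]

theorem rowVal_unifVec {n : ℕ} {C : Finset (Fin n)} (hC : 0 < C.card) (w : Fin n → Bool) :
    rowVal (unifVec C) w = 1 / 2 + signSum C w / (2 * C.card) := by
  have : (C.card : ℝ) ≠ 0 := by positivity
  have e : signSum C w = 2 * (∑ j ∈ C, if w j then (1 : ℝ) else 0) - C.card := by
    rw [signSum, Finset.mul_sum, ← nsmul_one C.card, ← Finset.sum_const, ← Finset.sum_sub_distrib]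
    refine Finset.sum_congr rfl fun j _ => ?_
    split_ifs <;> norm_num
  have e2 : rowVal (unifVec C) w = (C.card : ℝ)⁻¹ * ∑ j ∈ C, if w j then (1 : ℝ) else 0 := by
    rw [rowVal, Finset.mul_sum, ← Finset.sum_subset (Finset.subset_univ C)]
    · refine Finset.sum_congr rfl fun j hj => ?_
      simp [unifVec, hj]
    · intro j _ hj
      simp [unifVec, hj]
  rw [e, e2]
  field_simp
  ring

theorem nthLargest_succ_card_le {n : ℕ} (t : Fin n → ℝ) (C : Finset (Fin n)) (hn : C.card < n)
    (v : ℝ) (h : ∀ i, i ∉ C → t i ≤ v) : nthLargest t (C.card + 1) ≤ v := by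
  have h1 := card_le_nthLargest t (i := C.card + 1) (by omega) hn
  by_contra hc
  have := Finset.card_le_card (s := Finset.univ.filter fun a => nthLargest t (C.card + 1) ≤ t a)
    (t := C) fun a ha => by
      by_contra haC
      simp only [Finset.mem_filter, Finset.mem_univ, true_and] at ha
      exact hc (ha.trans (h a haC))
  omega

/-- A row in `C` misses at most its own diagonal entry, so its value is at least `1 - 1/|C|`; the
rows outside lie within `ε/2` of 1/2. Thus `t_[k] ≥ 1 - 1/k`, `t_[k+1] ≤ 1/2 + ε/2` and `t_[n] ≥ 1/2
- ε/2`. -/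
theorem le_mixValue_unifVec {n : ℕ} (G : SimpleGraph (Fin n)) (d : Fin n → Bool)
    {C : Finset (Fin n)} (h2 : 2 ≤ C.card) (hn : C.card < n) {ε : ℝ}
    (hclique : ∀ i ∈ C, ∀ j ∈ C, i ≠ j → G.Adj i j)
    (h : ∀ i, i ∉ C → |signSum C (adjB G i)| < ε * C.card) :
    1 - (C.card : ℝ)⁻¹ - ε ≤ mixValue (gClique n C.card) (adjLoops G d) (unifVec C) := by
  have hpos : (0 : ℝ) < C.card := by positivity
  have h2' : (2 : ℝ) ≤ C.card := by exact_mod_cast h2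
  have hinv : (C.card : ℝ)⁻¹ ≤ 1 / 2 := by
    rw [one_div]; exact inv_anti₀ (by norm_num) h2'
  set t := (adjLoops G d).mulVec (unifVec C) with ht
  have hout : ∀ i, i ∉ C → |t i - 1 / 2| < ε / 2 := by
    intro i hi
    rw [ht, mulVec_adjLoops G d (M := C) (fun j hj => by simp [unifVec, hj]) hi,
      rowVal_unifVec (by omega), add_sub_cancel_left, abs_div, abs_of_pos (by positivity : (0:ℝ) <
      2 * C.card), div_lt_iff₀ (by positivity)]
    calc _ < _ := h i hi
      _ = _ := by ring
  have hin : ∀ i ∈ C, 1 - (C.card : ℝ)⁻¹ ≤ t i := by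
    intro i hi
    have : t i = ∑ j ∈ C, adjLoops G d i j * (C.card : ℝ)⁻¹ := by
      rw [ht, Matrix.mulVec, dotProduct, ← Finset.sum_subset (Finset.subset_univ C)]
      · refine Finset.sum_congr rfl fun j hj => ?_
        simp [unifVec, hj]
      · intro j _ hj
        simp [unifVec, hj]
    rw [this, ← Finset.add_sum_erase _ _ hi]
    have e : ∑ j ∈ C.erase i, adjLoops G d i j * (C.card : ℝ)⁻¹ =
        ∑ j ∈ C.erase i, (C.card : ℝ)⁻¹ := by
      refine Finset.sum_congr rfl fun j hj => ?_
      have hij := (Finset.ne_of_mem_erase hj).symm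
      simp [adjLoops, hij, hclique i hi j (Finset.mem_of_mem_erase hj) hij]
    rw [e, Finset.sum_const, Finset.card_erase_of_mem hi, nsmul_eq_mul,
      Nat.cast_sub (by omega : 1 ≤ C.card)]
    have := mul_nonneg (adjLoops_mem_Icc G d i i).1 (inv_nonneg.2 hpos.le)
    have e3 : ((C.card : ℝ) - (1 : ℕ)) * (C.card : ℝ)⁻¹ = 1 - (C.card : ℝ)⁻¹ := by
      field_simp
      simp
    linarith
  have hεpos : 0 < ε := by
    obtain ⟨i, hi⟩ : ∃ i, i ∉ C := by
      by_contra hc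
      push Not at hc
      have := Finset.card_le_card (fun i _ => hc i : (Finset.univ : Finset (Fin n)) ⊆ C)
      simp at this
      omega
    linarith [(abs_nonneg _).trans_lt (hout i hi)]
  have g1 : 1 - (C.card : ℝ)⁻¹ ≤ nthLargest t C.card := by
    rw [le_nthLargest_iff t (by omega) hn.le]
    exact Finset.card_le_card fun i hi => by simpa using hin i hi
  have g2 : nthLargest t (C.card + 1) ≤ 1 / 2 + ε / 2 :=
    nthLargest_succ_card_le t C hn _ fun i hi => by linarith [(abs_lt.1 (hout i hi)).2]
  have g3 : 1 / 2 - ε / 2 ≤ nthLargest t n := by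
    rw [le_nthLargest_self_iff t (by omega)]
    intro i
    by_cases hi : i ∈ C
    · linarith [hin i hi]
    · linarith [(abs_lt.1 (hout i hi)).1]
  have : mixValue (gClique n C.card) (adjLoops G d) (unifVec C) =
      nthLargest t C.card - nthLargest t (C.card + 1) + nthLargest t n := rfl
  rw [this]
  linarith

theorem plantedGraph_optimum (k : ℕ → ℕ)
    (hk_low : (fun n : ℕ => Real.log n ^ 2) =o[atTop] (fun n : ℕ => (k n : ℝ)))
    (hk_lt : ∀ᶠ n in atTop, k n < n) (ε : ℝ) (hε : 0 < ε) :
    Tendsto (fun n : ℕ => plantedGraph n (k n)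
        {G | ∀ d : Fin n → Bool, ∃ x ∈ stdSimplex ℝ (Fin n),
          1 - ε ≤ mixValue (gClique n (k n)) (adjLoops G d) x}) atTop (𝓝 1) := by
  have hlog : Tendsto (fun n : ℕ => Real.log n) atTop atTop :=
    Real.tendsto_log_atTop.comp tendsto_natCast_atTop_atTop
  have hlarge : ∀ c : ℝ, 0 < c → ∀ᶠ n : ℕ in atTop, c * Real.log n ≤ k n := by
    intro c hc
    filter_upwards [hk_low.bound (show (0 : ℝ) < 1 by norm_num), hlog.eventually_ge_atTop c]
      with n h1 h2
    rw [Real.norm_of_nonneg (by positivity), Real.norm_of_nonneg (by positivity), one_mul] at h1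
    nlinarith
  -- Half of `ε` pays for the missing diagonal, `1/k ≤ ε/2`, the other half for the deviations of
  -- the rows outside the clique.
  apply tendsto_measure_one
    (δ := fun n => n * (2 * Real.exp (-((ε / 2) ^ 2 / 2 * k n))))
  · filter_upwards [hk_lt] with n hn
    exact isProbabilityMeasure_plantedGraph hn.le
  · have hlarge' : ∀ᶠ n : ℕ in atTop, max 2 (2 / ε) ≤ (k n : ℝ) := by
      filter_upwards [hlarge 1 one_pos, hlog.eventually_ge_atTop (max 2 (2 / ε))] with n h1 h2
      linarith
    filter_upwards [hk_lt, hlarge'] with n hn hl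
    have hk2 : 2 ≤ k n := by exact_mod_cast (le_max_left _ _).trans hl
    have hkε : ((k n : ℕ) : ℝ)⁻¹ ≤ ε / 2 := by
      rw [inv_le_comm₀ (by positivity) (by positivity), inv_div]
      exact (le_max_right _ _).trans hl
    apply plantedGraph_le
    intro C hC
    have hsub : {G | G ⊔ cliqueOn C ∈ {G | ∀ d : Fin n → Bool, ∃ x ∈ stdSimplex ℝ (Fin n),
          1 - ε ≤ mixValue (gClique n (k n)) (adjLoops G d) x}ᶜ} ⊆
        ⋃ i, {G | i ∉ C ∧ ε / 2 * C.card ≤ |signSum C (adjB G i)|} := by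
      intro G hG
      by_contra hc
      apply hG
      intro d
      refine ⟨unifVec C, unifVec_mem_stdSimplex (by omega), ?_⟩
      have hrow : ∀ i, i ∉ C → |signSum C (adjB (G ⊔ cliqueOn C) i)| < ε / 2 * C.card := by
        intro i hi
        simp only [Set.mem_iUnion, Set.mem_ofPred_eq, not_exists, not_and, not_le] at hc
        refine lt_of_eq_of_lt ?_ (hc i hi)
        congr 1
        refine Finset.sum_congr rfl fun j _ => ?_
        have : (G ⊔ cliqueOn C).Adj i j ↔ G.Adj i j := by
          simp only [SimpleGraph.sup_adj, or_iff_left_iff_imp]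
          exact fun h => absurd h.2.1 hi
        have e : adjB (G ⊔ cliqueOn C) i j = adjB G i j := decide_eq_decide.2 this
        rw [e]
      have := le_mixValue_unifVec (G ⊔ cliqueOn C) d (by omega) (by omega) (fun i hi j hj hij => by
        right; exact ⟨hij, hi, hj⟩) hrow
      rw [hC] at this
      linarith
    refine (measure_mono hsub).trans ?_
    have := measure_iUnion_le_ofReal (randomGraph n)
      (fun i => {G | i ∉ C ∧ ε / 2 * C.card ≤ |signSum C (adjB G i)|})
      (2 * Real.exp (-((ε / 2) ^ 2 / 2 * k n))) (fun i => by
        by_cases hi : i ∈ C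
        · simp [hi]
        · have := randomGraph_signSum_le C hi (ε := ε / 2) (by positivity)
          rw [hC] at this
          simpa [hi, hC] using this)
    simpa using this
  · have h1 : Tendsto (fun n : ℕ => 2 * ((n : ℝ))⁻¹) atTop (𝓝 0) := by
      simpa using tendsto_inv_atTop_nhds_zero_nat.const_mul (2 : ℝ)
    refine tendsto_of_tendsto_of_tendsto_of_le_of_le' tendsto_const_nhds h1
      (Eventually.of_forall fun n => by positivity) ?_
    -- This multiple of `log n` makes the exponent at least `2 log n`: each row fails with
    -- probability at most `2 / n²`, which survives the union bound over `n` rows.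
    filter_upwards [hlarge (2 / ((ε / 2) ^ 2 / 2)) (by positivity), eventually_gt_atTop 0]
      with n h2 hn
    have hn' : (0 : ℝ) < n := by exact_mod_cast hn
    have h3 : 2 * Real.log n ≤ (ε / 2) ^ 2 / 2 * k n := by
      rw [div_mul_eq_mul_div, div_le_iff₀ (by positivity)] at h2
      linarith
    have h4 : Real.exp (-((ε / 2) ^ 2 / 2 * k n)) ≤ (n : ℝ)⁻¹ * (n : ℝ)⁻¹ := by
      calc _ ≤ Real.exp (-Real.log n + -Real.log n) := Real.exp_le_exp.2 (by linarith)
        _ = _ := by rw [Real.exp_add, Real.exp_neg, Real.exp_log hn']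
    calc (n : ℝ) * (2 * Real.exp (-((ε / 2) ^ 2 / 2 * k n)))
        ≤ n * (2 * ((n : ℝ)⁻¹ * (n : ℝ)⁻¹)) := by gcongr
      _ = 2 * (n : ℝ)⁻¹ := by field_simp

/-! ### Sparse mixtures -/

/-- The empirical distribution of the sample `J`. -/
noncomputable def empVec {n r : ℕ} (J : Fin r → Fin n) : Fin n → ℝ :=
  fun j => ∑ a, if J a = j then (r : ℝ)⁻¹ else 0

theorem empVec_nonneg {n r : ℕ} (J : Fin r → Fin n) (j : Fin n) : 0 ≤ empVec J j :=
  Finset.sum_nonneg fun a _ => by split_ifs <;> positivity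

theorem sum_empVec {n r : ℕ} (hr : 0 < r) (J : Fin r → Fin n) : ∑ j, empVec J j = 1 := by
  unfold empVec
  rw [Finset.sum_comm]
  have : (r : ℝ) ≠ 0 := by positivity
  simp [this]

theorem empVec_mem_stdSimplex {n r : ℕ} (hr : 0 < r) (J : Fin r → Fin n) :
    empVec J ∈ stdSimplex ℝ (Fin n) := ⟨empVec_nonneg J, sum_empVec hr J⟩

theorem empVec_eq_zero {n r : ℕ} (J : Fin r → Fin n) {j : Fin n}
    (hj : j ∉ Finset.univ.image J) : empVec J j = 0 := by
  refine Finset.sum_eq_zero fun a _ => if_neg ?_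
  rintro rfl
  exact hj (Finset.mem_image_of_mem J (Finset.mem_univ a))

theorem mulVec_empVec {n m r : ℕ} (A : Matrix (Fin n) (Fin m) ℝ) (J : Fin r → Fin m) (i : Fin n) :
    A.mulVec (empVec J) i = (∑ a, A i (J a)) / r := by
  rw [Matrix.mulVec, dotProduct]
  simp only [empVec, Finset.mul_sum]
  rw [Finset.sum_comm, Finset.sum_div]
  refine Finset.sum_congr rfl fun a _ => ?_
  simp [div_eq_mul_inv]

theorem exists_le_of_average {m : ℕ} {x : Fin m → ℝ} (hx : x ∈ stdSimplex ℝ (Fin m))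
    (f : Fin m → ℝ) (b : ℝ) (h : ∑ j, x j * f j ≤ b) : ∃ j, f j ≤ b := by
  by_contra hc
  push Not at hc
  have h1 : ∑ j, x j * (f j - b) ≤ 0 := by
    simp only [mul_sub, Finset.sum_sub_distrib, ← Finset.sum_mul, hx.2]
    linarith
  have h2 : ∀ j, 0 ≤ x j * (f j - b) := fun j => mul_nonneg (hx.1 j) (by linarith [hc j])
  have h3 := (Finset.sum_eq_zero_iff_of_nonneg fun j _ => h2 j).1
    (le_antisymm h1 (Finset.sum_nonneg fun j _ => h2 j))
  have h4 : ∀ j, x j = 0 := fun j => by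
    rcases mul_eq_zero.1 (h3 j (Finset.mem_univ j)) with h | h
    · exact h
    · linarith [hc j]
  have := hx.2
  simp [h4] at this

/-- Uses `exp u ≤ 1 + u + u²` for `|u| ≤ 1`; the linear term has mean zero. -/
theorem sum_mul_exp_le {m : ℕ} {x : Fin m → ℝ} (hx : x ∈ stdSimplex ℝ (Fin m)) (z : Fin m → ℝ)
    (hz : ∀ j, |z j| ≤ 1) (hmean : ∑ j, x j * z j = 0) (c : ℝ) (hc : |c| ≤ 1) :
    ∑ j, x j * Real.exp (c * z j) ≤ 1 + c ^ 2 := by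
  have h1 : ∀ j, Real.exp (c * z j) ≤ 1 + c ^ 2 + c * z j := by
    intro j
    have h := Real.abs_exp_sub_one_sub_id_le (x := c * z j) (by
      rw [abs_mul]; exact mul_le_one₀ hc (abs_nonneg _) (hz j))
    have h2 : (c * z j) ^ 2 ≤ c ^ 2 := by
      rw [mul_pow]
      exact mul_le_of_le_one_right (sq_nonneg c) ((sq_le_one_iff_abs_le_one _).2 (hz j))
    linarith [(abs_le.1 h).2]
  calc ∑ j, x j * Real.exp (c * z j) ≤ ∑ j, x j * (1 + c ^ 2 + c * z j) :=
        Finset.sum_le_sum fun j _ => mul_le_mul_of_nonneg_left (h1 j) (hx.1 j)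
    _ = (∑ j, x j) * (1 + c ^ 2) + c * ∑ j, x j * z j := by
        simp only [mul_add, Finset.sum_add_distrib, Finset.sum_mul, Finset.mul_sum]
        congr 1
        refine Finset.sum_congr rfl fun j _ => by ring
    _ = 1 + c ^ 2 := by rw [hx.2, hmean]; ring

/-- Sampling by the method of conditional expectations. Drawing the next column from `x` multiplies
the expected potential by at most `1 + c²`, so some column does at least as well. -/
theorem exists_sample_potential {n m : ℕ} {x : Fin m → ℝ} (hx : x ∈ stdSimplex ℝ (Fin m))
    (Z : Fin n → Fin m → ℝ) (hZ : ∀ i j, |Z i j| ≤ 1) (hmean : ∀ i, ∑ j, x j * Z i j = 0)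
    (c : ℝ) (hc : |c| ≤ 1) (r : ℕ) : ∃ J : Fin r → Fin m,
      ∑ i, (Real.exp (c * ∑ a, Z i (J a)) + Real.exp (-c * ∑ a, Z i (J a))) ≤
        2 * n * (1 + c ^ 2) ^ r := by
  induction r with
  | zero =>
    refine ⟨Fin.elim0, ?_⟩
    simp
    linarith
  | succ r ih =>
    obtain ⟨J, hJ⟩ := ih
    have key : ∀ c' : ℝ, |c'| ≤ 1 → ∀ i, ∑ j, x j * Real.exp (c' * (Z i j + ∑ a, Z i (J a))) ≤
        (1 + c' ^ 2) * Real.exp (c' * ∑ a, Z i (J a)) := by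
      intro c' hc' i
      calc _ = (∑ j, x j * Real.exp (c' * Z i j)) * Real.exp (c' * ∑ a, Z i (J a)) := by
            rw [Finset.sum_mul]
            refine Finset.sum_congr rfl fun j _ => ?_
            rw [mul_add, Real.exp_add, mul_assoc]
        _ ≤ _ := by
            gcongr
            exact sum_mul_exp_le hx (Z i) (hZ i) (hmean i) c' hc'
    obtain ⟨j, hj⟩ := exists_le_of_average hx
      (fun j => ∑ i, (Real.exp (c * (Z i j + ∑ a, Z i (J a))) +
        Real.exp (-c * (Z i j + ∑ a, Z i (J a))))) (2 * n * (1 + c ^ 2) ^ (r + 1)) (by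
      simp only [Finset.mul_sum]
      rw [Finset.sum_comm]
      calc _ ≤ ∑ i, (1 + c ^ 2) * (Real.exp (c * ∑ a, Z i (J a)) +
              Real.exp (-c * ∑ a, Z i (J a))) := by
            refine Finset.sum_le_sum fun i _ => ?_
            simp only [mul_add (x _), Finset.sum_add_distrib]
            have k1 := key c hc i
            have k2 := key (-c) (by rwa [abs_neg]) i
            rw [neg_sq] at k2
            linarith
        _ ≤ (1 + c ^ 2) * (2 * n * (1 + c ^ 2) ^ r) := by
            rw [← Finset.mul_sum]
            gcongr
        _ = _ := by ring)
    refine ⟨Fin.cons j J, ?_⟩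
    simpa [Fin.sum_univ_succ] using hj

/-- Every mixture is approximated by the empirical distribution of a sample of logarithmic size. -/
theorem exists_sample {n m : ℕ} {A : Matrix (Fin n) (Fin m) ℝ}
    (hA : ∀ i j, A i j ∈ Set.Icc (0 : ℝ) 1) {x : Fin m → ℝ} (hx : x ∈ stdSimplex ℝ (Fin m))
    {B l : ℕ} (hB : 0 < B) (hl : 0 < l) (hn : n ≤ 2 ^ l) :
    ∃ J : Fin (8 * B ^ 2 * l) → Fin m, ∀ i,
      |A.mulVec x i - A.mulVec (empVec J) i| ≤ 1 / B := by
  set r := 8 * B ^ 2 * l with hr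
  have hrR : (r : ℝ) = 8 * B ^ 2 * l := by rw [hr]; push_cast; ring
  have hB1 : (1 : ℝ) ≤ B := by exact_mod_cast hB
  have hl1 : (1 : ℝ) ≤ l := by exact_mod_cast hl
  have hrpos : (0 : ℝ) < r := by rw [hrR]; positivity
  -- The potential gives `c * |s| ≤ 2 l + r c²`, where `|s|` is `r` times the deviation. So the
  -- deviation is at most `2 l / (r c) + c`, and with these `r` and `c` both terms equal `1 / (2
  -- B)`.
  set c : ℝ := 1 / (2 * B) with hc
  have hcpos : 0 < c := by positivity
  have hc1 : c ≤ 1 := by rw [hc, div_le_one (by positivity)]; linarith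
  have ht := mulVec_mem_cube hA hx
  obtain ⟨J, hJ⟩ := exists_sample_potential hx (fun i j => A i j - A.mulVec x i)
    (fun i j => by
      have h1 := hA i j
      have h2 := ht i
      rw [abs_le]; constructor <;> linarith [h1.1, h1.2, h2.1, h2.2])
    (fun i => by
      simp only [mul_sub, Finset.sum_sub_distrib, ← Finset.sum_mul, hx.2, one_mul]
      rw [sub_eq_zero, Matrix.mulVec, dotProduct]
      exact Finset.sum_congr rfl fun j _ => mul_comm _ _)
    c (by rwa [abs_of_pos hcpos]) r
  refine ⟨J, fun i => ?_⟩
  set s := ∑ a, (A i (J a) - A.mulVec x i) with hs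
  have hsum : Real.exp (c * s) + Real.exp (-c * s) ≤ 2 * n * (1 + c ^ 2) ^ r :=
    (Finset.single_le_sum (f := fun i => Real.exp (c * ∑ a, (A i (J a) - A.mulVec x i)) +
      Real.exp (-c * ∑ a, (A i (J a) - A.mulVec x i))) (fun i _ => by positivity)
      (Finset.mem_univ i)).trans hJ
  have hbound : (2 : ℝ) * n * (1 + c ^ 2) ^ r ≤ Real.exp (2 * l + r * c ^ 2) := by
    have h1 : (1 + c ^ 2) ^ r ≤ Real.exp (r * c ^ 2) := by
      rw [Real.exp_nat_mul]
      exact pow_le_pow_left₀ (by positivity) (by linarith [Real.add_one_le_exp (c ^ 2)]) _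
    have h2 : (2 : ℝ) * n ≤ Real.exp (2 * l) := by
      have h3 : (n : ℝ) ≤ 2 ^ l := by exact_mod_cast hn
      have h4 : (2 : ℝ) ≤ 2 ^ l := by
        calc (2 : ℝ) = 2 ^ 1 := by norm_num
          _ ≤ 2 ^ l := pow_le_pow_right₀ (by norm_num) hl
      have h5 : (2 : ℝ) ^ l ≤ Real.exp l := by
        rw [← mul_one (l : ℝ), Real.exp_nat_mul]
        exact pow_le_pow_left₀ (by norm_num) (by linarith [Real.add_one_le_exp (1 : ℝ)]) _
      calc (2 : ℝ) * n ≤ Real.exp l * Real.exp l := by gcongr <;> linarith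
        _ = _ := by rw [← Real.exp_add]; ring_nf
    calc _ ≤ Real.exp (2 * l) * Real.exp (r * c ^ 2) := by gcongr
      _ = _ := by rw [← Real.exp_add]
  have habs : c * |s| ≤ 2 * l + r * c ^ 2 := by
    rw [← Real.exp_le_exp]
    refine le_trans ?_ (hsum.trans hbound)
    rcases abs_cases s with ⟨h, -⟩ | ⟨h, -⟩ <;> rw [h]
    · linarith [Real.exp_pos (-c * s)]
    · rw [mul_neg, ← neg_mul]
      linarith [Real.exp_pos (c * s)]
  have hs' : s = r * (A.mulVec (empVec J) i - A.mulVec x i) := by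
    rw [mulVec_empVec, hs, Finset.sum_sub_distrib]
    simp
    field_simp
  rw [abs_sub_comm]
  rw [hs', abs_mul, abs_of_pos hrpos, hrR, hc] at habs
  have hBpos : (0 : ℝ) < B := by linarith
  field_simp at habs
  rw [le_div_iff₀ hBpos]
  have hl' : (0 : ℝ) < l := by linarith
  nlinarith [habs, abs_nonneg (A.mulVec (empVec J) i - A.mulVec x i)]

/-! ### The optimum on a random graph -/

open Classical in
/-- Number of vertices outside the sample whose rows satisfy `Q`. -/
noncomputable def rowCount {n r : ℕ} (J : Fin r → Fin n) (G : SimpleGraph (Fin n))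
    (Q : (Fin n → Bool) → Prop) : ℕ :=
  ((Finset.univ.image J)ᶜ.filter fun i => Q (adjB G i)).card

/-- The properties of the rows of a typical graph that bound the value of a sparse mixture. -/
structure TypicalFor {n r : ℕ} (K L : ℕ) (G : SimpleGraph (Fin n)) (J : Fin r → Fin n) :
    Prop where
  half : L < rowCount J G fun w => rowVal (empVec J) w ≤ 1 / 2
  high : ∀ j, L < rowCount J G fun w => 1 / 2 + empVec J j / 2 ≤ rowVal (empVec J) w
  low : ∀ j, L < rowCount J G fun w => rowVal (empVec J) w ≤ 1 / 2 - empVec J j / 2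
  -- Every row value is an average of `r` zeros and ones, so the thresholds `c / r` cover all
  -- possible values of `t_[k]`. The subtraction in `K - r` discounts the at most `r` rows belonging
  -- to the sample.
  gap : (∀ j, empVec J j ≤ 1 / 4) → ∀ c : Fin (r + 1), (3 / 4 : ℝ) ≤ (c : ℕ) / r →
    ¬ ((∀ i, i ∉ Finset.univ.image J → ¬ ((c : ℕ) / r - 1 / 4 ≤ rowVal (empVec J) (adjB G i) ∧
        rowVal (empVec J) (adjB G i) < (c : ℕ) / r)) ∧
      K - r ≤ rowCount J G fun w => (c : ℕ) / r ≤ rowVal (empVec J) w)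

theorem rowCount_le {n r : ℕ} (J : Fin r → Fin n) (G : SimpleGraph (Fin n)) (d : Fin n → Bool)
    (P : ℝ → Prop) [DecidablePred P] :
    rowCount J G (fun w => P (rowVal (empVec J) w)) ≤
      (Finset.univ.filter fun i => P ((adjLoops G d).mulVec (empVec J) i)).card := by
  classical
  unfold rowCount
  apply Finset.card_le_card
  intro i hi
  simp only [Finset.mem_filter, Finset.mem_univ, true_and, Finset.mem_compl] at hi ⊢
  rw [mulVec_adjLoops G d (fun j hj => empVec_eq_zero J hj) hi.1]
  exact hi.2

theorem exists_of_rowCount {n r L : ℕ} {J : Fin r → Fin n} {G : SimpleGraph (Fin n)}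
    (d : Fin n → Bool) (P : ℝ → Prop) (h : L < rowCount J G fun w => P (rowVal (empVec J) w)) :
    ∃ i, P ((adjLoops G d).mulVec (empVec J) i) := by
  classical
  obtain ⟨i, hi⟩ := Finset.card_pos.1 ((Nat.zero_le L).trans_lt (h.trans_le (rowCount_le J G d P)))
  exact ⟨i, (Finset.mem_filter.1 hi).2⟩

/-- With all weights at most 1/4, a value above 3/4 gives `t_[k] > 3/4` because `t_[k+1] ≥ t_[n]`,
and a gap larger than 1/4 because `t_[n] ≤ 1/2`; `gap` excludes this. With a weight `y j > 1/4`,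
`high` and `low` give `t_[k+1] ≥ 1/2 + y j / 2` and `t_[n] ≤ 1/2 - y j / 2`, so the value is at most
`1 - y j`. -/
theorem TypicalFor.gClique_le {n r K L : ℕ} {G : SimpleGraph (Fin n)} {J : Fin r → Fin n}
    (h : TypicalFor K L G J) (hr : 0 < r) (d : Fin n → Bool) {k : ℕ} (h1 : 1 ≤ k) (hn : k < n)
    (hK : K ≤ k) (hL : k ≤ L) :
    gClique n k ((adjLoops G d).mulVec (empVec J)) ≤ 3 / 4 := by
  classical
  set t := (adjLoops G d).mulVec (empVec J) with ht
  have hcube : t ∈ cube n := mulVec_mem_cube (adjLoops_mem_Icc G d) (empVec_mem_stdSimplex hr J)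
  have hk1 := (nthLargest_mem_Icc hcube h1 hn.le).2
  have hanti := nthLargest_anti t (Nat.succ_pos k) hn le_rfl
  simp only [Nat.succ_eq_add_one] at hanti
  by_cases hheavy : ∀ j, empVec J j ≤ 1 / 4
  · by_contra hc
    push Not at hc
    unfold gClique at hc
    obtain ⟨i0, hi0⟩ := exists_of_rowCount d (fun v => v ≤ 1 / 2) h.half
    have hmin : nthLargest t n ≤ 1 / 2 := (nthLargest_self_le t i0).trans hi0
    obtain ⟨i1, hi1⟩ := exists_eq_nthLargest t h1 hn.le
    have hrR : (0 : ℝ) < r := by exact_mod_cast hr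
    obtain ⟨c, hc'⟩ : ∃ c : Fin (r + 1), nthLargest t k = (c : ℕ) / r := by
      have : ∃ c : ℕ, (∑ a, adjLoops G d i1 (J a)) = c := by
        refine ⟨∑ a, if (i1 = J a ∧ d i1 = true) ∨ (i1 ≠ J a ∧ G.Adj i1 (J a)) then 1 else 0, ?_⟩
        push_cast
        refine Finset.sum_congr rfl fun a _ => ?_
        by_cases h' : i1 = J a
        · simp [adjLoops, h']
        · simp [adjLoops, h']
      obtain ⟨c, hcc⟩ := this
      have e : nthLargest t k = c / r := by rw [← hi1, ht, mulVec_empVec, hcc]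
      have hle : c ≤ r := by
        rw [e, div_le_one hrR] at hk1
        exact_mod_cast hk1
      exact ⟨⟨c, by omega⟩, e⟩
    refine h.gap hheavy c (by rw [← hc']; linarith) ⟨?_, ?_⟩
    · rintro i hi ⟨hlo, hhi⟩
      rw [← mulVec_adjLoops G d (fun j hj => empVec_eq_zero J hj) hi, ← hc', ← ht] at hlo hhi
      have := nthLargest_le_of_lt t h1 hn i (by linarith)
      linarith
    · have e1 := card_le_nthLargest t h1 hn.le
      have e2 : (Finset.univ.filter fun a => nthLargest t k ≤ t a).card ≤
          (Finset.univ.image J).card +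
            rowCount J G fun w => (c : ℕ) / r ≤ rowVal (empVec J) w := by
        unfold rowCount
        refine le_trans (Finset.card_le_card fun i hi => ?_) (Finset.card_union_le _ _)
        by_cases hiM : i ∈ Finset.univ.image J
        · exact Finset.mem_union_left _ hiM
        · apply Finset.mem_union_right
          simp only [Finset.mem_filter, Finset.mem_univ, true_and] at hi
          rw [Finset.mem_filter, Finset.mem_compl]
          refine ⟨hiM, ?_⟩
          change _ ≤ rowVal (empVec J) (adjB G i)
          rw [← mulVec_adjLoops G d (fun j hj => empVec_eq_zero J hj) hiM, ← hc']
          exact hi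
      have e3 : (Finset.univ.image J).card ≤ r := by
        simpa using Finset.card_image_le (s := (Finset.univ : Finset (Fin r))) (f := J)
      omega
  · push Not at hheavy
    obtain ⟨j, hj⟩ := hheavy
    obtain ⟨i0, hi0⟩ := exists_of_rowCount d (fun v => v ≤ 1 / 2 - empVec J j / 2) (h.low j)
    have hmin := (nthLargest_self_le t i0).trans hi0
    have hhigh : 1 / 2 + empVec J j / 2 ≤ nthLargest t (k + 1) := by
      rw [le_nthLargest_iff t (by omega) hn]
      exact (Nat.succ_le_of_lt (hL.trans_lt (h.high j))).trans
        (rowCount_le J G d fun v => 1 / 2 + empVec J j / 2 ≤ v)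
    unfold gClique
    linarith

theorem randomGraph_rowCount_le {n r : ℕ} (J : Fin r → Fin n) (P : ℝ → Prop) [DecidablePred P]
    (h4 : 2 ^ n ≤ 4 * (Finset.univ.filter fun w => P (rowVal (empVec J) w)).card) (L : ℕ) :
    randomGraph n {G | ¬ L < rowCount J G fun w => P (rowVal (empVec J) w)} ≤
      ENNReal.ofReal ((7 / 8) ^ (n - r) * 2 ^ L) := by
  have hdep := rowVal_depOn (fun j hj => empVec_eq_zero J (j := j) hj)
  have := randomGraph_card_le (Finset.univ.image J) (fun w => P (rowVal (empVec J) w))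
    (fun w w' h => by simp only [hdep w w' h]) (by convert h4) L
  simp only [not_lt]
  refine (le_of_eq ?_).trans (this.trans (ENNReal.ofReal_le_ofReal ?_))
  · rfl
  · refine mul_le_mul_of_nonneg_right ?_ (by positivity)
    apply pow_le_pow_of_le_one (by norm_num) (by norm_num)
    have e3 : (Finset.univ.image J).card ≤ r := by
      simpa using Finset.card_image_le (s := (Finset.univ : Finset (Fin r))) (f := J)
    omega

theorem randomGraph_not_typicalFor_le {n r : ℕ} (hr : 0 < r) (K L : ℕ) (J : Fin r → Fin n) :
    randomGraph n {G | ¬ TypicalFor K L G J} ≤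
      ENNReal.ofReal ((1 + 2 * n) * ((7 / 8) ^ (n - r) * 2 ^ L) + (r + 1) * (2 / 3) ^ (K - r)) := by
  classical
  have hy := sum_empVec hr J
  set y := empVec J with hydef
  have hdep : DepOn (Finset.univ.image J) (rowVal y) :=
    rowVal_depOn (fun j hj => empVec_eq_zero J (j := j) hj)
  have b1 := randomGraph_rowCount_le J (fun v => v ≤ 1 / 2) (frequent_le_half hy) L
  have b2 := measure_iUnion_le_ofReal (randomGraph n) _ _ fun j =>
    randomGraph_rowCount_le J (fun v => 1 / 2 + y j / 2 ≤ v) (frequent_high hy j) L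
  have b3 := measure_iUnion_le_ofReal (randomGraph n) _ _ fun j =>
    randomGraph_rowCount_le J (fun v => v ≤ 1 / 2 - y j / 2) (frequent_low hy j) L
  have b4 := measure_iUnion_le_ofReal (randomGraph n)
    (fun c : Fin (r + 1) => {G | (∀ j, y j ≤ 1 / 4) ∧ (3 / 4 : ℝ) ≤ (c : ℕ) / r ∧
      (∀ i, i ∉ Finset.univ.image J → ¬ ((c : ℕ) / r - 1 / 4 ≤ rowVal y (adjB G i) ∧
        rowVal y (adjB G i) < (c : ℕ) / r)) ∧
      K - r ≤ rowCount J G fun w => (c : ℕ) / r ≤ rowVal y w}) ((2 / 3) ^ (K - r)) (fun c => by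
      by_cases hcond : (∀ j, y j ≤ 1 / 4) ∧ (3 / 4 : ℝ) ≤ (c : ℕ) / r
      · refine le_trans (measure_mono ?_) (randomGraph_gap_le (Finset.univ.image J)
          (fun w => (c : ℕ) / r ≤ rowVal y w)
          (fun w => (c : ℕ) / r - 1 / 4 ≤ rowVal y w ∧ rowVal y w < (c : ℕ) / r)
          (fun w w' h => by simp only [hdep w w' h]) (fun w w' h => by simp only [hdep w w' h])
          (fun w hw => not_le.2 hw.2)
          (by convert card_le_two_mul_card_boundary (empVec_nonneg J) hy hcond.1 hcond.2) (K - r))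
        intro G hG
        exact hG.2.2
      · have : {G : SimpleGraph (Fin n) | (∀ j, y j ≤ 1 / 4) ∧ (3 / 4 : ℝ) ≤ (c : ℕ) / r ∧
            (∀ i, i ∉ Finset.univ.image J → ¬ ((c : ℕ) / r - 1 / 4 ≤ rowVal y (adjB G i) ∧
              rowVal y (adjB G i) < (c : ℕ) / r)) ∧
            K - r ≤ rowCount J G fun w => (c : ℕ) / r ≤ rowVal y w} = ∅ := by
          apply Set.eq_empty_of_forall_notMem
          intro G hG
          exact hcond ⟨hG.1, hG.2.1⟩
        rw [this]
        simp)
  refine (measure_mono fun G hG => ?_).trans ((measure_union_le_ofReal ?_ ?_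
    (measure_union_le_ofReal ?_ ?_ (measure_union_le_ofReal ?_ ?_ b1 b2) b3) b4).trans
    (ENNReal.ofReal_le_ofReal ?_))
  · by_contra hc
    simp only [Set.mem_union, Set.mem_iUnion, Set.mem_ofPred_eq, not_or, not_exists, not_not] at hc
    obtain ⟨⟨⟨c1, c2⟩, c3⟩, c4⟩ := hc
    exact hG ⟨c1, c2, c3, fun hh c h3 hG' => c4 c ⟨hh, h3, hG'⟩⟩
  all_goals try positivity
  apply le_of_eq
  simp only [Fintype.card_fin]
  push_cast
  ring

theorem randomGraph_not_typical_le {n r : ℕ} (hr : 0 < r) (K L : ℕ) :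
    randomGraph n {G | ∀ J : Fin r → Fin n, TypicalFor K L G J}ᶜ ≤
      ENNReal.ofReal (n ^ r * ((1 + 2 * n) * ((7 / 8) ^ (n - r) * 2 ^ L) +
        (r + 1) * (2 / 3) ^ (K - r))) := by
  have := measure_iUnion_le_ofReal (randomGraph n) _ _
    fun J : Fin r → Fin n => randomGraph_not_typicalFor_le hr K L J
  refine (measure_mono fun G hG => ?_).trans (this.trans (le_of_eq ?_))
  · simpa using hG
  · simp

theorem sq_log_le (c : ℕ) : ∀ᶠ n : ℕ in atTop, c * (Nat.log 2 n + 1) ^ 2 ≤ n := by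
  have h1 : Tendsto (fun m : ℕ => (m : ℝ) ^ 2 / 2 ^ m) atTop (𝓝 0) :=
    tendsto_pow_const_div_const_pow_of_one_lt 2 (by norm_num)
  have h2 : Tendsto (fun n : ℕ => Nat.log 2 n + 1) atTop atTop := by
    rw [tendsto_atTop]
    intro b
    filter_upwards [eventually_ge_atTop (2 ^ b)] with n hn
    have := Nat.le_log_of_pow_le (by norm_num) hn
    omega
  have h3 := (h1.comp h2).eventually_lt_const (show (0 : ℝ) < 1 / (2 * (c + 1)) by positivity)
  filter_upwards [h3, eventually_gt_atTop 0] with n hn hpos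
  simp only [Function.comp] at hn
  rw [div_lt_div_iff₀ (by positivity) (by positivity), one_mul, pow_succ 2 (Nat.log 2 n)] at hn
  have hpow : 2 ^ Nat.log 2 n ≤ n := Nat.pow_log_le_self 2 hpos.ne'
  have hpowR : (2 : ℝ) ^ Nat.log 2 n ≤ n := by exact_mod_cast hpow
  have : (c : ℝ) * ((Nat.log 2 n + 1 : ℕ) : ℝ) ^ 2 ≤ n := by
    have := sq_nonneg ((Nat.log 2 n + 1 : ℕ) : ℝ)
    linarith
  exact_mod_cast this

theorem pow_two_third_le (a : ℕ) : (2 / 3 : ℝ) ^ (2 * a) ≤ (1 / 2) ^ a := by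
  rw [pow_mul]
  exact pow_le_pow_left₀ (by norm_num) (by norm_num) a

theorem pow_seven_eighth_le (a : ℕ) : (7 / 8 : ℝ) ^ (6 * a) ≤ (1 / 2) ^ a := by
  rw [pow_mul]
  exact pow_le_pow_left₀ (by norm_num) (by norm_num) a

/-- There are at most `2 ^ (A l²)` samples. As `(2/3)² ≤ 1/2` and `K - r ≥ 2 (A l² + l)`, the gap
term beats this number by `2 ^ (-l)`. As `(7/8)⁶ ≤ 1/2`, the frequency terms beat it together with
`2 ^ L` and `1 + 2 n ≤ 2 ^ (2 l)`. -/
theorem failure_bound {n A l r K L : ℕ} (hr : r = A * l) (hl : 1 ≤ l)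
    (hn : n ≤ 2 ^ l) (hK : (3 * A + 2) * l ^ 2 ≤ K) (hL : 100 * L ≤ n)
    (hbig : (24 * A + 48) * l ^ 2 ≤ n) :
    (n : ℝ) ^ r * ((1 + 2 * n) * ((7 / 8) ^ (n - r) * 2 ^ L) + (r + 1) * (2 / 3) ^ (K - r)) ≤
      (A * l + 2) * (1 / 2) ^ l := by
  have hnR : (n : ℝ) ≤ 2 ^ l := by exact_mod_cast hn
  have hll : l ≤ l ^ 2 := by nlinarith
  have hAl : A * l ≤ A * l ^ 2 := Nat.mul_le_mul_left A hll
  have hpow : (n : ℝ) ^ r ≤ 2 ^ (A * l ^ 2) := by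
    calc (n : ℝ) ^ r ≤ (2 ^ l) ^ r := pow_le_pow_left₀ (by positivity) hnR r
      _ = _ := by rw [← pow_mul, hr]; congr 1; ring
  have h2half : ∀ a : ℕ, (2 : ℝ) ^ a * (1 / 2) ^ a = 1 := by
    intro a; rw [← mul_pow]; norm_num
  have hsecond : (2 / 3 : ℝ) ^ (K - r) ≤ (1 / 2) ^ (A * l ^ 2 + l) := by
    refine le_trans (pow_le_pow_of_le_one (by norm_num) (by norm_num) ?_)
      (pow_two_third_le (A * l ^ 2 + l))
    have : (3 * A + 2) * l ^ 2 = 3 * (A * l ^ 2) + 2 * l ^ 2 := by ring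
    omega
  have hfirst : (7 / 8 : ℝ) ^ (n - r) * 2 ^ L ≤ (1 / 2) ^ (A * l ^ 2 + 3 * l) := by
    have h1 : (7 / 8 : ℝ) ^ (n - r) ≤ (1 / 2) ^ (A * l ^ 2 + 3 * l + L) := by
      refine le_trans (pow_le_pow_of_le_one (by norm_num) (by norm_num) ?_)
        (pow_seven_eighth_le (A * l ^ 2 + 3 * l + L))
      have : (24 * A + 48) * l ^ 2 = 24 * (A * l ^ 2) + 48 * l ^ 2 := by ring
      omega
    calc _ ≤ (1 / 2 : ℝ) ^ (A * l ^ 2 + 3 * l + L) * 2 ^ L := by gcongr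
      _ = (1 / 2) ^ (A * l ^ 2 + 3 * l) * (2 ^ L * (1 / 2) ^ L) := by rw [pow_add]; ring
      _ = _ := by rw [h2half, mul_one]
  have hlin : (1 + 2 * (n : ℝ)) ≤ 2 ^ (2 * l) := by
    have h2 : (2 : ℝ) ≤ 2 ^ l := by
      calc (2 : ℝ) = 2 ^ 1 := by norm_num
        _ ≤ 2 ^ l := pow_le_pow_right₀ (by norm_num) hl
    rcases Nat.lt_or_ge l 2 with h | h
    · have : l = 1 := by omega
      subst this
      have : 48 ≤ n := by nlinarith
      norm_num at hnR
      have : (48 : ℝ) ≤ n := by exact_mod_cast this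
      linarith
    · have h4 : (4 : ℝ) ≤ 2 ^ l := by
        calc (4 : ℝ) = 2 ^ 2 := by norm_num
          _ ≤ 2 ^ l := pow_le_pow_right₀ (by norm_num) h
      rw [two_mul l, pow_add]
      nlinarith
  calc (n : ℝ) ^ r * ((1 + 2 * n) * ((7 / 8) ^ (n - r) * 2 ^ L) + (r + 1) * (2 / 3) ^ (K - r))
      ≤ 2 ^ (A * l ^ 2) * (2 ^ (2 * l) * (1 / 2) ^ (A * l ^ 2 + 3 * l) +
          (A * l + 1) * (1 / 2) ^ (A * l ^ 2 + l)) := by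
        have : (r : ℝ) = A * l := by rw [hr]; push_cast; ring
        rw [this]
        gcongr
    _ = (2 ^ (A * l ^ 2) * (1 / 2) ^ (A * l ^ 2)) * ((2 ^ (2 * l) * (1 / 2) ^ (2 * l)) *
          (1 / 2) ^ l + (A * l + 1) * (1 / 2) ^ l) := by
        rw [show 3 * l = 2 * l + l by ring, pow_add, pow_add, pow_add]
        ring
    _ = _ := by rw [h2half, h2half]; ring

/-- With high probability, no mixture has a value larger than `3/4 + ε` for any clique size between
`C log² n` and `n/100`. -/
theorem randomGraph_optimum (ε : ℝ) (hε : 0 < ε) : ∃ C : ℕ, ∀ K L : ℕ → ℕ,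
    (∀ᶠ n in atTop, C * (Nat.log 2 n + 1) ^ 2 ≤ K n) → (∀ᶠ n in atTop, 100 * L n ≤ n) →
    Tendsto (fun n : ℕ => randomGraph n {G | ∀ k, 1 ≤ k → k < n → K n ≤ k → k ≤ L n →
      ∀ d : Fin n → Bool, ∀ x ∈ stdSimplex ℝ (Fin n),
        mixValue (gClique n k) (adjLoops G d) x ≤ 3 / 4 + ε}) atTop (𝓝 1) := by
  -- Replacing a mixture by a sample moves each row by at most `1 / B`, and `gClique` is
  -- 3-Lipschitz.
  obtain ⟨B, hB⟩ := exists_nat_gt (3 / ε)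
  have hBpos : 0 < B := by
    have : (0 : ℝ) < B := lt_trans (by positivity) hB
    exact_mod_cast this
  have hBR : (0 : ℝ) < B := by exact_mod_cast hBpos
  set A := 8 * B ^ 2 with hA
  refine ⟨3 * A + 2, fun K L hK hL => ?_⟩
  have hlog : Tendsto (fun n : ℕ => Nat.log 2 n + 1) atTop atTop := by
    rw [tendsto_atTop]
    intro b
    filter_upwards [eventually_ge_atTop (2 ^ b)] with n hn
    have := Nat.le_log_of_pow_le (by norm_num) hn
    omega
  apply tendsto_measure_one
    (δ := fun n => (A * (Nat.log 2 n + 1 : ℕ) + 2) * (1 / 2) ^ (Nat.log 2 n + 1))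
  · exact Eventually.of_forall isProbabilityMeasure_randomGraph
  · filter_upwards [hK, hL, sq_log_le (24 * A + 48)] with n hKn hLn hbig
    set l := Nat.log 2 n + 1 with hl
    have hn : n ≤ 2 ^ l := (Nat.lt_pow_succ_log_self (by norm_num) n).le
    have hr : 0 < A * l := by positivity
    refine (measure_mono ?_).trans ((randomGraph_not_typical_le hr (K n) (L n)).trans
      (ENNReal.ofReal_le_ofReal (failure_bound rfl (by omega) hn hKn hLn hbig)))
    apply Set.compl_subset_compl.2
    intro G hG k h1 hkn hKk hkL d x hx
    obtain ⟨J, hJ⟩ := exists_sample (adjLoops_mem_Icc G d) hx hBpos (show 0 < l by omega) hn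
    have e1 := (hG J).gClique_le hr d h1 hkn hKk hkL
    have e2 := (abs_le.1 (abs_gClique_sub_le _ _ _ hJ h1 hkn)).2
    have e3 : 3 * (1 / (B : ℝ)) ≤ ε := by
      rw [div_lt_iff₀ hε] at hB
      rw [mul_one_div, div_le_iff₀ hBR]
      linarith
    unfold mixValue
    linarith
  · have h1 : Tendsto (fun m : ℕ => ((A : ℝ) * m + 2) * (1 / 2) ^ m) atTop (𝓝 0) := by
      have e1 : Tendsto (fun m : ℕ => (m : ℝ) * (1 / 2) ^ m) atTop (𝓝 0) :=
        tendsto_self_mul_const_pow_of_lt_one (by norm_num) (by norm_num)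
      have e2 : Tendsto (fun m : ℕ => (1 / 2 : ℝ) ^ m) atTop (𝓝 0) :=
        tendsto_pow_atTop_nhds_zero_of_lt_one (by norm_num) (by norm_num)
      have := (e1.const_mul (A : ℝ)).add (e2.const_mul 2)
      simp only [mul_zero, add_zero] at this
      refine this.congr fun m => ?_
      ring
    exact h1.comp hlog

/-! ### Bit lengths and polynomial bounds -/

theorem size_add_le (a b : ℕ) : (a + b).size ≤ a.size + b.size + 1 := by
  rw [Nat.size_le, pow_succ, pow_add]
  have ha := Nat.lt_size_self a
  have hb := Nat.lt_size_self b
  have h1 := Nat.one_le_two_pow (n := a.size)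
  have h2 := Nat.one_le_two_pow (n := b.size)
  nlinarith

theorem size_mul_le (a b : ℕ) : (a * b).size ≤ a.size + b.size := by
  rw [Nat.size_le, pow_add]
  exact Nat.mul_lt_mul'' (Nat.lt_size_self a) (Nat.lt_size_self b)

theorem size_le_self (a : ℕ) : a.size ≤ a := by
  rw [Nat.size_le]
  exact Nat.lt_two_pow_self

/-- `f` is bounded by a polynomial. -/
def PolyBdd (f : ℕ → ℕ) : Prop := ∃ q : Polynomial ℕ, ∀ n, f n ≤ q.eval n

theorem polynomial_eval_mono (q : Polynomial ℕ) : Monotone fun n => q.eval n := by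
  intro a b hab
  simp only [Polynomial.eval_eq_sum_range]
  exact Finset.sum_le_sum fun i _ => Nat.mul_le_mul_left _ (Nat.pow_le_pow_left hab i)

namespace PolyBdd

theorem const (c : ℕ) : PolyBdd fun _ => c := ⟨Polynomial.C c, fun n => by simp⟩

theorem id : PolyBdd fun n => n := ⟨Polynomial.X, fun n => by simp⟩

theorem add {f g : ℕ → ℕ} (hf : PolyBdd f) (hg : PolyBdd g) : PolyBdd fun n => f n + g n := by
  obtain ⟨p, hp⟩ := hf
  obtain ⟨q, hq⟩ := hg
  exact ⟨p + q, fun n => by rw [Polynomial.eval_add]; exact add_le_add (hp n) (hq n)⟩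

theorem mul {f g : ℕ → ℕ} (hf : PolyBdd f) (hg : PolyBdd g) : PolyBdd fun n => f n * g n := by
  obtain ⟨p, hp⟩ := hf
  obtain ⟨q, hq⟩ := hg
  exact ⟨p * q, fun n => by rw [Polynomial.eval_mul]; exact Nat.mul_le_mul (hp n) (hq n)⟩

theorem eval_comp {f : ℕ → ℕ} (q : Polynomial ℕ) (hf : PolyBdd f) :
    PolyBdd fun n => q.eval (f n) := by
  obtain ⟨p, hp⟩ := hf
  exact ⟨q.comp p, fun n => by
    rw [Polynomial.eval_comp]; exact polynomial_eval_mono q (hp n)⟩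

end PolyBdd

/-! ### Programs and fresh arrays -/

/-- All array names in the expression are smaller than this number. -/
def Expr.bound : Expr → ℕ
  | .lit _ => 0
  | .get v i => max (v + 1) i.bound
  | .add a b => max a.bound b.bound
  | .sub a b => max a.bound b.bound
  | .mul a b => max a.bound b.bound
  | .div a b => max a.bound b.bound

/-- All array names in the program are smaller than this number. -/
def Prog.bound : Prog → ℕ
  | .skip => 0
  | .set v i e => max (v + 1) (max i.bound e.bound)
  | .seq p q => max p.bound q.bound
  | .ite c p q => max c.bound (max p.bound q.bound)
  | .loop c p => max c.bound p.bound

theorem Expr.eval_cost_congr {V : ℕ} {σ σ' : Store} (h : ∀ v < V, σ v = σ' v) (e : Expr)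
    (he : e.bound ≤ V) : e.eval σ = e.eval σ' ∧ e.cost σ = e.cost σ' := by
  induction e with
  | lit c => exact ⟨rfl, rfl⟩
  | get v i ih =>
    simp only [Expr.bound, max_le_iff] at he
    obtain ⟨h1, h2⟩ := ih he.2
    simp only [Expr.eval, Expr.cost, h1, h2, h v he.1, and_self]
  | add a b iha ihb | sub a b iha ihb | mul a b iha ihb | div a b iha ihb =>
    simp only [Expr.bound, max_le_iff] at he
    obtain ⟨h1, h2⟩ := iha he.1
    obtain ⟨h3, h4⟩ := ihb he.2
    simp only [Expr.eval, Expr.cost, h1, h2, h3, h4, and_self]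

/-- A program neither reads nor changes the arrays it does not mention. -/
theorem Runs.frame {V : ℕ} {p : Prog} {σ τ : Store} {T : ℕ} (h : Runs p σ τ T) :
    p.bound ≤ V → ∀ σ' : Store, (∀ v < V, σ v = σ' v) →
      ∃ τ', Runs p σ' τ' T ∧ (∀ v < V, τ v = τ' v) ∧ ∀ v, V ≤ v → τ' v = σ' v := by
  induction h with
  | skip σ => exact fun _ σ' h => ⟨σ', .skip σ', h, fun _ _ => rfl⟩
  | set v i e σ =>
    intro hp σ' h
    simp only [Prog.bound, max_le_iff] at hp
    obtain ⟨i1, i2⟩ := Expr.eval_cost_congr h i hp.2.1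
    obtain ⟨e1, e2⟩ := Expr.eval_cost_congr h e hp.2.2
    refine ⟨Function.update σ' v (Function.update (σ' v) (i.eval σ') (e.eval σ')), ?_, ?_, ?_⟩
    · rw [i2, e2]
      exact .set v i e σ'
    · intro u hu
      by_cases huv : u = v
      · subst huv
        simp [i1, e1, h u hu]
      · simp [huv, h u hu]
    · intro u hu
      have : u ≠ v := by omega
      simp [this]
  | seq _ _ ih1 ih2 =>
    intro hp σ' h
    simp only [Prog.bound, max_le_iff] at hp
    obtain ⟨ρ', r1, a1, f1⟩ := ih1 hp.1 σ' h
    obtain ⟨τ', r2, a2, f2⟩ := ih2 hp.2 ρ' a1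
    exact ⟨τ', .seq r1 r2, a2, fun v hv => (f2 v hv).trans (f1 v hv)⟩
  | ite_true hc _ ih =>
    intro hp σ' h
    simp only [Prog.bound, max_le_iff] at hp
    obtain ⟨c1, c2⟩ := Expr.eval_cost_congr h _ hp.1
    obtain ⟨τ', r, a, f⟩ := ih hp.2.1 σ' h
    rw [c2]
    exact ⟨τ', .ite_true (c1 ▸ hc) r, a, f⟩
  | ite_false hc _ ih =>
    intro hp σ' h
    simp only [Prog.bound, max_le_iff] at hp
    obtain ⟨c1, c2⟩ := Expr.eval_cost_congr h _ hp.1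
    obtain ⟨τ', r, a, f⟩ := ih hp.2.2 σ' h
    rw [c2]
    exact ⟨τ', .ite_false (c1 ▸ hc) r, a, f⟩
  | loop_true hc _ _ ih1 ih2 =>
    intro hp σ' h
    have hp' := hp
    simp only [Prog.bound, max_le_iff] at hp'
    obtain ⟨c1, c2⟩ := Expr.eval_cost_congr h _ hp'.1
    obtain ⟨ρ', r1, a1, f1⟩ := ih1 hp'.2 σ' h
    obtain ⟨τ', r2, a2, f2⟩ := ih2 hp ρ' a1
    rw [c2]
    exact ⟨τ', .loop_true (c1 ▸ hc) r1 r2, a2, fun v hv => (f2 v hv).trans (f1 v hv)⟩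
  | loop_false hc =>
    intro hp σ' h
    simp only [Prog.bound, max_le_iff] at hp
    obtain ⟨c1, c2⟩ := Expr.eval_cost_congr h _ hp.1
    rw [c2]
    exact ⟨σ', .loop_false (c1 ▸ hc), h, fun _ _ => rfl⟩

theorem Expr.size_eval_le_cost (σ : Store) (e : Expr) : (e.eval σ).size ≤ e.cost σ := by
  cases e <;> simp only [Expr.eval, Expr.cost] <;> omega

/-- Bit lengths grow at most by the running time. -/
theorem Runs.size_le {p : Prog} {σ τ : Store} {T : ℕ} (h : Runs p σ τ T) :
    ∀ B, (∀ v i, (σ v i).size ≤ B) → ∀ v i, (τ v i).size ≤ B + T := by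
  induction h with
  | skip σ => exact fun B h v i => (h v i).trans (by omega)
  | set u i e σ =>
    intro B h v a
    have h1 := h v a
    have h2 := e.size_eval_le_cost σ
    by_cases hv : v = u
    · subst hv
      by_cases ha : a = i.eval σ
      · subst ha
        simp only [Function.update_self]
        omega
      · simp only [Function.update_self, Function.update_of_ne ha]
        omega
    · simp only [Function.update_of_ne hv]
      omega
  | seq _ _ ih1 ih2 =>
    intro B h v i
    have := ih2 _ (ih1 B h) v i
    omega
  | ite_true _ _ ih | ite_false _ _ ih =>
    intro B h v i
    have := ih B h v i
    omega
  | loop_true _ _ _ ih1 ih2 =>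
    intro B h v i
    have := ih2 _ (ih1 B h) v i
    omega
  | loop_false _ =>
    intro B h v i
    have := h v i
    omega

/-! ### Terms with bounded sums -/

/-- Binary arithmetic operations. -/
inductive Op : Type
  | add
  | sub
  | mul
  | div

def Op.val : Op → ℕ → ℕ → ℕ
  | .add, a, b => a + b
  | .sub, a, b => a - b
  | .mul, a, b => a * b
  | .div, a, b => a / b

def Op.expr : Op → Expr → Expr → Expr
  | .add => .add
  | .sub => .sub
  | .mul => .mul
  | .div => .div

theorem Op.eval_expr (o : Op) (a b : Expr) (σ : Store) :
    (o.expr a b).eval σ = o.val (a.eval σ) (b.eval σ) := by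
  cases o <;> rfl

theorem Op.cost_expr (o : Op) (a b : Expr) (σ : Store) :
    (o.expr a b).cost σ = a.cost σ + b.cost σ + 1 + (o.val (a.eval σ) (b.eval σ)).size := by
  cases o <;> rfl

theorem Op.size_val_le (o : Op) (a b : ℕ) : (o.val a b).size ≤ a.size + b.size + 1 := by
  cases o
  · exact size_add_le a b
  · exact (Nat.size_le_size (Nat.sub_le a b)).trans (by omega)
  · exact (size_mul_le a b).trans (by omega)
  · exact (Nat.size_le_size (Nat.div_le_self a b)).trans (by omega)

/-- Terms over the arrays of a memory; `sum x t` is the sum of `t` for `x < n`, where `n` is a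
parameter of the evaluation. -/
inductive Term : Type
  | lit (c : ℕ)
  | var (x : ℕ)
  | get (v : ℕ) (t : Term)
  | op (o : Op) (a b : Term)
  | sum (x : ℕ) (t : Term)

def Term.eval (σ : Store) (n : ℕ) : Term → (ℕ → ℕ) → ℕ
  | .lit c, _ => c
  | .var x, ρ => ρ x
  | .get v t, ρ => σ v (t.eval σ n ρ)
  | .op o a b, ρ => o.val (a.eval σ n ρ) (b.eval σ n ρ)
  | .sum x t, ρ => ∑ i ∈ Finset.range n, t.eval σ n (Function.update ρ x i)

/-- The term does not read the array `R`. -/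
def Term.Avoids (R : ℕ) : Term → Prop
  | .lit _ => True
  | .var _ => True
  | .get v t => v ≠ R ∧ t.Avoids R
  | .op _ a b => a.Avoids R ∧ b.Avoids R
  | .sum _ t => t.Avoids R

/-- The cell `r` of the array `R`. -/
def reg (R r : ℕ) : Expr := .get R (.lit r)

/-- The program storing the value of `e` in cell `r` of the array `R`. -/
def setReg (R r : ℕ) (e : Expr) : Prog := .set R (.lit r) e

/-- Memory with the cell `r` of the array `R` replaced by `a`. -/
def Store.put (σ : Store) (R r a : ℕ) : Store := Function.update σ R (Function.update (σ R) r a)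

theorem Store.put_same (σ : Store) (R r a : ℕ) : σ.put R r a R r = a := by
  simp [Store.put]

theorem Store.put_ne_cell (σ : Store) (R : ℕ) {r s : ℕ} (a : ℕ) (h : s ≠ r) :
    σ.put R r a R s = σ R s := by
  simp [Store.put, h]

theorem Store.put_ne_array (σ : Store) {R v : ℕ} (r a : ℕ) (h : v ≠ R) :
    σ.put R r a v = σ v := by
  simp [Store.put, h]

theorem runs_setReg (R r : ℕ) (e : Expr) (σ : Store) :
    Runs (setReg R r e) σ (σ.put R r (e.eval σ)) (1 + r.size + e.cost σ + 1) :=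
  Runs.set R (.lit r) e σ

theorem eval_reg (R r : ℕ) (σ : Store) : (reg R r).eval σ = σ R r := rfl

theorem cost_reg (R r : ℕ) (σ : Store) : (reg R r).cost σ = 2 + r.size + (σ R r).size := by
  simp only [reg, Expr.cost, Expr.eval]
  omega

/-- Compilation of a term: the variable `x` is read from cell `env x` of the array `R`, the
parameter `n` from its cell `0`; cells from `d` on are used as working memory, and the result is
stored in cell `d`. -/
def Term.compile (R : ℕ) : Term → (ℕ → ℕ) → ℕ → Prog
  | .lit c, _, d => setReg R d (.lit c)
  | .var x, env, d => setReg R d (reg R (env x))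
  | .get v t, env, d => .seq (t.compile R env d) (setReg R d (.get v (reg R d)))
  | .op o a b, env, d => .seq (a.compile R env d) (.seq (b.compile R env (d + 1))
      (setReg R d (o.expr (reg R d) (reg R (d + 1)))))
  -- The loop counts down: cell `d` is both the counter and the summation variable, cell `d + 1`
  -- accumulates, and the summand is computed in cell `d + 2`.
  | .sum x t, env, d => .seq (setReg R d (reg R 0)) (.seq (setReg R (d + 1) (.lit 0)) (.seq
      (.loop (reg R d) (.seq (setReg R d (.sub (reg R d) (.lit 1))) (.seq
        (t.compile R (Function.update env x d) (d + 2))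
        (setReg R (d + 1) (.add (reg R (d + 1)) (reg R (d + 2)))))))
      (setReg R d (reg R (d + 1)))))

/-- The program `p` stores `a` in cell `d` of the array `R` in time at most `T`, changing nothing
but cells from `d` on of this array. -/
def Stores (R : ℕ) (p : Prog) (σ : Store) (d a T : ℕ) : Prop :=
  ∃ τ T', Runs p σ τ T' ∧ T' ≤ T ∧ (∀ v, v ≠ R → τ v = σ v) ∧ (∀ r < d, τ R r = σ R r) ∧
    τ R d = a

/-- The loop computing a sum. -/
theorem stores_loop {R d n s c : ℕ} {body : Prog} {f : ℕ → ℕ} {σ₀ : Store}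
    (hn : n.size ≤ s)
    (hs : ∀ m ≤ n, (∑ i ∈ Finset.range n, f i - ∑ i ∈ Finset.range m, f i).size ≤ s)
    (hf : ∀ i < n, (f i).size ≤ s)
    (hbody : ∀ i < n, ∀ σ : Store, (∀ v, v ≠ R → σ v = σ₀ v) → (∀ r < d, σ R r = σ₀ R r) →
      σ R d = i → Stores R body σ (d + 2) (f i) c) :
    ∀ m ≤ n, ∀ σ : Store, (∀ v, v ≠ R → σ v = σ₀ v) → (∀ r < d, σ R r = σ₀ R r) → σ R d = m →
      σ R (d + 1) = ∑ i ∈ Finset.range n, f i - ∑ i ∈ Finset.range m, f i →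
      ∃ τ T, Runs (.loop (reg R d) (.seq (setReg R d (.sub (reg R d) (.lit 1))) (.seq body
          (setReg R (d + 1) (.add (reg R (d + 1)) (reg R (d + 2))))))) σ τ T ∧
        T ≤ m * (c + 8 * s + 8 * d + 50) + (s + d + 3) ∧
        (∀ v, v ≠ R → τ v = σ₀ v) ∧ (∀ r < d, τ R r = σ₀ R r) ∧
        τ R (d + 1) = ∑ i ∈ Finset.range n, f i := by
  have hsz : ∀ a, Nat.size a ≤ a := size_le_self
  have hd0 := hsz d
  have hd1 := hsz (d + 1)
  have hd2 := hsz (d + 2)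
  have h1 := hsz 1
  -- Invariant: with counter value `m` the accumulator holds the terms with index from `m` to `n -
  -- 1`, written as a difference of partial sums.
  intro m
  induction m with
  | zero =>
    intro _ σ h1 h2 h3 h4
    refine ⟨σ, _, .loop_false h3, ?_, h1, h2, by simpa using h4⟩
    rw [cost_reg, h3]
    simp
    omega
  | succ m ih =>
    intro hm σ e1 e2 e3 e4
    set σ1 := σ.put R d m with hσ1
    have r1 : Runs (setReg R d (.sub (reg R d) (.lit 1))) σ σ1
        (1 + d.size + (Expr.sub (reg R d) (.lit 1)).cost σ + 1) := by
      have := runs_setReg R d (.sub (reg R d) (.lit 1)) σ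
      simp only [Expr.eval, eval_reg, e3, Nat.add_sub_cancel] at this
      exact this
    obtain ⟨σ2, T2, r2, hT2, a2, b2, c2⟩ := hbody m hm σ1
      (fun v hv => (Store.put_ne_array σ d m hv).trans (e1 v hv))
      (fun r hr => (Store.put_ne_cell σ R m (by omega)).trans (e2 r hr))
      (Store.put_same σ R d m)
    have c21 : σ2 R (d + 1) = ∑ i ∈ Finset.range n, f i - ∑ i ∈ Finset.range (m + 1), f i := by
      rw [b2 (d + 1) (by omega), hσ1, Store.put_ne_cell _ _ _ (by omega), e4]
    have c2d : σ2 R d = m := by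
      rw [b2 d (by omega), hσ1, Store.put_same]
    have hsum : σ2 R (d + 1) + σ2 R (d + 2) =
        ∑ i ∈ Finset.range n, f i - ∑ i ∈ Finset.range m, f i := by
      have hle : ∑ i ∈ Finset.range (m + 1), f i ≤ ∑ i ∈ Finset.range n, f i :=
        Finset.sum_le_sum_of_subset (Finset.range_subset_range.2 hm)
      rw [c21, c2]
      rw [Finset.sum_range_succ] at hle ⊢
      omega
    have r3 := runs_setReg R (d + 1) (.add (reg R (d + 1)) (reg R (d + 2))) σ2
    simp only [Expr.eval, eval_reg, hsum] at r3
    obtain ⟨τ, T, r4, hT, g1, g2, g3⟩ := ih (by omega) _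
      (fun v hv => (Store.put_ne_array σ2 (d + 1) _ hv).trans ((a2 v hv).trans
        ((Store.put_ne_array σ d m hv).trans (e1 v hv))))
      (fun r hr => (Store.put_ne_cell σ2 R _ (by omega)).trans ((b2 r (by omega)).trans
        ((Store.put_ne_cell σ R m (by omega)).trans (e2 r hr))))
      ((Store.put_ne_cell σ2 R _ (by omega)).trans c2d) (Store.put_same _ _ _ _)
    refine ⟨τ, _, .loop_true (by rw [eval_reg, e3]; omega) (.seq r1 (.seq r2 r3)) r4, ?_,
      g1, g2, g3⟩
    have z1 := hs (m + 1) hm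
    have z2 := hs m (by omega)
    have z3 := hf m hm
    have z4 : m.size ≤ s := (Nat.size_le_size (show m ≤ n by omega)).trans hn
    have z5 : (m + 1).size ≤ s := (Nat.size_le_size hm).trans hn
    have k1 : (Expr.sub (reg R d) (.lit 1)).cost σ ≤ 2 * s + d + 6 := by
      simp only [Expr.cost, cost_reg, Expr.eval, eval_reg, e3, Nat.add_sub_cancel]
      omega
    have k2 : (Expr.add (reg R (d + 1)) (reg R (d + 2))).cost σ2 ≤ 3 * s + 2 * d + 9 := by
      simp only [Expr.cost, cost_reg, eval_reg, hsum]
      rw [c21, c2]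
      omega
    have k3 : (reg R d).cost σ ≤ s + d + 2 := by
      rw [cost_reg, e3]
      omega
    rw [Nat.succ_mul]
    omega

theorem size_sum_le {n s : ℕ} {f : ℕ → ℕ} (hf : ∀ i < n, (f i).size ≤ s) :
    (∑ i ∈ Finset.range n, f i).size ≤ n + s := by
  have h : ∑ i ∈ Finset.range n, f i ≤ n * 2 ^ s := by
    have := Finset.sum_le_card_nsmul (Finset.range n) f (2 ^ s) fun i hi =>
      (Nat.size_le.1 (hf i (Finset.mem_range.1 hi))).le
    simpa using this
  rw [Nat.size_le, pow_add]
  exact h.trans_lt (Nat.mul_lt_mul_of_pos_right Nat.lt_two_pow_self (by positivity))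

/-- Correctness and polynomial running time of compiled terms. -/
theorem Term.stores_compile {R : ℕ} (t : Term) (ht : t.Avoids R) : ∀ (env : ℕ → ℕ) (d : ℕ), 1 ≤ d →
    (∀ x, env x < d) → ∃ q s : ℕ → ℕ, PolyBdd q ∧ PolyBdd s ∧
      ∀ (B n : ℕ) (mem σ : Store) (ρ : ℕ → ℕ), n ≤ B →
        (∀ v, v ≠ R → ∀ i, (mem v i).size ≤ B) → (∀ x, ρ x ≤ B) → (∀ v, v ≠ R → σ v = mem v) →
        σ R 0 = n → (∀ x, σ R (env x) = ρ x) →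
        (t.eval mem n ρ).size ≤ s B ∧ Stores R (t.compile R env d) σ d (t.eval mem n ρ) (q B) := by
  have hsz : ∀ a, Nat.size a ≤ a := size_le_self
  induction t with
  | lit c =>
    intro env d _ _
    refine ⟨fun _ => d + c + 10, fun _ => c, .const _, .const _, ?_⟩
    intro B n mem σ ρ hn hmem hρ hσ h0 henv
    refine ⟨hsz c, _, _, runs_setReg R d _ σ, ?_, fun v hv => Store.put_ne_array σ d _ hv,
      fun r hr => Store.put_ne_cell σ R _ (by omega), Store.put_same _ _ _ _⟩
    have := hsz c
    have := hsz d
    simp only [Expr.cost]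
    omega
  | var x =>
    intro env d _ henvd
    refine ⟨fun B => 2 * d + B + 10, fun B => B, (PolyBdd.const _).add (.id) |>.add (.const _), .id,
      ?_⟩
    intro B n mem σ ρ hn hmem hρ hσ h0 henv
    refine ⟨(hsz _).trans (hρ x), _, _, runs_setReg R d _ σ, ?_,
      fun v hv => Store.put_ne_array σ d _ hv,
      fun r hr => Store.put_ne_cell σ R _ (by omega), ?_⟩
    · rw [cost_reg, henv]
      have := hsz (env x)
      have := hsz d
      have := hsz (ρ x)
      have := hρ x
      have := henvd x
      dsimp only
      omega
    · rw [Store.put_same, eval_reg, henv]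
      rfl
  | get v t ih =>
    intro env d hd henvd
    obtain ⟨q, s, hq, hs, h⟩ := ih ht.2 env d hd henvd
    refine ⟨fun B => q B + s B + B + 2 * d + 10, fun B => B,
      ((((hq.add hs).add .id).add (.const _)).add (.const _)), .id, ?_⟩
    intro B n mem σ ρ hn hmem hρ hσ h0 henv
    obtain ⟨hsize, τ, T, r, hT, a, b, c⟩ := h B n mem σ ρ hn hmem hρ hσ h0 henv
    have hval : (Expr.get v (reg R d)).eval τ = (Term.get v t).eval mem n ρ := by
      simp only [Expr.eval, eval_reg, c, Term.eval, a v ht.1, hσ v ht.1]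
    refine ⟨hmem v ht.1 _, _, _, .seq r (runs_setReg R d _ τ), ?_,
      fun u hu => (Store.put_ne_array τ d _ hu).trans (a u hu),
      fun r hr => (Store.put_ne_cell τ R _ (by omega)).trans (b r hr), ?_⟩
    · simp only [Expr.cost, cost_reg, eval_reg, c, a v ht.1, hσ v ht.1]
      have := hmem v ht.1 (t.eval mem n ρ)
      have := hsz d
      omega
    · rw [Store.put_same, hval]
  | op o t u iht ihu =>
    intro env d hd henvd
    obtain ⟨q1, s1, hq1, hs1, h1⟩ := iht ht.1 env d hd henvd
    obtain ⟨q2, s2, hq2, hs2, h2⟩ := ihu ht.2 env (d + 1) (by omega)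
      fun x => (henvd x).trans (Nat.lt_succ_self d)
    refine ⟨fun B => q1 B + q2 B + 2 * s1 B + 2 * s2 B + (3 * d + 20), fun B => s1 B + s2 B + 1,
      ((((hq1.add hq2).add ((PolyBdd.const 2).mul hs1)).add ((PolyBdd.const 2).mul hs2)).add
      (.const _)), ((hs1.add hs2).add (.const _)), ?_⟩
    intro B n mem σ ρ hn hmem hρ hσ h0 henv
    obtain ⟨z1, τ1, T1, r1, hT1, a1, b1, c1⟩ := h1 B n mem σ ρ hn hmem hρ hσ h0 henv
    obtain ⟨z2, τ2, T2, r2, hT2, a2, b2, c2⟩ := h2 B n mem τ1 ρ hn hmem hρ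
      (fun v hv => (a1 v hv).trans (hσ v hv)) ((b1 0 hd).trans h0)
      (fun x => (b1 _ (henvd x)).trans (henv x))
    have c1' : τ2 R d = t.eval mem n ρ := (b2 d (by omega)).trans c1
    have z3 := o.size_val_le (t.eval mem n ρ) (u.eval mem n ρ)
    refine ⟨?_, _, _, .seq r1 (.seq r2 (runs_setReg R d _ τ2)), ?_,
      fun v hv => (Store.put_ne_array τ2 d _ hv).trans ((a2 v hv).trans (a1 v hv)),
      fun r hr => (Store.put_ne_cell τ2 R _ (by omega)).trans
        ((b2 r (by omega)).trans (b1 r hr)), ?_⟩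
    · simp only [Term.eval]
      omega
    · simp only [Op.cost_expr, cost_reg, eval_reg, c1', c2]
      have := hsz d
      have := hsz (d + 1)
      omega
    · rw [Store.put_same, Op.eval_expr, eval_reg, eval_reg, c1', c2]
      rfl
  | sum x t ih =>
    intro env d hd henvd
    have henv' : ∀ y, Function.update env x d y < d + 2 := by
      intro y
      by_cases hy : y = x
      · subst hy; simp
      · rw [Function.update_of_ne hy]
        exact (henvd y).trans (by omega)
    obtain ⟨q, s, hq, hs, h⟩ := ih ht (Function.update env x d) (d + 2) (by omega) henv'
    refine ⟨fun B => B * (q B + 8 * (B + s B) + 8 * d + 50) + ((B + s B) + d + 3) +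
        (3 * B + s B + 5 * d + 50), fun B => B + s B,
      ((PolyBdd.id.mul (((hq.add ((PolyBdd.const 8).mul (PolyBdd.id.add hs))).add
        (.const _)).add (.const _))).add (((PolyBdd.id.add hs).add (.const _)).add
        (.const _))).add (((((PolyBdd.const 3).mul .id).add hs).add (.const _)).add (.const _)),
      PolyBdd.id.add hs, ?_⟩
    intro B n mem σ ρ hn hmem hρ hσ h0 henv
    set f : ℕ → ℕ := fun i => t.eval mem n (Function.update ρ x i) with hf
    have hρ' : ∀ i < n, ∀ y, Function.update ρ x i y ≤ B := by
      intro i hi y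
      by_cases hy : y = x
      · subst hy; simp; omega
      · rw [Function.update_of_ne hy]
        exact hρ y
    set σ1 := σ.put R d n with hσ1
    set σ2 := σ1.put R (d + 1) 0 with hσ2
    have hbody : ∀ i < n, ∀ σ' : Store, (∀ v, v ≠ R → σ' v = σ2 v) →
        (∀ r < d, σ' R r = σ2 R r) → σ' R d = i → (f i).size ≤ s B ∧
        Stores R (t.compile R (Function.update env x d) (d + 2)) σ' (d + 2) (f i) (q B) := by
      intro i hi σ' e1 e2 e3
      have e2' : ∀ r < d, σ' R r = σ R r := fun r hr => by
        rw [e2 r hr, hσ2, Store.put_ne_cell _ _ _ (by omega), hσ1,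
          Store.put_ne_cell _ _ _ (by omega)]
      refine h B n mem σ' (Function.update ρ x i) hn hmem (hρ' i hi) ?_ ?_ ?_
      · intro v hv
        rw [e1 v hv, hσ2, Store.put_ne_array _ _ _ hv, hσ1, Store.put_ne_array _ _ _ hv, hσ v hv]
      · rw [e2' 0 hd, h0]
      · intro y
        by_cases hy : y = x
        · subst hy; simp [e3]
        · rw [Function.update_of_ne hy, Function.update_of_ne hy, e2' _ (henvd y), henv y]
    have hfs : ∀ i < n, (f i).size ≤ s B := by
      intro i hi
      refine (hbody i hi (σ2.put R d i) (fun v hv => Store.put_ne_array _ _ _ hv)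
        (fun r hr => Store.put_ne_cell _ _ _ (by omega)) (Store.put_same _ _ _ _)).1
    have hsum := size_sum_le hfs
    have r1 : Runs (setReg R d (reg R 0)) σ σ1 (1 + d.size + (reg R 0).cost σ + 1) := by
      have := runs_setReg R d (reg R 0) σ
      rw [eval_reg, h0] at this
      exact this
    have r2 := runs_setReg R (d + 1) (.lit 0) σ1
    simp only [Expr.eval, ← hσ2] at r2
    obtain ⟨τ, T, r3, hT, g1, g2, g3⟩ := stores_loop (R := R) (d := d) (n := n) (s := B + s B)
      (c := q B) (f := f) (σ₀ := σ2)
      ((hsz n).trans (by omega))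
      (fun m _ => (Nat.size_le_size (Nat.sub_le _ _)).trans (hsum.trans (by omega)))
      (fun i hi => (hfs i hi).trans (by omega))
      (fun i hi σ' e1 e2 e3 => (hbody i hi σ' e1 e2 e3).2) n le_rfl σ2 (fun _ _ => rfl)
      (fun _ _ => rfl) (by rw [hσ2, Store.put_ne_cell _ _ _ (by omega), hσ1, Store.put_same])
      (by rw [hσ2, Store.put_same, Nat.sub_self])
    refine ⟨hsum.trans (by dsimp only; omega), _, _,
      .seq r1 (.seq r2 (.seq r3 (runs_setReg R d _ τ))), ?_, ?_, ?_, ?_⟩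
    · have hT' : T ≤ B * (q B + 8 * (B + s B) + 8 * d + 50) + ((B + s B) + d + 3) :=
        hT.trans (Nat.add_le_add_right (Nat.mul_le_mul_right _ hn) _)
      simp only [cost_reg, Expr.cost, h0, g3, Nat.size_zero]
      have := hsz n
      have := hsz d
      have := hsz (d + 1)
      omega
    · intro v hv
      rw [Store.put_ne_array _ _ _ hv, g1 v hv, hσ2, Store.put_ne_array _ _ _ hv, hσ1,
        Store.put_ne_array _ _ _ hv]
    · intro r hr
      rw [Store.put_ne_cell _ _ _ (by omega), g2 r hr, hσ2, Store.put_ne_cell _ _ _ (by omega),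
        hσ1, Store.put_ne_cell _ _ _ (by omega)]
    · rw [Store.put_same, eval_reg, g3]
      rfl

/-! ### From graphs to matrices -/

/-- The program turning the input layout of a graph into that of its adjacency matrix, with a copy
of the matrix in array `V`, and the number of vertices in cell `0` of array `R`. -/
def prepare (V R : ℕ) : Prog :=
  .seq (setReg R 0 (.get 0 (.lit 0))) (.seq (setReg R 1 (.mul (reg R 0) (reg R 0))) (.seq
    -- Array `1` already holds the numerators, so only the denominators 1 have to be written. The
    -- copy in `V` is kept because the approximation algorithm may overwrite array `1`.
    (.loop (reg R 1) (.seq (setReg R 1 (.sub (reg R 1) (.lit 1))) (.seq (.set 2 (reg R 1) (.lit 1))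
      (.set V (reg R 1) (.get 1 (reg R 1))))))
    (.set 0 (.lit 1) (reg R 0))))

theorem runs_prepare_loop {V R S : ℕ} (hV : 5 ≤ V) (hR : V < R) : ∀ (m : ℕ), m ≤ S → ∀ σ : Store,
    σ R 1 = m → (∀ a, (σ 1 a).size ≤ 1) →
    ∃ τ T, Runs (.loop (reg R 1) (.seq (setReg R 1 (.sub (reg R 1) (.lit 1))) (.seq
        (.set 2 (reg R 1) (.lit 1)) (.set V (reg R 1) (.get 1 (reg R 1)))))) σ τ T ∧
      T ≤ m * (6 * S + 50) + (S + 10) ∧ (∀ v, v ≠ R → v ≠ 2 → v ≠ V → τ v = σ v) ∧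
      τ R 0 = σ R 0 ∧ (∀ a, τ 2 a = if a < m then 1 else σ 2 a) ∧
      ∀ a, τ V a = if a < m then σ 1 a else σ V a := by
  intro m
  induction m with
  | zero =>
    intro _ σ h1 _
    refine ⟨σ, _, .loop_false h1, ?_, fun _ _ _ _ => rfl, rfl, by simp, by simp⟩
    rw [cost_reg, h1]
    simp
  | succ m ih =>
    intro hm σ h1 hs
    have r1 := runs_setReg R 1 (.sub (reg R 1) (.lit 1)) σ
    have e1 : (Expr.sub (reg R 1) (.lit 1)).eval σ = m := by simp [Expr.eval, eval_reg, h1]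
    rw [e1] at r1
    set σ1 := σ.put R 1 m with hσ1
    have c1 : σ1 R 1 = m := Store.put_same _ _ _ _
    have r2 := Runs.set 2 (reg R 1) (.lit 1) σ1
    rw [eval_reg, c1] at r2
    set σ2 := σ1.put 2 m 1 with hσ2
    have c2 : σ2 R 1 = m := by rw [hσ2, Store.put_ne_array _ _ _ (by omega), c1]
    have a2 : σ2 1 m = σ 1 m := by
      rw [hσ2, Store.put_ne_array _ _ _ (by omega), hσ1, Store.put_ne_array _ _ _ (by omega)]
    have r3 := Runs.set V (reg R 1) (.get 1 (reg R 1)) σ2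
    rw [eval_reg, c2] at r3
    have e3 : (Expr.get 1 (reg R 1)).eval σ2 = σ 1 m := by simp [Expr.eval, eval_reg, c2, a2]
    rw [e3] at r3
    set σ3 := σ2.put V m (σ 1 m) with hσ3
    have hother : ∀ v, v ≠ R → v ≠ 2 → v ≠ V → σ3 v = σ v := by
      intro v v1 v2 v3
      rw [hσ3, Store.put_ne_array _ _ _ v3, hσ2, Store.put_ne_array _ _ _ v2, hσ1,
        Store.put_ne_array _ _ _ v1]
    have hcellR : ∀ r, σ3 R r = σ1 R r := by
      intro r
      rw [hσ3, Store.put_ne_array _ _ _ (by omega), hσ2, Store.put_ne_array _ _ _ (by omega)]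
    have h31 := hother 1 (by omega) (by omega) (by omega)
    obtain ⟨τ, T, r4, hT, g1, g2, g3, g4⟩ := ih (by omega) σ3 (by rw [hcellR, c1])
      (by rw [h31]; exact hs)
    refine ⟨τ, _, .loop_true (by rw [eval_reg, h1]; omega) (.seq r1 (.seq r2 r3)) r4, ?_,
      fun v v1 v2 v3 => (g1 v v1 v2 v3).trans (hother v v1 v2 v3), ?_, ?_, ?_⟩
    · have z1 := size_le_self m
      have z2 := size_le_self (m + 1)
      have z3 := hs m
      have z4 := size_le_self 1
      simp only [Expr.cost, cost_reg, Expr.eval, eval_reg, h1, c1, c2, a2, Nat.add_sub_cancel]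
      rw [Nat.succ_mul]
      omega
    · rw [g2, hcellR, hσ1, Store.put_ne_cell _ _ _ (by omega)]
    · intro a
      rw [g3]
      have hc : σ3 2 a = if a = m then 1 else σ 2 a := by
        rw [hσ3, Store.put_ne_array _ _ _ (by omega), hσ2]
        by_cases ha : a = m
        · subst ha; simp [Store.put_same]
        · rw [Store.put_ne_cell _ _ _ ha, hσ1, Store.put_ne_array _ _ _ (by omega), if_neg ha]
      rw [hc]
      split_ifs <;> first | rfl | omega
    · intro a
      rw [g4, h31]
      have hc : σ3 V a = if a = m then σ 1 m else σ V a := by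
        rw [hσ3]
        by_cases ha : a = m
        · subst ha; simp [Store.put_same]
        · rw [Store.put_ne_cell _ _ _ ha, hσ2, Store.put_ne_array _ _ _ (by omega), hσ1,
            Store.put_ne_array _ _ _ (by omega), if_neg ha]
      rw [hc]
      by_cases ha : a = m
      · subst ha; simp
      · split_ifs <;> first | rfl | omega

open Classical in
/-- The adjacency matrix with rational entries. -/
noncomputable def adjQ {n : ℕ} (G : SimpleGraph (Fin n)) : Matrix (Fin n) (Fin n) ℚ :=
  fun i j => if G.Adj i j then 1 else 0

theorem adjQ_mem_Icc {n : ℕ} (G : SimpleGraph (Fin n)) (i j : Fin n) :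
    adjQ G i j ∈ Set.Icc (0 : ℚ) 1 := by
  unfold adjQ
  split_ifs <;> simp

theorem adjQ_map {n : ℕ} (G : SimpleGraph (Fin n)) :
    (adjQ G).map (fun a : ℚ => (a : ℝ)) = adjLoops G fun _ => false := by
  ext i j
  by_cases hij : i = j
  · subst hij; simp [adjQ, adjLoops]
  · by_cases h : G.Adj i j <;> simp [adjQ, adjLoops, hij, h]

theorem matrixSize_adjQ_le {n : ℕ} (G : SimpleGraph (Fin n)) :
    matrixSize (adjQ G) ≤ 2 * n + 2 * (n * n) := by
  have h : ∀ i j, (adjQ G i j).num.natAbs.size + (adjQ G i j).den.size ≤ 2 := by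
    intro i j
    unfold adjQ
    have := size_le_self 1
    split_ifs <;> simp [Nat.size_one]
  unfold matrixSize
  have : ∑ i, ∑ j, ((adjQ G i j).num.natAbs.size + (adjQ G i j).den.size) ≤
      ∑ _i : Fin n, ∑ _j : Fin n, 2 :=
    Finset.sum_le_sum fun i _ => Finset.sum_le_sum fun j _ => h i j
  simp only [Finset.sum_const, Finset.card_univ, Fintype.card_fin, smul_eq_mul] at this
  have e : n * (n * 2) = 2 * (n * n) := by ring
  omega

theorem graphStore_size_le {n q : ℕ} (G : SimpleGraph (Fin n)) (r : Fin q → Bool) (v i : ℕ) :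
    (graphStore G r v i).size ≤ n + 1 := by
  have := size_le_self n
  have h1 : Nat.size 1 = 1 := Nat.size_one
  have h0 : Nat.size 0 = 0 := Nat.size_zero
  unfold graphStore
  split
  all_goals try split_ifs
  all_goals omega

/-- Cell `a` of the row-by-row layout of the adjacency matrix. -/
noncomputable def adjCell {n : ℕ} (G : SimpleGraph (Fin n)) (a : ℕ) : ℕ :=
  graphStore G (Fin.elim0 : Fin 0 → Bool) 1 a

theorem graphStore_one {n q : ℕ} (G : SimpleGraph (Fin n)) (r : Fin q → Bool) :
    graphStore G r 1 = adjCell G := by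
  funext a
  simp only [adjCell, graphStore]

theorem adjCell_size_le {n : ℕ} (G : SimpleGraph (Fin n)) (a : ℕ) : (adjCell G a).size ≤ 1 := by
  have h1 : Nat.size 1 = 1 := Nat.size_one
  have h0 : Nat.size 0 = 0 := Nat.size_zero
  simp only [adjCell, graphStore]
  split_ifs <;> omega

theorem adjCell_eq {n : ℕ} (G : SimpleGraph (Fin n)) (i j : Fin n) :
    (adjCell G (i * n + j) : ℝ) = adjLoops G (fun _ => false) i j := by
  have hlt : (i : ℕ) * n + j < n * n := by
    calc (i : ℕ) * n + j < i * n + n := by omega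
      _ = (i + 1) * n := by ring
      _ ≤ n * n := Nat.mul_le_mul_right n i.isLt
  have e : (finProdFinEquiv.symm ⟨(i : ℕ) * n + j, hlt⟩ : Fin n × Fin n) = (i, j) := by
    rw [Equiv.symm_apply_eq]
    ext
    simp [finProdFinEquiv, mul_comm, add_comm]
  classical
  have hc : adjCell G (i * n + j) = if G.Adj i j then 1 else 0 := by
    simp only [adjCell, graphStore]
    rw [dif_pos hlt, e]
  rw [hc]
  by_cases hij : i = j
  · subst hij; simp [adjLoops]
  · by_cases h : G.Adj i j <;> simp [adjLoops, hij, h]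

/-- With no coin flips, array `2` is zero beyond the matrix, as the matrix layout demands. The
equation `q = 0` replaces a literal 0 because the number of coins will be the value of a polynomial.
-/
theorem runs_prepare {V R n : ℕ} (hV : 5 ≤ V) (hR : V < R) (G : SimpleGraph (Fin n))
    {q : ℕ} (hq : q = 0) (r : Fin q → Bool) :
    ∃ τ T, Runs (prepare V R) (graphStore G r) τ T ∧
      T ≤ n * n * (6 * (n * n) + 50) + (6 * (n * n) + 6 * n + 100) ∧
      (∀ v < V, matrixStore (adjQ G) v = τ v) ∧ τ R 0 = n ∧
      ∀ i j : Fin n, τ V (i * n + j) = adjCell G (i * n + j) := by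
  subst hq
  set σ := graphStore G r with hσ
  have hσ0 : σ 0 0 = n := by simp [hσ, graphStore]
  have r1 := runs_setReg R 0 (.get 0 (.lit 0)) σ
  have e1 : (Expr.get 0 (.lit 0)).eval σ = n := hσ0
  rw [e1] at r1
  set σ1 := σ.put R 0 n with hσ1
  have c1 : σ1 R 0 = n := Store.put_same _ _ _ _
  have r2 := runs_setReg R 1 (.mul (reg R 0) (reg R 0)) σ1
  have e2 : (Expr.mul (reg R 0) (reg R 0)).eval σ1 = n * n := by simp [Expr.eval, eval_reg, c1]
  rw [e2] at r2
  set σ2 := σ1.put R 1 (n * n) with hσ2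
  have hσ2v : ∀ v, v ≠ R → σ2 v = σ v := fun v hv => by
    rw [hσ2, Store.put_ne_array _ _ _ hv, hσ1, Store.put_ne_array _ _ _ hv]
  have c2 : σ2 R 0 = n := by rw [hσ2, Store.put_ne_cell _ _ _ (by omega), c1]
  obtain ⟨τ, T, r3, hT, g1, g2, g3, g4⟩ := runs_prepare_loop hV hR (n * n) le_rfl σ2
    (Store.put_same _ _ _ _) (by
      rw [hσ2v 1 (by omega), hσ, graphStore_one]
      exact adjCell_size_le G)
  have c3 : τ R 0 = n := g2.trans c2
  have r4 := Runs.set 0 (.lit 1) (reg R 0) τ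
  rw [eval_reg, c3] at r4
  refine ⟨_, _, .seq r1 (.seq r2 (.seq r3 r4)), ?_, ?_, ?_, ?_⟩
  · simp only [Expr.cost, cost_reg, Expr.eval, eval_reg, c1, c3, hσ0, Nat.size_zero, Nat.size_one]
    have := size_le_self n
    have := size_le_self (n * n)
    omega
  · intro v hv
    have hrest : ∀ v, v ≠ 0 → v ≠ R → v ≠ 2 → v ≠ V → Function.update τ 0
        (Function.update (τ 0) ((Expr.lit 1).eval τ) n) v = graphStore G r v := by
      intro v h1 h2 h3 h4
      rw [Function.update_of_ne h1, g1 v h2 h3 h4, hσ2v v h2]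
    rcases v with _ | _ | _ | v
    · simp only [Function.update_self]
      funext a
      rw [g1 0 (by omega) (by omega) (by omega), hσ2v 0 (by omega)]
      by_cases ha : a = 1
      · subst ha; simp [matrixStore, Expr.eval]
      · simp [matrixStore, Expr.eval, hσ, graphStore, ha]
    · rw [hrest _ (by omega) (by omega) (by omega) (by omega)]
      funext a
      simp only [matrixStore, graphStore, adjQ]
      split_ifs <;> simp
    · rw [Function.update_of_ne (by omega)]
      funext a
      change matrixStore (adjQ G) 2 a = τ 2 a
      rw [g3, hσ2v 2 (by omega)]
      simp only [matrixStore, hσ, graphStore, adjQ]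
      split_ifs <;> first | omega | simp
    · rw [hrest _ (by omega) (by omega) (by omega) (by omega)]
      rfl
  · rw [Function.update_of_ne (by omega), c3]
  · intro i j
    have hlt : (i : ℕ) * n + j < n * n := by
      calc (i : ℕ) * n + j < i * n + n := by omega
        _ = (i + 1) * n := by ring
        _ ≤ n * n := Nat.mul_le_mul_right n i.isLt
    rw [Function.update_of_ne (by omega), g4, if_pos hlt, hσ2v 1 (by omega), hσ, graphStore_one]

/-! ### The acceptance test -/

/-- A number of order `log n` that is easy to compute. -/
def approxLog (n : ℕ) : ℕ := (∑ i ∈ Finset.range n, n / (i + 1)) / n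

/-- Lower end of the range of clique sizes considered by the test. -/
def lowerSize (C n : ℕ) : ℕ := C * ((approxLog n + 3) * 2) * ((approxLog n + 3) * 2)

/-- The test applied to the rounded vector `t / (64 n)`. -/
def PassesTest (C n : ℕ) (t : ℕ → ℕ) : Prop :=
  -- Here `t i` plays `t_[k]`, with `k` the number of entries at or above it; the smaller entries `t
  -- j` play `t_[k+1]` and `t l` plays `t_[n]`. The value 7/8 becomes `56 n` in units of `1 / (64
  -- n)`. The last alternative covers ties `t_[k] = t_[k+1]`, where the value is the minimum.
  (∃ i < n, lowerSize C n ≤ ((Finset.range n).filter fun j => t i ≤ t j).card ∧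
    ((Finset.range n).filter fun j => t i ≤ t j).card * 100 ≤ n ∧
    ∀ j < n, ∀ l < n, t i ≤ t j ∨ t j + 56 * n ≤ t i + t l) ∨ ∀ i < n, 56 * n ≤ t i

namespace Term

/-- Truth value of `a ≤ b`. -/
def le (a b : Term) : Term := .op .sub (.lit 1) (.op .sub a b)

/-- Negation of a truth value. -/
def not (a : Term) : Term := .op .sub (.lit 1) a

/-- The inner product of a row of the matrix in array `V` and the rounded output vector. -/
def row (V : ℕ) (i : Term) : Term :=
  .sum 4 (.op .mul (.get V (.op .add (.op .mul i (.var 0)) (.var 4)))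
    (.op .div (.op .mul (.op .mul (.lit 64) (.var 0)) (.get 3 (.var 4))) (.get 4 (.var 4))))

def approxLog : Term :=
  .op .div (.sum 4 (.op .div (.var 0) (.op .add (.var 4) (.lit 1)))) (.var 0)

def lowerSize (C : ℕ) : Term :=
  .op .mul (.op .mul (.lit C) (.op .mul (.op .add approxLog (.lit 3)) (.lit 2)))
    (.op .mul (.op .add approxLog (.lit 3)) (.lit 2))

def count (V : ℕ) : Term := .sum 5 (le (row V (.var 1)) (row V (.var 5)))

/-- A product is a conjunction, and a universal statement is the vanishing of the sum of its
violations. Variable `0` stands for `n` and is the only free one; rows bind `4`, counts `5` and the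
test itself `1`, `2`, `3`, so nothing is captured. -/
def test (C V : ℕ) : Term :=
  .op .add
    (.sum 1 (.op .mul (.op .mul (le (lowerSize C) (count V))
      (le (.op .mul (count V) (.lit 100)) (.var 0)))
      (not (.sum 2 (.sum 3 (.op .mul (not (le (row V (.var 1)) (row V (.var 2))))
        (not (le (.op .add (row V (.var 2)) (.op .mul (.lit 56) (.var 0)))
          (.op .add (row V (.var 1)) (row V (.var 3)))))))))))
    (not (.sum 1 (not (le (.op .mul (.lit 56) (.var 0)) (row V (.var 1))))))

end Term

/-- The rounded inner products of the rows of the matrix in array `V` and the output vector. -/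
def roundedRow (σ : Store) (V n i : ℕ) : ℕ :=
  ∑ j ∈ Finset.range n, σ V (i * n + j) * (64 * n * σ 3 j / σ 4 j)

/-- Truncated subtraction supplies the comparisons that the term language does not have. -/
theorem one_sub_sub_eq (a b : ℕ) : 1 - (a - b) = if a ≤ b then 1 else 0 := by
  split_ifs <;> omega

theorem one_sub_ite (p : Prop) [Decidable p] : 1 - (if p then 1 else 0) = if ¬ p then 1 else 0 := by
  split_ifs <;> rfl

theorem test_ne_zero_iff {C V n : ℕ} (σ : Store) :
    (Term.test C V).eval σ n (fun _ => n) ≠ 0 ↔ PassesTest C n (roundedRow σ V n) := by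
  have hrow : ∀ (x : ℕ) (ρ : ℕ → ℕ), x ≠ 4 → ρ 0 = n →
      (Term.row V (.var x)).eval σ n ρ = roundedRow σ V n (ρ x) := by
    intro x ρ hx h0
    simp [Term.row, Term.eval, Op.val, roundedRow, hx, h0]
  have hcount : ∀ ρ : ℕ → ℕ, ρ 0 = n → (Term.count V).eval σ n ρ =
      ((Finset.range n).filter fun j => roundedRow σ V n (ρ 1) ≤ roundedRow σ V n j).card := by
    intro ρ h0
    rw [Finset.card_filter]
    simp only [Term.count, Term.eval, Term.le, Op.val]
    refine Finset.sum_congr rfl fun j _ => ?_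
    rw [hrow _ _ (by norm_num) (by simpa using h0), hrow _ _ (by norm_num) (by simpa using h0),
      one_sub_sub_eq]
    simp
  have hlower : ∀ ρ : ℕ → ℕ, ρ 0 = n → (Term.lowerSize C).eval σ n ρ = lowerSize C n := by
    intro ρ h0
    simp [Term.lowerSize, Term.approxLog, Term.eval, Op.val, lowerSize, approxLog, h0]
  simp [Term.test, Term.eval, Term.le, Term.not, Op.val, one_sub_sub_eq, one_sub_ite, hrow, hcount,
    hlower, PassesTest, Nat.sub_eq_zero_iff_le, Nat.one_le_iff_ne_zero]
  rw [or_iff_not_imp_left]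
  refine imp_congr ?_ Iff.rfl
  push Not
  constructor
  · intro h i hi h1 h2
    obtain ⟨j, hj, l, hl, h3, h4⟩ := h i hi h2 h1
    exact ⟨j, hj, l, hl, h4, h3⟩
  · intro h i hi h1 h2
    obtain ⟨j, hj, l, hl, h3, h4⟩ := h i hi h2 h1
    exact ⟨j, hj, l, hl, h4, h3⟩

/-! ### Meaning of the test -/

theorem card_range_filter {n : ℕ} (P : ℕ → Prop) [DecidablePred P] :
    ((Finset.range n).filter P).card = (Finset.univ.filter fun i : Fin n => P i).card := by
  rw [Finset.card_filter, Finset.card_filter,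
    ← Fin.sum_univ_eq_sum_range (fun i => if P i then 1 else 0)]

theorem scaled_le_iff {n : ℕ} (hn : 0 < n) (a b : ℕ) :
    a ≤ b ↔ (a : ℝ) / (64 * n) ≤ (b : ℝ) / (64 * n) := by
  have : (0 : ℝ) < 64 * n := by positivity
  rw [div_le_div_iff_of_pos_right this]
  exact Nat.cast_le.symm

theorem card_scaled {n : ℕ} (t : ℕ → ℕ) (i : Fin n) :
    ((Finset.range n).filter fun j => t i ≤ t j).card =
      (Finset.univ.filter fun j : Fin n => (t i : ℝ) / (64 * n) ≤ (t j : ℝ) / (64 * n)).card := by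
  rw [card_range_filter]
  congr 1
  ext j
  simp only [Finset.mem_filter, Finset.mem_univ, true_and]
  exact scaled_le_iff i.pos _ _

theorem scaled_add_le_iff {n : ℕ} (hn : 0 < n) (a b c : ℕ) : a + 56 * n ≤ b + c ↔
    (a : ℝ) / (64 * n) + 7 / 8 ≤ (b : ℝ) / (64 * n) + (c : ℝ) / (64 * n) := by
  have h : (0 : ℝ) < 64 * n := by positivity
  have e : (7 / 8 : ℝ) = (56 * n) / (64 * n) := by field_simp; norm_num
  rw [e, ← add_div, ← add_div, div_le_div_iff_of_pos_right h]
  exact_mod_cast Iff.rfl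

/-- If `t_[k] = t_[k+1]`, all entries are at least 7/8. Otherwise exactly `k` entries reach `t_[k]`,
and an index attaining it is the witness. -/
theorem passesTest_of_le_gClique {C n k : ℕ} {t : ℕ → ℕ} (h1 : 1 ≤ k) (hn : k < n)
    (hC : lowerSize C n ≤ k) (hk : k * 100 ≤ n)
    (h : 7 / 8 ≤ gClique n k fun i => (t i : ℝ) / (64 * n)) : PassesTest C n t := by
  have hpos : 0 < n := by omega
  set u : Fin n → ℝ := fun i => (t i : ℝ) / (64 * n) with hu
  unfold gClique at h
  have hanti := nthLargest_anti u h1 (Nat.le_succ k) hn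
  simp only [Nat.succ_eq_add_one] at hanti
  by_cases hgap : nthLargest u k ≤ nthLargest u (k + 1)
  · right
    intro i hi
    have := nthLargest_self_le u ⟨i, hi⟩
    have e := (scaled_add_le_iff hpos 0 (t i) 0).2 (by
      simp only [Nat.cast_zero, zero_div, zero_add, add_zero]
      change (7 / 8 : ℝ) ≤ u ⟨i, hi⟩
      linarith)
    omega
  · push Not at hgap
    left
    obtain ⟨i, hi⟩ := exists_eq_nthLargest u h1 hn.le
    have hcard : ((Finset.range n).filter fun j => t i ≤ t j).card = k := by
      rw [card_scaled t i]
      change (Finset.univ.filter fun j => u i ≤ u j).card = k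
      rw [hi]
      apply le_antisymm _ (card_le_nthLargest u h1 hn.le)
      have := card_nthLargest_lt u (i := k + 1) (by omega) hn
      have h2 : (Finset.univ.filter fun j => nthLargest u k ≤ u j).card ≤
          (Finset.univ.filter fun j => nthLargest u (k + 1) < u j).card := by
        apply Finset.card_le_card
        intro j
        simp only [Finset.mem_filter, Finset.mem_univ, true_and]
        exact hgap.trans_le
      omega
    refine ⟨i, i.isLt, by rw [hcard]; exact hC, by rw [hcard]; exact hk, fun j hj l hl => ?_⟩
    by_cases hij : t i ≤ t j
    · exact Or.inl hij
    · right
      rw [scaled_le_iff hpos] at hij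
      have hij' : ¬ u i ≤ u ⟨j, hj⟩ := hij
      rw [hi] at hij'
      rw [scaled_add_le_iff hpos]
      change u ⟨j, hj⟩ + 7 / 8 ≤ u i + u ⟨l, hl⟩
      have h2 : u ⟨j, hj⟩ ≤ nthLargest u (k + 1) := by
        by_contra hc
        exact hij' (nthLargest_le_of_lt u h1 hn _ (not_le.1 hc))
      have h3 := nthLargest_self_le u ⟨l, hl⟩
      rw [hi]
      linarith

/-- The size is the number of entries at or above `t i`, which need not be the planted size. If all
entries are large, any size in the range works and the lower end is taken. -/
theorem exists_le_gClique_of_passesTest {C n : ℕ} {t : ℕ → ℕ} (hC1 : 1 ≤ lowerSize C n)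
    (hC2 : lowerSize C n * 100 ≤ n) (h : PassesTest C n t) :
    ∃ k, 1 ≤ k ∧ k < n ∧ lowerSize C n ≤ k ∧ k * 100 ≤ n ∧
      7 / 8 ≤ gClique n k fun i => (t i : ℝ) / (64 * n) := by
  have hpos : 0 < n := by omega
  set u : Fin n → ℝ := fun i => (t i : ℝ) / (64 * n) with hu
  rcases h with ⟨i, hi, hlow, hhigh, h⟩ | h
  · set k := ((Finset.range n).filter fun j => t i ≤ t j).card with hk
    have hk' : k = (Finset.univ.filter fun j => u ⟨i, hi⟩ ≤ u j).card := card_scaled t ⟨i, hi⟩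
    have h1 : 1 ≤ k := hC1.trans hlow
    have hn : k < n := by omega
    refine ⟨k, h1, hn, hlow, hhigh, ?_⟩
    have g1 : u ⟨i, hi⟩ ≤ nthLargest u k := (le_nthLargest_iff u h1 hn.le _).2 hk'.le
    have g2 : nthLargest u (k + 1) < u ⟨i, hi⟩ := by
      by_contra hc
      have := (le_nthLargest_iff u (i := k + 1) (by omega) hn _).1 (not_lt.1 hc)
      omega
    obtain ⟨j, hj⟩ := exists_eq_nthLargest u (i := k + 1) (by omega) hn
    obtain ⟨l, hl⟩ := exists_eq_nthLargest u (i := n) (by omega) le_rfl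
    rcases h j j.isLt l l.isLt with h2 | h2
    · rw [scaled_le_iff hpos] at h2
      have h2' : u ⟨i, hi⟩ ≤ u j := h2
      linarith
    · rw [scaled_add_le_iff hpos] at h2
      have h2' : u j + 7 / 8 ≤ u ⟨i, hi⟩ + u l := h2
      unfold gClique
      linarith
  · refine ⟨lowerSize C n, hC1, by omega, le_rfl, hC2, ?_⟩
    have hn : lowerSize C n < n := by omega
    have hanti := nthLargest_anti u hC1 (Nat.le_succ _) hn
    simp only [Nat.succ_eq_add_one] at hanti
    have hmin : 7 / 8 ≤ nthLargest u n := by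
      rw [le_nthLargest_self_iff u hpos]
      intro i
      have := (scaled_add_le_iff hpos 0 (t i) 0).1 (by have := h i i.isLt; omega)
      simpa using this
    unfold gClique
    linarith

/-! ### The distinguisher -/

/-- Run `P` on the adjacency matrix of a graph with more than `N` vertices, and test the output. -/
def distinguisher (P : Prog) (C N : ℕ) : Prog :=
  -- For `n ≤ N` the clique size may be out of range and `P` carries no guarantee; these `n` do not
  -- affect the limits. The arrays `max P.bound 5` and its successor are not mentioned by `P` and
  -- avoid the input and output arrays.
  .ite (.sub (.get 0 (.lit 0)) (.lit N))
    (.seq (prepare (max P.bound 5) (max P.bound 5 + 1)) (.seq P (.seq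
      ((Term.test C (max P.bound 5)).compile (max P.bound 5 + 1) (fun _ => 0) 1)
      (.set 3 (.lit 0) (reg (max P.bound 5 + 1) 1)))))
    .skip

theorem test_avoids {C V R : ℕ} (hV : V < R) (h5 : 5 ≤ V) : (Term.test C V).Avoids R := by
  have h3 : 3 ≠ R := by omega
  have h4 : 4 ≠ R := by omega
  simp [Term.test, Term.le, Term.not, Term.lowerSize, Term.approxLog, Term.count, Term.row,
    Term.Avoids, hV.ne, h3, h4]

/-- The relation between the output `x` of an approximation algorithm on the adjacency matrix of `G`
and the numbers `t` to which the test is applied. -/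
def Rounded {n : ℕ} (G : SimpleGraph (Fin n)) (x : Fin n → ℝ) (t : ℕ → ℕ) : Prop :=
  ∀ i : Fin n, |(t i : ℝ) / (64 * n) - (adjLoops G fun _ => false).mulVec x i| ≤ 1 / 64

theorem abs_natDiv_sub_le (a b c : ℕ) : |((c * a / b : ℕ) : ℝ) - c * (a / b)| ≤ 1 := by
  rcases Nat.eq_zero_or_pos b with rfl | hb
  · simp
  · have hb' : (0 : ℝ) < b := by exact_mod_cast hb
    have h1 : ((c * a / b : ℕ) : ℝ) ≤ c * (a / b) := by
      have := Nat.cast_div_le (α := ℝ) (m := c * a) (n := b)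
      rw [Nat.cast_mul, mul_div_assoc] at this
      exact this
    have h2 : (c : ℝ) * (a / b) ≤ (c * a / b : ℕ) + 1 := by
      have := Nat.lt_div_mul_add hb (a := c * a)
      rw [← mul_div_assoc, div_le_iff₀ hb', add_mul, one_mul]
      exact_mod_cast this.le
    rw [abs_le]
    constructor <;> linarith

/-- Each of the `n` summands is rounded by at most 1, so the row is off by at most `n`, which is
`1/64` on the scale `64 n`. -/
theorem rounded_roundedRow {n V : ℕ} (G : SimpleGraph (Fin n)) {τ : Store}
    (hV : ∀ i j : Fin n, τ V (i * n + j) = adjCell G (i * n + j)) :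
    Rounded G (outputVec n τ) (roundedRow τ V n) := by
  intro i
  have hn : (0 : ℝ) < n := by exact_mod_cast i.pos
  have e : (roundedRow τ V n i : ℝ) = ∑ j : Fin n, adjLoops G (fun _ => false) i j *
      ((64 * n * τ 3 j / τ 4 j : ℕ) : ℝ) := by
    rw [roundedRow, ← Fin.sum_univ_eq_sum_range (fun j => τ V (i * n + j) *
      (64 * n * τ 3 j / τ 4 j)), Nat.cast_sum]
    refine Finset.sum_congr rfl fun j _ => ?_
    rw [Nat.cast_mul, hV i j, adjCell_eq]
  have e2 : (roundedRow τ V n i : ℝ) - 64 * n * (adjLoops G fun _ => false).mulVec (outputVec n τ) i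
      = ∑ j : Fin n, adjLoops G (fun _ => false) i j *
        (((64 * n * τ 3 j / τ 4 j : ℕ) : ℝ) - ((64 * n : ℕ) : ℝ) * (τ 3 j / τ 4 j)) := by
    rw [e, Matrix.mulVec, dotProduct, Finset.mul_sum, ← Finset.sum_sub_distrib]
    refine Finset.sum_congr rfl fun j _ => ?_
    simp only [outputVec]
    push_cast
    ring
  have e3 : |(roundedRow τ V n i : ℝ) -
      64 * n * (adjLoops G fun _ => false).mulVec (outputVec n τ) i| ≤ n := by
    rw [e2]
    calc _ ≤ ∑ j : Fin n, |adjLoops G (fun _ => false) i j *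
          (((64 * n * τ 3 j / τ 4 j : ℕ) : ℝ) - ((64 * n : ℕ) : ℝ) * (τ 3 j / τ 4 j))| :=
          Finset.abs_sum_le_sum_abs _ _
      _ ≤ ∑ _j : Fin n, (1 : ℝ) := by
          refine Finset.sum_le_sum fun j _ => ?_
          have ha := adjLoops_mem_Icc G (fun _ => false) i j
          rw [abs_mul, abs_of_nonneg ha.1]
          exact mul_le_one₀ ha.2 (abs_nonneg _) (abs_natDiv_sub_le _ _ _)
      _ = n := by simp
  have h64 : (0 : ℝ) < 64 * n := by positivity
  have e4 : (roundedRow τ V n i : ℝ) / (64 * n) -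
      (adjLoops G fun _ => false).mulVec (outputVec n τ) i = ((roundedRow τ V n i : ℝ) -
      64 * n * (adjLoops G fun _ => false).mulVec (outputVec n τ) i) / (64 * n) := by
    field_simp
  rw [e4, abs_div, abs_of_pos h64, div_le_iff₀ h64]
  linarith

/-- Running time and outcome of the distinguisher. -/
theorem runs_distinguisher {P : Prog} {C N : ℕ} {p : Polynomial ℕ}
    {Good : ∀ n, SimpleGraph (Fin n) → (Fin n → ℝ) → Prop}
    (hP : ∀ n, N < n → ∀ G : SimpleGraph (Fin n), ∃ τ T, Runs P (matrixStore (adjQ G)) τ T ∧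
      T ≤ p.eval (matrixSize (adjQ G)) ∧ Good n G (outputVec n τ)) :
    ∃ b : Polynomial ℕ, ∀ (n : ℕ) (G : SimpleGraph (Fin n)) (q : ℕ) (_ : q = 0)
      (r : Fin q → Bool), ∃ τ T, Runs (distinguisher P C N) (graphStore G r) τ T ∧ T ≤ b.eval n ∧
        (N < n → ∃ x t, Good n G x ∧ Rounded G x t ∧ (τ 3 0 ≠ 0 ↔ PassesTest C n t)) := by
  set V := max P.bound 5 with hV
  have hV5 : 5 ≤ V := le_max_right _ _
  obtain ⟨qt, st, hqt, hst, hterm⟩ := (Term.test C V).stores_compile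
    (test_avoids (C := C) (Nat.lt_succ_self V) hV5) (fun _ => 0) 1 le_rfl (fun _ => one_pos)
  set f1 : ℕ → ℕ := fun n => n * n * (6 * (n * n) + 50) + (6 * (n * n) + 6 * n + 100) with hf1
  set f2 : ℕ → ℕ := fun n => p.eval (2 * n + 2 * (n * n)) with hf2
  -- Bounds every cell's bit length when the test starts: that of the input plus the time spent so
  -- far.
  set f3 : ℕ → ℕ := fun n => n + 1 + f1 n + f2 n with hf3
  have pf1 : PolyBdd f1 :=
    (((PolyBdd.id.mul .id).mul (((PolyBdd.const 6).mul (PolyBdd.id.mul .id)).add (.const _))).add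
      ((((PolyBdd.const 6).mul (PolyBdd.id.mul .id)).add ((PolyBdd.const 6).mul .id)).add
      (.const _)))
  have pf2 : PolyBdd f2 :=
    PolyBdd.eval_comp p
      (((PolyBdd.const 2).mul .id).add ((PolyBdd.const 2).mul (PolyBdd.id.mul .id)))
  have pf3 : PolyBdd f3 := ((PolyBdd.id.add (.const _)).add pf1).add pf2
  obtain ⟨q', hq'⟩ := hqt
  obtain ⟨s', hs'⟩ := hst
  have pfin : PolyBdd fun n => (2 * n + N + 20) + f1 n + f2 n + q'.eval (f3 n) + s'.eval (f3 n) :=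
    (((((((PolyBdd.const 2).mul .id).add (.const _)).add (.const _)).add pf1).add pf2).add
      (PolyBdd.eval_comp q' pf3)).add (PolyBdd.eval_comp s' pf3)
  obtain ⟨b, hb⟩ := pfin
  refine ⟨b, fun n G q hq r => ?_⟩
  have hcond : (Expr.sub (.get 0 (.lit 0)) (.lit N)).eval (graphStore G r) = n - N := by
    simp [Expr.eval, graphStore]
  have hcost : (Expr.sub (.get 0 (.lit 0)) (.lit N)).cost (graphStore G r) ≤ 2 * n + N + 5 := by
    have h0 : graphStore G r 0 0 = n := by simp [graphStore]
    have := size_le_self n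
    have := size_le_self N
    have := size_le_self (n - N)
    simp only [Expr.cost, Expr.eval, h0, Nat.size_zero]
    omega
  have hbn := hb n
  by_cases hn : N < n
  · obtain ⟨σ1, T1, r1, hT1, a1, b1, c1⟩ := runs_prepare hV5 (Nat.lt_succ_self V) G hq r
    obtain ⟨τ0, T2, r2, hT2, hgood⟩ := hP n hn G
    -- The prepared memory agrees with the matrix layout only below `V`. By the frame property `P`
    -- behaves the same there and leaves the copy of the matrix and the registers intact.
    obtain ⟨σ2, r2', a2, b2⟩ := r2.frame (le_max_left P.bound 5) σ1 a1
    have hT1' : T1 ≤ f1 n := hT1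
    have hT2' : T2 ≤ f2 n := hT2.trans (polynomial_eval_mono p (matrixSize_adjQ_le G))
    have hsize : ∀ v i, (σ2 v i).size ≤ f3 n := by
      intro v i
      have := r2'.size_le _ (r1.size_le _ (graphStore_size_le G r)) v i
      simp only [hf3]
      omega
    obtain ⟨hsz, σ3, T3, r3, hT3, a3, b3, c3⟩ := hterm (f3 n) n σ2 σ2 (fun _ => n)
      (by simp only [hf3]; omega) (fun v _ i => hsize v i) (fun _ => by simp only [hf3]; omega)
      (fun _ _ => rfl) ((congrFun (b2 (V + 1) (Nat.le_succ V)) 0).trans b1)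
      (fun _ => (congrFun (b2 (V + 1) (Nat.le_succ V)) 0).trans b1)
    have hs3 := hs' (f3 n)
    have hq3 := hq' (f3 n)
    have r4 := Runs.set 3 (.lit 0) (reg (V + 1) 1) σ3
    refine ⟨_, _, .ite_true (by rw [hcond]; omega) (.seq r1 (.seq r2' (.seq r3 r4))), ?_, ?_⟩
    · have k1 : (Expr.lit 0).cost σ3 = 1 := by simp [Expr.cost]
      have k2 : (reg (V + 1) 1).cost σ3 = 3 + ((Term.test C V).eval σ2 n fun _ => n).size := by
        rw [cost_reg, c3, Nat.size_one]
      dsimp only at hbn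
      omega
    · intro _
      have hout : outputVec n σ2 = outputVec n τ0 := by
        funext j
        simp only [outputVec]
        rw [a2 3 (by omega), a2 4 (by omega)]
      refine ⟨outputVec n σ2, roundedRow σ2 V n, hout ▸ hgood, rounded_roundedRow G ?_, ?_⟩
      · intro i j
        rw [b2 V le_rfl, c1]
      · rw [← test_ne_zero_iff, ← c3]
        simp [Expr.eval, eval_reg]
  · refine ⟨_, _, .ite_false (by rw [hcond]; omega) (.skip _), ?_, fun h => absurd h hn⟩
    dsimp only at hbn
    omega

/-! ### Asymptotics of the range of clique sizes -/

theorem sum_div_eq_harmonic (n : ℕ) :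
    ∑ i ∈ Finset.range n, (n : ℝ) / ((i + 1 : ℕ) : ℝ) = n * (harmonic n : ℝ) := by
  rw [harmonic, Rat.cast_sum, Finset.mul_sum]
  refine Finset.sum_congr rfl fun i _ => ?_
  push_cast
  rw [div_eq_mul_inv]

theorem approxLog_le {n : ℕ} (hn : 0 < n) : (approxLog n : ℝ) ≤ 1 + Real.log n := by
  have hn' : (0 : ℝ) < n := by exact_mod_cast hn
  refine le_trans ?_ (harmonic_le_one_add_log n)
  have h1 : (approxLog n : ℝ) ≤ ((∑ i ∈ Finset.range n, n / (i + 1) : ℕ) : ℝ) / n := Nat.cast_div_le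
  refine h1.trans ?_
  rw [div_le_iff₀ hn', mul_comm, ← sum_div_eq_harmonic, Nat.cast_sum]
  exact Finset.sum_le_sum fun i _ => Nat.cast_div_le

/-- Rounding loses at most 1 in each of the `n` quotients, hence 1 after division by `n`, and at
most 1 more in that division; so `approxLog n + 2` is at least the harmonic number. -/
theorem log_le_approxLog {n : ℕ} (hn : 0 < n) : Real.log n ≤ approxLog n + 2 := by
  have hn' : (0 : ℝ) < n := by exact_mod_cast hn
  have h0 : Real.log n ≤ harmonic n := by
    refine le_trans ?_ (log_add_one_le_harmonic n)
    exact Real.log_le_log hn' (by push_cast; linarith)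
  have h1 : (n : ℝ) * harmonic n ≤ (∑ i ∈ Finset.range n, n / (i + 1) : ℕ) + n := by
    rw [← sum_div_eq_harmonic, Nat.cast_sum]
    have e : ∑ i ∈ Finset.range n, (((n / (i + 1) : ℕ) : ℝ) + 1) =
        ∑ i ∈ Finset.range n, ((n / (i + 1) : ℕ) : ℝ) + n := by
      simp [Finset.sum_add_distrib]
    rw [← e]
    refine Finset.sum_le_sum fun i _ => ?_
    have hi : 0 < i + 1 := Nat.succ_pos i
    have hi' : (0 : ℝ) < ((i + 1 : ℕ) : ℝ) := by exact_mod_cast hi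
    rw [div_le_iff₀ hi', add_mul, one_mul]
    exact_mod_cast (Nat.lt_div_mul_add hi (a := n)).le
  have h2 : ((∑ i ∈ Finset.range n, n / (i + 1) : ℕ) : ℝ) ≤ approxLog n * n + n := by
    exact_mod_cast (Nat.lt_div_mul_add hn (a := ∑ i ∈ Finset.range n, n / (i + 1))).le
  have h3 : (n : ℝ) * harmonic n ≤ n * (approxLog n + 2) := by linarith
  exact h0.trans (le_of_mul_le_mul_left h3 hn')

theorem log_two_le_approxLog {n : ℕ} (hn : 0 < n) :
    Nat.log 2 n + 1 ≤ (approxLog n + 3) * 2 := by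
  have h1 : ((2 ^ Nat.log 2 n : ℕ) : ℝ) ≤ n := by exact_mod_cast Nat.pow_log_le_self 2 hn.ne'
  have h2 := Real.log_le_log (by positivity) h1
  rw [Nat.cast_pow, Real.log_pow] at h2
  have h3 := log_le_approxLog hn
  have h4 : (0.69 : ℝ) < Real.log 2 := lt_trans (by norm_num) Real.log_two_gt_d9
  have h5 : (0 : ℝ) ≤ Nat.log 2 n := Nat.cast_nonneg _
  have h6 : (0 : ℝ) ≤ approxLog n := Nat.cast_nonneg _
  have h7 : ((Nat.log 2 n + 1 : ℕ) : ℝ) ≤ (((approxLog n + 3) * 2 : ℕ) : ℝ) := by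
    push_cast at h2 ⊢
    nlinarith
  exact_mod_cast h7

theorem mul_sq_log_le_lowerSize (C : ℕ) {n : ℕ} (hn : 0 < n) :
    C * (Nat.log 2 n + 1) ^ 2 ≤ lowerSize C n := by
  unfold lowerSize
  rw [mul_assoc, ← pow_two]
  exact Nat.mul_le_mul_left C (Nat.pow_le_pow_left (log_two_le_approxLog hn) 2)

section Sizes

variable {k : ℕ → ℕ}

theorem eventually_mul_sq_log_le
    (hk_low : (fun n : ℕ => Real.log n ^ 2) =o[atTop] (fun n : ℕ => (k n : ℝ))) (c : ℝ)
    (hc : 0 < c) : ∀ᶠ n : ℕ in atTop, c * Real.log n ^ 2 ≤ k n := by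
  filter_upwards [hk_low.bound (show (0 : ℝ) < 1 / c by positivity)] with n h1
  rw [Real.norm_of_nonneg (by positivity), Real.norm_of_nonneg (by positivity), one_div,
    le_inv_mul_iff₀ hc] at h1
  exact h1

theorem eventually_lowerSize_le
    (hk_low : (fun n : ℕ => Real.log n ^ 2) =o[atTop] (fun n : ℕ => (k n : ℝ))) (C : ℕ) :
    ∀ᶠ n : ℕ in atTop, lowerSize C n ≤ k n := by
  have hlog : Tendsto (fun n : ℕ => Real.log n) atTop atTop :=
    Real.tendsto_log_atTop.comp tendsto_natCast_atTop_atTop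
  -- Once `log n ≥ 1`, `(approxLog n + 3) * 2 ≤ 2 log n + 8 ≤ 10 log n`, whose square accounts for
  -- the 100.
  filter_upwards [eventually_mul_sq_log_le hk_low (100 * (C + 1)) (by positivity),
    hlog.eventually_ge_atTop 1, eventually_gt_atTop 0] with n h1 h2 hn
  have h3 := approxLog_le hn
  have h4 : (0 : ℝ) ≤ approxLog n := Nat.cast_nonneg _
  have h5 : ((approxLog n : ℝ) + 3) * 2 ≤ 10 * Real.log n := by linarith
  have h6 : (lowerSize C n : ℝ) ≤ k n := by
    unfold lowerSize
    push_cast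
    calc (C : ℝ) * ((approxLog n + 3) * 2) * ((approxLog n + 3) * 2)
        ≤ (C + 1) * (10 * Real.log n) * (10 * Real.log n) := by gcongr; linarith
      _ = 100 * (C + 1) * Real.log n ^ 2 := by ring
      _ ≤ k n := h1
  exact_mod_cast h6

theorem eventually_mul_hundred_le
    (hk_high : (fun n : ℕ => (k n : ℝ)) =o[atTop] (fun n : ℕ => Real.sqrt n)) :
    ∀ᶠ n : ℕ in atTop, k n * 100 ≤ n := by
  filter_upwards [hk_high.bound (show (0 : ℝ) < 1 / 100 by norm_num), eventually_ge_atTop 1]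
    with n h1 hn
  rw [Real.norm_of_nonneg (by positivity), Real.norm_of_nonneg (by positivity)] at h1
  have hn' : (1 : ℝ) ≤ n := by exact_mod_cast hn
  have h2 : Real.sqrt n ≤ n := by
    rw [Real.sqrt_le_left (by linarith)]
    nlinarith
  have : (k n : ℝ) * 100 ≤ n := by linarith
  exact_mod_cast this

theorem eventually_one_le
    (hk_low : (fun n : ℕ => Real.log n ^ 2) =o[atTop] (fun n : ℕ => (k n : ℝ))) :
    ∀ᶠ n : ℕ in atTop, 1 ≤ k n := by
  filter_upwards [eventually_lowerSize_le hk_low 1] with n hn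
  unfold lowerSize at hn
  nlinarith

theorem eventually_add_two_le
    (hk_low : (fun n : ℕ => Real.log n ^ 2) =o[atTop] (fun n : ℕ => (k n : ℝ)))
    (hk_high : (fun n : ℕ => (k n : ℝ)) =o[atTop] (fun n : ℕ => Real.sqrt n)) :
    ∀ᶠ n : ℕ in atTop, 1 ≤ k n ∧ k n + 2 ≤ n := by
  filter_upwards [eventually_one_le hk_low, eventually_mul_hundred_le hk_high] with n h1 h2
  omega

end Sizes

/-! ### Hardness -/

/-- If the desired outcome occurs on `S n` for all coin flips, only the graph contributes to the
error. -/
theorem tendsto_lintegral_uniformOn_one {μ : ∀ n, Measure (SimpleGraph (Fin n))} {q : ℕ → ℕ}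
    {S : ∀ n, Set (SimpleGraph (Fin n))} (R : ∀ n, SimpleGraph (Fin n) → Set (Fin (q n) → Bool))
    (hμ : ∀ᶠ n in atTop, IsProbabilityMeasure (μ n))
    (hR : ∀ᶠ n in atTop, ∀ G ∈ S n, ∀ r, r ∈ R n G)
    (hS : Tendsto (fun n => μ n (S n)) atTop (𝓝 1)) :
    Tendsto (fun n => ∫⁻ G, ProbabilityTheory.uniformOn Set.univ (R n G) ∂(μ n)) atTop (𝓝 1) := by
  refine tendsto_of_tendsto_of_tendsto_of_le_of_le' hS tendsto_const_nhds ?_ ?_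
  · filter_upwards [hR] with n hn
    rw [← lintegral_indicator_one (MeasurableSet.of_discrete)]
    refine lintegral_mono fun G => ?_
    by_cases hG : G ∈ S n
    · have : R n G = Set.univ := Set.eq_univ_of_forall (hn G hG)
      have hp := ProbabilityTheory.isProbabilityMeasure_uniformOn
        (Set.finite_univ (α := Fin (q n) → Bool)) Set.univ_nonempty
      simp only [this, measure_univ]
      simp [hG]
    · simp [hG]
  · filter_upwards [hμ] with n hn
    have := hn
    calc _ ≤ ∫⁻ _G, 1 ∂(μ n) := by
          refine lintegral_mono fun G => ?_
          have hp := ProbabilityTheory.isProbabilityMeasure_uniformOn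
            (Set.finite_univ (α := Fin (q n) → Bool)) Set.univ_nonempty
          exact prob_le_one
      _ = 1 := by simp

/-- Accuracy `1/64` suffices. With a planted clique the tested value is at least `1 - 1/64 - 1/64 -
3/64 = 59/64`, the losses being optimum, approximation and rounding. On a random graph it is at most
`3/4 + 1/64 + 3/64 = 52/64`. The threshold `7/8 = 56/64` separates the two. -/
theorem not_hasAdditivePTAS (k : ℕ → ℕ)
    (hk_low : (fun n : ℕ => Real.log n ^ 2) =o[atTop] (fun n : ℕ => (k n : ℝ)))
    (hk_high : (fun n : ℕ => (k n : ℝ)) =o[atTop] (fun n : ℕ => Real.sqrt n))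
    (h : PlantedCliqueAssumption k) :
    ¬ HasAdditivePTAS {n | 1 ≤ k n ∧ k n < n} (fun n => gClique n (k n)) := by
  intro hPTAS
  apply h
  obtain ⟨P, p, hP⟩ := hPTAS (1 / 64) (by norm_num)
  obtain ⟨C, hC⟩ := randomGraph_optimum (1 / 64) (by norm_num)
  have hev := eventually_add_two_le hk_low hk_high
  obtain ⟨N, hN⟩ := eventually_atTop.1 hev
  -- Taking `C + 1` makes the lower end of the range positive, so every size found by the test is at
  -- least 1.
  obtain ⟨b, hb⟩ := runs_distinguisher (P := P) (C := C + 1) (N := N) (p := p)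
    (Good := fun n G x => x ∈ stdSimplex ℝ (Fin n) ∧ ∀ y ∈ stdSimplex ℝ (Fin n),
      mixValue (gClique n (k n)) (adjLoops G fun _ => false) y - 1 / 64 ≤
        mixValue (gClique n (k n)) (adjLoops G fun _ => false) x) (by
    intro n hn G
    have hkn := hN n hn.le
    obtain ⟨τ, T, h1, h2, h3, h4⟩ := hP n ⟨hkn.1, by omega⟩ n (by omega) (adjQ G) (adjQ_mem_Icc G)
    rw [adjQ_map] at h4
    exact ⟨τ, T, h1, h2, h3, h4⟩)
  have hq : ∀ n, (0 : Polynomial ℕ).eval n = 0 := fun n => Polynomial.eval_zero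
  refine ⟨distinguisher P (C + 1) N, 0, ⟨b, fun n G r => ?_⟩, ?_, ?_⟩
  · obtain ⟨τ, T, h1, h2, -⟩ := hb n G _ (hq n) r
    exact ⟨τ, T, h1, h2⟩
  · have hlim := hC (lowerSize (C + 1)) (fun n => n / 100) (by
      filter_upwards [eventually_gt_atTop 0] with n hn
      refine le_trans (Nat.mul_le_mul_right _ (Nat.le_succ C)) (mul_sq_log_le_lowerSize (C + 1) hn))
      (Eventually.of_forall fun n => Nat.mul_div_le n 100)
    refine tendsto_lintegral_uniformOn_one (fun n G => {r | Rejects _ (graphStore G r)})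
      (Eventually.of_forall isProbabilityMeasure_randomGraph) ?_ hlim
    filter_upwards [eventually_gt_atTop N, eventually_lowerSize_le hk_low (C + 1),
      eventually_mul_hundred_le hk_high] with n hn hl h100 G hG r
    obtain ⟨τ, T, h1, -, h3⟩ := hb n G _ (hq n) r
    obtain ⟨x, t, ⟨hx, -⟩, hround, htest⟩ := h3 hn
    refine ⟨τ, T, h1, ?_⟩
    by_contra hne
    have hpos : 1 ≤ lowerSize (C + 1) n := by
      unfold lowerSize
      have : 1 ≤ (approxLog n + 3) * 2 := by omega
      exact Nat.one_le_iff_ne_zero.2 (by positivity)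
    obtain ⟨k', a1, a2, a3, a4, a5⟩ := exists_le_gClique_of_passesTest hpos (by omega)
      (htest.1 hne)
    have b1 := hG k' a1 a2 a3 (by omega) (fun _ => false) x hx
    have b2 := (abs_le.1 (abs_gClique_sub_le _ _ _ hround a1 a2)).2
    unfold mixValue at b1
    linarith
  · have hlim := plantedGraph_optimum k hk_low (hev.mono fun n hn => by omega) (1 / 64)
      (by norm_num)
    refine tendsto_lintegral_uniformOn_one (fun n G => {r | Accepts _ (graphStore G r)})
      (hev.mono fun n hn => isProbabilityMeasure_plantedGraph (by omega)) ?_ hlim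
    filter_upwards [eventually_gt_atTop N, eventually_lowerSize_le hk_low (C + 1),
      eventually_mul_hundred_le hk_high, hev] with n hn hl h100 hkn G hG r
    obtain ⟨τ, T, h1, -, h3⟩ := hb n G _ (hq n) r
    obtain ⟨x, t, ⟨-, hopt⟩, hround, htest⟩ := h3 hn
    refine ⟨τ, T, h1, htest.2 (passesTest_of_le_gClique hkn.1 (by omega) hl h100 ?_)⟩
    obtain ⟨y, hy, hval⟩ := hG fun _ => false
    have b1 := hopt y hy
    have b2 := (abs_le.1 (abs_gClique_sub_le _ _ _ hround hkn.1 (by omega))).1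
    have b3 : mixValue (gClique n (k n)) (adjLoops G fun _ => false) x =
      gClique n (k n) ((adjLoops G fun _ => false).mulVec x) := rfl
    linarith

end MixSel

/-! ### Assembly of the main theorem -/

theorem mainTheorem11 (k : ℕ → ℕ)
    (hk_low : (fun n : ℕ => Real.log n ^ 2) =o[Filter.atTop] (fun n : ℕ => (k n : ℝ)))
    (hk_high : (fun n : ℕ => (k n : ℝ)) =o[Filter.atTop] (fun n : ℕ => Real.sqrt n)) :
    -- the functions map the cube to `[0,1]` and are 3-Lipschitz, but not O(1)-stable
    (∀ n : ℕ, 1 ≤ k n → k n < n →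
      Set.MapsTo (MixSel.gClique n (k n)) (MixSel.cube n) (Set.Icc 0 1) ∧
      MixSel.IsLipschitz 3 (MixSel.gClique n (k n))) ∧
    (∀ β : ℝ, 0 ≤ β → ∀ᶠ n : ℕ in Filter.atTop, ¬ MixSel.IsStable β (MixSel.gClique n (k n))) ∧
    -- the optimum on a graph with a planted clique
    (∀ ε : ℝ, 0 < ε → Filter.Tendsto (fun n : ℕ => MixSel.plantedGraph n (k n)
        {G | ∀ d : Fin n → Bool, ∃ x ∈ stdSimplex ℝ (Fin n),
          1 - ε ≤ MixSel.mixValue (MixSel.gClique n (k n)) (MixSel.adjLoops G d) x})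
      Filter.atTop (nhds 1)) ∧
    -- the optimum on a random graph
    (∀ ε : ℝ, 0 < ε → Filter.Tendsto (fun n : ℕ => MixSel.randomGraph n
        {G | ∀ d : Fin n → Bool, ∀ x ∈ stdSimplex ℝ (Fin n),
          MixSel.mixValue (MixSel.gClique n (k n)) (MixSel.adjLoops G d) x ≤ 3 / 4 + ε})
      Filter.atTop (nhds 1)) ∧
    -- hardness
    (MixSel.PlantedCliqueAssumption k →
      ¬ MixSel.HasAdditivePTAS {n | 1 ≤ k n ∧ k n < n} (fun n => MixSel.gClique n (k n))) := by
  have hev := MixSel.eventually_add_two_le hk_low hk_high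
  refine ⟨fun n h1 hn => ⟨MixSel.mapsTo_gClique h1 hn, MixSel.isLipschitz_gClique h1 hn⟩, ?_,
    MixSel.plantedGraph_optimum k hk_low (hev.mono fun n hn => by omega), ?_,
    MixSel.not_hasAdditivePTAS k hk_low hk_high⟩
  · intro β _
    filter_upwards [hev, Filter.Tendsto.eventually_gt_atTop tendsto_natCast_atTop_atTop β]
      with n hn hβ
    exact MixSel.not_isStable_gClique hn.1 hn.2 hβ
  · intro ε hε
    obtain ⟨C, hC⟩ := MixSel.randomGraph_optimum ε hε
    have hlow : ∀ᶠ n : ℕ in Filter.atTop, C * (Nat.log 2 n + 1) ^ 2 ≤ k n := by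
      filter_upwards [MixSel.eventually_lowerSize_le hk_low C, Filter.eventually_gt_atTop 0]
        with n h1 hn
      exact (MixSel.mul_sq_log_le_lowerSize C hn).trans h1
    -- Here the range of sizes is the single value `k n`.
    have hlim := hC k k hlow ((MixSel.eventually_mul_hundred_le hk_high).mono fun n hn => by
      rwa [mul_comm])
    refine tendsto_of_tendsto_of_tendsto_of_le_of_le' hlim tendsto_const_nhds ?_ ?_
    · filter_upwards [hev] with n hn
      exact MeasureTheory.measure_mono fun G hG =>
        hG (k n) hn.1 (by omega) le_rfl le_rfl
    · refine Filter.Eventually.of_forall fun n => ?_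
      have := MixSel.isProbabilityMeasure_randomGraph n
      exact MeasureTheory.prob_le_one
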